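/- Let $D\subset\mathbb{R}^2\cong\mathbb{C}$ be a bounded domain (nonempty, open, connected) with $C^2$ boundary, and let $M_n(\mathbb{C})$ be the complex $n\times n$ matrices; ${}^tA$ denotes the transpose of $A$. A potential $v\in C^1(\bar D,M_n(\mathbb{C}))$ is said to satisfy the Dirichlet condition if $0$ is not a Dirichlet eigenvalue of $-\Delta+v$ in $D$, i.e. if the only weak solution $\psi\in H^1_0(D,M_n(\mathbb{C}))$ of $-\Delta\psi+v\psi=0$ in $D$ is $\psi=0$. The Dirichlet-to-Neumann operator $\Phi$ of such a $v$ is defined by $\Phi f=\frac{\partial\psi}{\partial\nu}\big|_{\partial D}$, an element of $L^p(\partial D,M_n(\mathbb{C}))$ for every $p<\infty$, where $\nu$ is the outer normal of $\partial D$ and $\psi\in H^1(D,M_n(\mathbb{C}))$ is the solution of $-\Delta\psi+v\psi=0$ in $D$, $\psi|_{\partial D}=f\in C^1(\partial D,M_n(\mathbb{C}))$. The normal derivative of $\psi$ is defined by Green's formula: $\frac{\partial\psi}{\partial\nu}=g$ means $\int_D(\nabla\varphi\cdot\nabla\psi+\varphi\,\Delta\psi)\,dx=\int_{\partial D}\varphi\,g\,|dz|$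 for all real-valued $\varphi\in C^1(\bar D)$. (a) If $v\in C^1(\bar D,M_n(\mathbb{C}))$ satisfies the Dirichlet condition, then so does ${}^tv$. (b) Let $v_1,v_2\in C^1(\bar D,M_n(\mathbb{C}))$ satisfy the Dirichlet condition, let $\Phi_1,\Phi_2$ be their Dirichlet-to-Neumann operators, and let $u_1,u_2\in C^2(\bar D,M_n(\mathbb{C}))$ satisfy $$(-\Delta+v_1)u_1=0,\qquad (-\Delta+{}^tv_2)u_2=0\qquad\text{on } D.$$ Then $\Phi_1(u_1|_{\partial D})$ and $\Phi_2(u_1|_{\partial D})$ are well defined (the solution exists, and its normal derivative exists and lies in $L^p(\partial D,M_n(\mathbb{C}))$ for every $p<\infty$), the integrands below are integrable, and $$\int_{\partial D}{}^tu_2(z)\,(\Phi_2-\Phi_1)u_1(z)\,|dz|=\int_D{}^tu_2(z)\,(v_2(z)-v_1(z))\,u_1(z)\,d\mathrm{Re}z\,d\mathrm{Im}z.$$ -/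

import Mathlib

open MeasureTheory Filter Topology Set
open scoped Matrix ENNReal

/- The plane `ℝ²` is identified with `ℂ`, the coordinate directions being `1` and `Complex.I`. -/
namespace Alessandrini

/-- `D` has `C²` boundary: near each boundary point, in suitably rotated Cartesian coordinates,
`D` is the set of points lying strictly above the graph of a `C²` function. -/
def HasC2Boundary (D : Set ℂ) : Prop :=
  ∀ z₀ ∈ frontier D, ∃ r : ℝ, 0 < r ∧ ∃ c : ℂ, ‖c‖ = 1 ∧ ∃ γ : ℝ → ℝ, ContDiff ℝ 2 γ ∧
    ∀ z ∈ Metric.ball z₀ r, (z ∈ D ↔ γ (c * z).re < (c * z).im)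

/-- Arc length on `∂D`. -/
noncomputable def arcLength (D : Set ℂ) : Measure ℂ :=
  (Measure.hausdorffMeasure 1 : Measure ℂ).restrict (frontier D)

/-- `φ ∈ C_c^∞(D, F)`. -/
structure IsTestFunction {F : Type*} [NormedAddCommGroup F] [NormedSpace ℝ F]
    (D : Set ℂ) (φ : ℂ → F) : Prop where
  smooth : ContDiff ℝ (⊤ : ℕ∞) φ
  compact : HasCompactSupport φ
  support : tsupport φ ⊆ D

/-- `g` is the weak derivative of `u` in the direction `e` on `D`. -/
def IsWeakDeriv (D : Set ℂ) (e : ℂ) (u g : ℂ → ℂ) : Prop :=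
  ∀ φ : ℂ → ℝ, IsTestFunction D φ →
    ∫ z in D, (fderiv ℝ φ z e) • u z = - ∫ z in D, φ z • g z

/-- `u ∈ H¹(D)`, with weak partial derivatives `ux` and `uy`. -/
structure IsH1 (D : Set ℂ) (u ux uy : ℂ → ℂ) : Prop where
  memLp : MemLp u 2 (volume.restrict D)
  memLp_x : MemLp ux 2 (volume.restrict D)
  memLp_y : MemLp uy 2 (volume.restrict D)
  deriv_x : IsWeakDeriv D 1 u ux
  deriv_y : IsWeakDeriv D Complex.I u uy

/-- `u ∈ H₀¹(D)`, the closure of `C_c^∞(D)` in `H¹(D)`, with weak partial derivatives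
`ux` and `uy`. -/
structure IsH10 (D : Set ℂ) (u ux uy : ℂ → ℂ) : Prop where
  isH1 : IsH1 D u ux uy
  approx : ∃ φ : ℕ → ℂ → ℂ, (∀ k, IsTestFunction D (φ k)) ∧
    Tendsto (fun k => eLpNorm (fun z => φ k z - u z) 2 (volume.restrict D)) atTop (𝓝 0) ∧
    Tendsto (fun k => eLpNorm (fun z => fderiv ℝ (φ k) z 1 - ux z) 2 (volume.restrict D))
      atTop (𝓝 0) ∧
    Tendsto (fun k => eLpNorm (fun z => fderiv ℝ (φ k) z Complex.I - uy z) 2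
      (volume.restrict D)) atTop (𝓝 0)

/-- `Δu = h` weakly in `D`, for `u ∈ H¹` with weak partial derivatives `ux` and `uy`. -/
def IsWeakLaplacian (D : Set ℂ) (ux uy h : ℂ → ℂ) : Prop :=
  ∀ φ : ℂ → ℝ, IsTestFunction D φ →
    ∫ z in D, (fderiv ℝ φ z 1 • ux z + fderiv ℝ φ z Complex.I • uy z + φ z • h z) = 0

/-- `u = f` on `∂D` in the sense of traces, for `u ∈ H¹` with weak partial derivatives `ux`, `uy`
and `f ∈ C¹(∂D)`: there is a `C¹(D̄)` extension `G` of `f` with `u - G ∈ H₀¹`. Only the values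
of `f` on `∂D` matter. -/
def HasBoundaryValue (D : Set ℂ) (u ux uy f : ℂ → ℂ) : Prop :=
  ∃ G : ℂ → ℂ, ContDiffOn ℝ 1 G (closure D) ∧ EqOn G f (frontier D) ∧
    IsH10 D (fun z => u z - G z) (fun z => ux z - fderiv ℝ G z 1)
      (fun z => uy z - fderiv ℝ G z Complex.I)

/-- `∂u/∂ν = g` on `∂D`, `ν` being the outer normal, for `u ∈ H¹` with weak partial derivatives
`ux` and `uy` and weak Laplacian `h`. The normal derivative of such a function is defined by
Green's formula `∫_D (∇φ · ∇u + φ Δu) = ∫_{∂D} φ ∂u/∂ν |dz|` for all `φ ∈ C¹(D̄)`. -/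
def HasNormalDeriv (D : Set ℂ) (ux uy h g : ℂ → ℂ) : Prop :=
  ∀ φ : ℂ → ℝ, ContDiffOn ℝ 1 φ (closure D) →
    ∫ z in D, (fderiv ℝ φ z 1 • ux z + fderiv ℝ φ z Complex.I • uy z + φ z • h z) =
      ∫ z, φ z • g z ∂(arcLength D)

variable {n : ℕ}

/-- `u ∈ C^k(D̄, M_n(ℂ))`. -/
def IsCk (k : ℕ) (D : Set ℂ) (u : ℂ → Matrix (Fin n) (Fin n) ℂ) : Prop :=
  ∀ i j, ContDiffOn ℝ k (fun z => u z i j) (closure D)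

/-- The entrywise Laplacian of a matrix-valued function. -/
noncomputable def matLaplacian (u : ℂ → Matrix (Fin n) (Fin n) ℂ) (z : ℂ) :
    Matrix (Fin n) (Fin n) ℂ :=
  Matrix.of fun i j => Laplacian.laplacian (fun w => u w i j) z

/-- Integrability of a matrix-valued function, entry by entry. -/
def MatIntegrable (u : ℂ → Matrix (Fin n) (Fin n) ℂ) (μ : Measure ℂ) : Prop :=
  ∀ i j, Integrable (fun z => u z i j) μ

/-- The entrywise integral of a matrix-valued function. -/
noncomputable def matIntegral (u : ℂ → Matrix (Fin n) (Fin n) ℂ) (μ : Measure ℂ) :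
    Matrix (Fin n) (Fin n) ℂ :=
  Matrix.of fun i j => ∫ z, u z i j ∂μ

/-- `0` is not a Dirichlet eigenvalue of `-Δ + v` in `D`: the only `M_n(ℂ)`-valued `ψ ∈ H₀¹(D)`
with `-Δψ + vψ = 0` weakly in `D` is `ψ = 0`. -/
def ZeroNotDirichletEigenvalue (D : Set ℂ) (v : ℂ → Matrix (Fin n) (Fin n) ℂ) : Prop :=
  ∀ ψ ψx ψy : ℂ → Matrix (Fin n) (Fin n) ℂ,
    (∀ i j, IsH10 D (fun z => ψ z i j) (fun z => ψx z i j) (fun z => ψy z i j)) →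
    (∀ i j, IsWeakLaplacian D (fun z => ψx z i j) (fun z => ψy z i j)
      (fun z => (v z * ψ z) i j)) →
    ∀ᵐ z ∂(volume.restrict D), ψ z = 0

/-- `g` is the image of the boundary function `f` under the Dirichlet-to-Neumann map of `v`:
`g ∈ L^p(∂D, M_n(ℂ))` for all `p < ∞`, and `g = ∂ψ/∂ν` on `∂D` for an `H¹` solution `ψ` of
`-Δψ + vψ = 0` in `D`, `ψ = f` on `∂D`. -/
def IsDtN (D : Set ℂ) (v f g : ℂ → Matrix (Fin n) (Fin n) ℂ) : Prop :=
  (∀ i j, ∀ p : ℝ≥0∞, p ≠ ⊤ → MemLp (fun z => g z i j) p (arcLength D)) ∧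
  ∃ ψ ψx ψy : ℂ → Matrix (Fin n) (Fin n) ℂ, ∀ i j,
    IsH1 D (fun z => ψ z i j) (fun z => ψx z i j) (fun z => ψy z i j) ∧
    IsWeakLaplacian D (fun z => ψx z i j) (fun z => ψy z i j) (fun z => (v z * ψ z) i j) ∧
    HasBoundaryValue D (fun z => ψ z i j) (fun z => ψx z i j) (fun z => ψy z i j)
      (fun z => f z i j) ∧
    HasNormalDeriv D (fun z => ψx z i j) (fun z => ψy z i j) (fun z => (v z * ψ z) i j)
      (fun z => g z i j)

open Classical in
/-- The Dirichlet-to-Neumann operator of `v`, applied to the boundary function `f`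
(zero if there is no image). -/
noncomputable def dtn (D : Set ℂ) (v f : ℂ → Matrix (Fin n) (Fin n) ℂ) :
    ℂ → Matrix (Fin n) (Fin n) ℂ :=
  if h : ∃ g, IsDtN D v f g then h.choose else 0

end Alessandrini

open scoped ContDiff Convolution

namespace Alessandrini

section

/-! ### Test functions, mollification and integration by parts -/

section TestFunctions

variable {F : Type*} [NormedAddCommGroup F] [NormedSpace ℝ F]

/-! The identity is Green's formula used twice. Let `ψ` solve the equation of a potential `v` with
boundary values `u₁`, and let `g` be its normal derivative. Testing `g` with the entries of `u₂`
gives `∫_∂D ᵗu₂ g = ∫_D (∇u₂ · ∇ψ + ᵗu₂ v ψ)`. Since `ψ - u₁` lies in `H₀¹`, it may be inserted into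
the weak equation of `u₂`, which trades `∇ψ` for `∇u₁` at the price of the term `-ᵗu₂ v₂ (ψ - u₁)`
(`IsDtN.exists_integral_eq`). For `v = v₂` the unknown `ψ` then cancels; for `v = v₁` the Dirichlet
condition gives `ψ = u₁`. In the difference the gradient terms disappear and the potentials remain.

The labour lies in the existence of `ψ` and of its normal derivative. For `ψ`: Riesz representation
on `H₀¹` gives a solution operator `T` of `-Δ + 1`. Stampacchia's level-set iteration bounds
`‖Tf‖_∞` by `‖f‖₂`, and over a finite measure an operator from `L²` to `L^∞` is Hilbert–Schmidt,
hence compact; no Rellich theorem is needed. The Fredholm alternative for `w + T((v - 1)w) = TF`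
turns the Dirichlet condition into solvability of `-Δw + vw = F` (`exists_isH10_solution`). Part (a)
is then duality: if `ψ` solves the transposed equation, solve `-Δw + vw = conj ψ` and test each
equation with the other solution; this leaves `∫ |ψ|² = 0`.

For the normal derivative: `ψ = u₁ + w` with `w` in `H₀¹` and `Δw` bounded. Barriers outside
exterior discs give `|w| ≤ C dist(·, ∂D)` (`IsH10.exists_le_infDist`). No bound on `∇w` up to the
boundary is used. The left side of Green's formula, as a functional of the test function, sees only
thin strips along `∂D`; there an integration by parts moves the derivative from `w` to the cutoff,
and the decay of `w` pays for the extra power of the width. So this functional is bounded by the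
`L¹(∂D)` norm (`HasStripBound.hasFluxBound`), and Hahn–Banach with Riesz represents it by a bounded
density, the normal derivative (`HasFluxBound.exists_hasNormalDeriv`). -/

theorem IsTestFunction.contDiff_one {D : Set ℂ} {φ : ℂ → F} (h : IsTestFunction D φ) :
    ContDiff ℝ 1 φ := h.smooth.of_le (by exact_mod_cast le_top)

/-- A `C¹` function with compact support in `D` is a limit of test functions in the `C¹` norm. -/
theorem exists_isTestFunction_near [CompleteSpace F] {D : Set ℂ} (hD : IsOpen D) {f : ℂ → F}
    (hf : ContDiff ℝ 1 f) (hc : HasCompactSupport f) (hs : tsupport f ⊆ D) {ε : ℝ} (hε : 0 < ε) :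
    ∃ φ : ℂ → F, IsTestFunction D φ ∧ (∀ z, ‖φ z - f z‖ ≤ ε) ∧
      ∀ z, ‖fderiv ℝ φ z - fderiv ℝ f z‖ ≤ ε := by
  obtain ⟨δ₀, hδ₀, hδ₀'⟩ := hc.isCompact.exists_cthickening_subset_open hD hs
  have hcf : Continuous (fderiv ℝ f) := hf.continuous_fderiv one_ne_zero
  have u1 : UniformContinuous f := hc.uniformContinuous_of_continuous hf.continuous
  have u2 : UniformContinuous (fderiv ℝ f) :=
    (hc.fderiv ℝ).uniformContinuous_of_continuous hcf
  obtain ⟨δ₁, hδ₁, h1⟩ := Metric.uniformContinuous_iff.1 u1 ε hε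
  obtain ⟨δ₂, hδ₂, h2⟩ := Metric.uniformContinuous_iff.1 u2 ε hε
  -- The mollification radius: `δ₀` keeps the support inside `D`, while `δ₁` and `δ₂` are moduli of
  -- uniform continuity of `f` and of its derivative.
  set δ := min δ₀ (min δ₁ δ₂) with hδ
  have hδpos : 0 < δ := by positivity
  let b : ContDiffBump (0 : ℂ) := ⟨δ / 2, δ, by positivity, by linarith⟩
  set φ : ℂ → F := (b.normed volume) ⋆[ContinuousLinearMap.lsmul ℝ ℝ, volume] f with hφ
  have hder : ∀ z, HasFDerivAt φ
      (((b.normed volume) ⋆[ContinuousLinearMap.lsmul ℝ ℝ, volume] (fderiv ℝ f)) z) z := by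
    intro z
    have := hc.hasFDerivAt_convolution_right (ContinuousLinearMap.lsmul ℝ ℝ)
      ((b.continuous_normed (μ := volume)).locallyIntegrable (μ := volume)) hf z
    have e : (ContinuousLinearMap.lsmul ℝ ℝ : ℝ →L[ℝ] F →L[ℝ] F).precompR ℂ =
        ContinuousLinearMap.lsmul ℝ ℝ := by
      ext; rfl
    rwa [e] at this
  refine ⟨φ, ⟨?_, ?_, ?_⟩, ?_, ?_⟩
  · exact b.hasCompactSupport_normed.contDiff_convolution_left _
      b.contDiff_normed hf.continuous.locallyIntegrable
  · exact HasCompactSupport.convolution _ b.hasCompactSupport_normed hc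
  · refine subset_trans (closure_minimal ?_ Metric.isClosed_cthickening) hδ₀'
    refine (support_convolution_subset _).trans ?_
    rintro z ⟨x, hx, y, hy, rfl⟩
    have hx' : x ∈ Metric.ball (0 : ℂ) δ := by
      rw [b.support_normed_eq] at hx; exact hx
    refine Metric.mem_cthickening_of_dist_le _ y _ _ (subset_tsupport f hy) ?_
    simp only [dist_add_self_left]
    exact (mem_ball_zero_iff.1 hx').le.trans (min_le_left _ _)
  · intro z
    rw [← dist_eq_norm]
    refine b.dist_normed_convolution_le hf.continuous.aestronglyMeasurable fun x hx => ?_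
    exact (h1 (lt_of_lt_of_le hx ((min_le_right _ _).trans (min_le_left _ _)))).le
  · intro z
    rw [(hder z).fderiv, ← dist_eq_norm]
    refine b.dist_normed_convolution_le hcf.aestronglyMeasurable fun x hx => ?_
    exact (h2 (lt_of_lt_of_le hx ((min_le_right _ _).trans (min_le_right _ _)))).le

/-- Integration by parts against a compactly supported `C¹` function. -/
theorem setIntegral_fderiv_smul_eq_neg {D : Set ℂ} (hD : IsOpen D) {φ : ℂ → ℝ} {u : ℂ → F}
    (hφ : ContDiff ℝ 1 φ) (hc : HasCompactSupport φ) (hs : tsupport φ ⊆ D)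
    (hu : ContDiffOn ℝ 1 u D) (e : ℂ) :
    ∫ z in D, fderiv ℝ φ z e • u z = - ∫ z in D, φ z • fderiv ℝ u z e := by
  have hsupp1 : Function.support (fun z => fderiv ℝ φ z e • u z) ⊆ tsupport φ := by
    intro z hz
    by_contra h
    exact hz (by simp [fderiv_of_notMem_tsupport ℝ h])
  have hsupp2 : Function.support (fun z => φ z • fderiv ℝ u z e) ⊆ tsupport φ := by
    intro z hz
    by_contra h
    exact hz (by simp [image_eq_zero_of_notMem_tsupport h])
  have hsupp3 : Function.support (fun z => φ z • u z) ⊆ tsupport φ := by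
    intro z hz
    by_contra h
    exact hz (by simp [image_eq_zero_of_notMem_tsupport h])
  have hK : IsCompact (tsupport φ) := hc
  have cu : ContinuousOn u (tsupport φ) := hu.continuousOn.mono hs
  have cu' : ContinuousOn (fun z => fderiv ℝ u z e) (tsupport φ) :=
    ((hu.continuousOn_fderiv_of_isOpen hD le_rfl).clm_apply continuousOn_const).mono hs
  have cφ' : Continuous (fun z => fderiv ℝ φ z e) :=
    (hφ.continuous_fderiv one_ne_zero).clm_apply continuous_const
  have i1 : Integrable (fun z => fderiv ℝ φ z e • u z) := by
    rw [← integrableOn_iff_integrable_of_support_subset hsupp1]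
    exact (cφ'.continuousOn.smul cu).integrableOn_compact hK
  have i2 : Integrable (fun z => φ z • fderiv ℝ u z e) := by
    rw [← integrableOn_iff_integrable_of_support_subset hsupp2]
    exact (hφ.continuous.continuousOn.smul cu').integrableOn_compact hK
  have i3 : Integrable (fun z => φ z • u z) := by
    rw [← integrableOn_iff_integrable_of_support_subset hsupp3]
    exact (hφ.continuous.continuousOn.smul cu).integrableOn_compact hK
  -- Both integrands live on `tsupport φ ⊆ D`, so the integrals may be taken over the whole plane,
  -- where `u` need only be differentiable on the support of `φ`.
  rw [setIntegral_eq_integral_of_forall_compl_eq_zero (fun z hz => ?_),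
    setIntegral_eq_integral_of_forall_compl_eq_zero (fun z hz => ?_),
    integral_smul_fderiv_eq_neg_fderiv_smul_of_integrable i1 i2 i3 ?_ ?_, neg_neg]
  · exact fun z _ => hφ.differentiable one_ne_zero z
  · exact fun z hz => (hu.differentiableOn one_ne_zero z (hs hz)).differentiableAt
      (hD.mem_nhds (hs hz))
  · exact Function.notMem_support.1 fun h => hz (hs (hsupp2 h))
  · exact Function.notMem_support.1 fun h => hz (hs (hsupp1 h))

/-- A `C¹` function on `D̄` is bounded on `D`, together with its derivative. -/
theorem exists_bound_fderiv {D : Set ℂ} (hD : IsOpen D) (hb : Bornology.IsBounded D)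
    {f : ℂ → F} (hf : ContDiffOn ℝ 1 f (closure D)) :
    ∃ C, 0 ≤ C ∧ ∀ z ∈ D, ‖f z‖ ≤ C ∧ ‖fderiv ℝ f z‖ ≤ C := by
  have hK : IsCompact (closure D) := hb.isCompact_closure
  have key : ∃ C, ∀ z ∈ closure D ∩ D, ‖f z‖ ≤ C ∧ ‖fderiv ℝ f z‖ ≤ C := by
    refine hK.induction_on (p := fun s => ∃ C, ∀ z ∈ s ∩ D, ‖f z‖ ≤ C ∧ ‖fderiv ℝ f z‖ ≤ C)
      ⟨0, by simp⟩ ?_ ?_ ?_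
    · rintro s t hst ⟨C, hC⟩
      exact ⟨C, fun z hz => hC z ⟨hst hz.1, hz.2⟩⟩
    · rintro s t ⟨C, hC⟩ ⟨C', hC'⟩
      refine ⟨max C C', ?_⟩
      rintro z ⟨hz | hz, hzD⟩
      · exact (hC z ⟨hz, hzD⟩).imp (le_max_of_le_left) (le_max_of_le_left)
      · exact (hC' z ⟨hz, hzD⟩).imp (le_max_of_le_right) (le_max_of_le_right)
    · intro x hx
      -- At a boundary point, `ContDiffOn` provides a Taylor series on a relative neighbourhood. Its
      -- first coefficient is continuous up to the boundary and equals `fderiv` at the points of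
      -- `D`; outside `D`, `fderiv` carries no such information.
      obtain ⟨u, hu, p, hp⟩ := (hf x hx) 1 le_rfl
      have hxu : x ∈ u := mem_of_mem_nhdsWithin (mem_insert _ _) hu
      rw [insert_eq_of_mem hx] at hu
      have c1 : ContinuousWithinAt f u x := hp.continuousOn x hxu
      have c2 : ContinuousWithinAt (fun y => p y 1) u x := hp.cont 1 le_rfl x hxu
      have e1 : ∀ᶠ y in 𝓝[closure D] x, ‖f y‖ < ‖f x‖ + 1 ∧ ‖p y 1‖ < ‖p x 1‖ + 1 := by
        have : 𝓝[closure D] x ≤ 𝓝[u] x := le_inf inf_le_left (le_principal_iff.2 hu)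
        refine this ?_
        exact (c1.norm.eventually (gt_mem_nhds (by simp))).and
          (c2.norm.eventually (gt_mem_nhds (by simp)))
      have e2 : ∀ᶠ y in 𝓝[closure D] x, ∃ v ∈ 𝓝 y, v ∩ closure D ⊆ u := by
        obtain ⟨v, hv, hvu⟩ := mem_nhdsWithin_iff_exists_mem_nhds_inter.1 hu
        exact mem_nhdsWithin_of_mem_nhds ((eventually_mem_nhds_iff.2 hv).mono fun y hy =>
          ⟨v, hy, hvu⟩)
      refine ⟨_, e1.and e2, max (‖f x‖ + 1) (‖p x 1‖ + 1), ?_⟩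
      rintro z ⟨⟨⟨h1, h2⟩, v, hv, hvu⟩, hzD⟩
      refine ⟨h1.le.trans (le_max_left _ _), le_trans ?_ (le_max_right _ _)⟩
      have hzu : u ∈ 𝓝 z := mem_of_superset (inter_mem hv (mem_of_superset (hD.mem_nhds hzD)
        subset_closure)) hvu
      rw [(hp.hasFDerivAt (by norm_num) hzu).fderiv]
      refine le_trans (le_of_eq ?_) h2.le
      exact LinearIsometryEquiv.norm_map _ _
  obtain ⟨C, hC⟩ := key
  refine ⟨max C 0, le_max_right _ _, fun z hz => ?_⟩
  exact (hC z ⟨subset_closure hz, hz⟩).imp (le_max_of_le_left) (le_max_of_le_left)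

end TestFunctions

end

section

/-! ### Convergence in `L²` -/

section L2

variable {α : Type*} {mα : MeasurableSpace α} {μ : Measure α}
  {F : Type*} [NormedAddCommGroup F]

theorem tendsto_eLpNorm_two_of_dominated {f : ℕ → α → F} {G : α → ℝ}
    (hf : ∀ k, AEStronglyMeasurable (f k) μ) (hG : MemLp G 2 μ)
    (hle : ∀ k, ∀ᵐ x ∂μ, ‖f k x‖ ≤ G x) (hlim : ∀ᵐ x ∂μ, Tendsto (fun k => f k x) atTop (𝓝 0)) :
    Tendsto (fun k => eLpNorm (f k) 2 μ) atTop (𝓝 0) := by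
  have e : ∀ k, eLpNorm (f k) 2 μ = (∫⁻ x, ‖f k x‖ₑ ^ (2 : ℝ) ∂μ) ^ (1 / (2 : ℝ)) := fun k => by
    rw [eLpNorm_eq_lintegral_rpow_enorm_toReal two_ne_zero ENNReal.ofNat_ne_top]; simp
  simp_rw [e]
  have h0 : Tendsto (fun k => ∫⁻ x, ‖f k x‖ₑ ^ (2 : ℝ) ∂μ) atTop (𝓝 (∫⁻ _, 0 ∂μ)) := by
    refine tendsto_lintegral_of_dominated_convergence' (fun x => ‖G x‖ₑ ^ (2 : ℝ)) ?_ ?_ ?_ ?_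
    · exact fun k => (hf k).enorm.pow_const _
    · intro k
      filter_upwards [hle k] with x hx
      gcongr
      rw [enorm_le_iff_norm_le]
      exact hx.trans (le_abs_self _)
    · have := hG.eLpNorm_lt_top
      rw [eLpNorm_lt_top_iff_lintegral_rpow_enorm_lt_top two_ne_zero ENNReal.ofNat_ne_top] at this
      simpa using this.ne
    · filter_upwards [hlim] with x hx
      have := (hx.enorm).ennrpow_const 2
      simpa using this
  rw [lintegral_zero] at h0
  have := h0.ennrpow_const (1 / 2)
  simpa using this

theorem tendsto_eLpNorm_of_le_add {f : ℕ → α → F} {a b : ℕ → ℝ≥0∞} {p : ℝ≥0∞}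
    (h : ∀ k, eLpNorm (f k) p μ ≤ a k + b k) (ha : Tendsto a atTop (𝓝 0))
    (hb : Tendsto b atTop (𝓝 0)) : Tendsto (fun k => eLpNorm (f k) p μ) atTop (𝓝 0) := by
  have := ha.add hb
  rw [add_zero] at this
  exact tendsto_of_tendsto_of_tendsto_of_le_of_le tendsto_const_nhds this (fun _ => zero_le) h

/-- By Cauchy–Schwarz, `L²` convergence of one factor gives `L¹` convergence of the product. This is
how weak identities pass from test functions to their limits in `H₀¹`. -/
theorem tendsto_integral_smul_of_tendsto_eLpNorm {𝕜 : Type*} [NormedField 𝕜] [NormedSpace ℝ F]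
    [NormedSpace 𝕜 F]
    {g : ℕ → α → 𝕜} {G : α → 𝕜} {h : α → F} (hg : ∀ k, MemLp (g k) 2 μ) (hG : MemLp G 2 μ)
    (hh : MemLp h 2 μ) (hlim : Tendsto (fun k => eLpNorm (fun x => g k x - G x) 2 μ) atTop (𝓝 0)) :
    Tendsto (fun k => ∫ x, g k x • h x ∂μ) atTop (𝓝 (∫ x, G x • h x ∂μ)) := by
  refine tendsto_integral_of_L1' _ (memLp_one_iff_integrable.1 (hh.smul hG)).1
    (Eventually.of_forall fun k => memLp_one_iff_integrable.1 (hh.smul (hg k))) ?_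
  have h1 : ∀ k, eLpNorm ((fun x => g k x • h x) - fun x => G x • h x) 1 μ ≤
      eLpNorm (fun x => g k x - G x) 2 μ * eLpNorm h 2 μ := by
    intro k
    have : ((fun x => g k x • h x) - fun x => G x • h x) = (fun x => g k x - G x) • h := by
      ext x; simp [sub_smul]
    rw [this]
    exact eLpNorm_smul_le_mul_eLpNorm hh.1 ((hg k).1.sub hG.1)
  have h2 := ENNReal.Tendsto.mul_const hlim (Or.inr hh.eLpNorm_ne_top)
  rw [zero_mul] at h2
  exact tendsto_of_tendsto_of_tendsto_of_le_of_le tendsto_const_nhds h2 (fun _ => zero_le) h1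

end L2

/-! ### Bounded continuous functions on a bounded open set -/

theorem isFiniteMeasure_restrict {D : Set ℂ} (hb : Bornology.IsBounded D) :
    IsFiniteMeasure (volume.restrict D) :=
  ⟨by rw [Measure.restrict_apply_univ]; exact hb.measure_lt_top⟩

theorem memLp_of_continuousOn_of_bound {F : Type*} [NormedAddCommGroup F] {D : Set ℂ}
    (hD : IsOpen D) (hb : Bornology.IsBounded D) {f : ℂ → F} [SecondCountableTopology F]
    (hf : ContinuousOn f D) {C : ℝ} (hC : ∀ z ∈ D, ‖f z‖ ≤ C) (p : ℝ≥0∞) :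
    MemLp f p (volume.restrict D) := by
  have := isFiniteMeasure_restrict hb
  refine MemLp.of_bound (hf.aestronglyMeasurable hD.measurableSet) C ?_
  exact (ae_restrict_iff' hD.measurableSet).2 (Eventually.of_forall hC)

theorem _root_.Continuous.memLp_restrict {F : Type*} [NormedAddCommGroup F] {D : Set ℂ}
    (hD : IsOpen D) (hb : Bornology.IsBounded D) {f : ℂ → F} [SecondCountableTopology F]
    (hf : Continuous f) (p : ℝ≥0∞) : MemLp f p (volume.restrict D) := by
  obtain ⟨C, hC⟩ := hb.isCompact_closure.exists_bound_of_continuousOn hf.continuousOn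
  exact memLp_of_continuousOn_of_bound hD hb hf.continuousOn
    (fun z hz => hC z (subset_closure hz)) p

theorem _root_.ContDiff.memLp_fderiv_restrict {F : Type*} [NormedAddCommGroup F]
    [NormedSpace ℝ F] {D : Set ℂ} (hD : IsOpen D) (hb : Bornology.IsBounded D) {f : ℂ → F}
    [SecondCountableTopology F] (hf : ContDiff ℝ 1 f) (e : ℂ) (p : ℝ≥0∞) :
    MemLp (fun z => fderiv ℝ f z e) p (volume.restrict D) :=
  ((hf.continuous_fderiv one_ne_zero).clm_apply continuous_const).memLp_restrict hD hb p

/-! ### Real-valued `H₀¹` functions -/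

/-- `u ∈ H₀¹(D)` real-valued, with weak partial derivatives `ux` and `uy`. -/
structure RealH10 (D : Set ℂ) (u ux uy : ℂ → ℝ) : Prop where
  memLp : MemLp u 2 (volume.restrict D)
  memLp_x : MemLp ux 2 (volume.restrict D)
  memLp_y : MemLp uy 2 (volume.restrict D)
  approx : ∃ φ : ℕ → ℂ → ℝ, (∀ k, IsTestFunction D (φ k)) ∧
    Tendsto (fun k => eLpNorm (fun z => φ k z - u z) 2 (volume.restrict D)) atTop (𝓝 0) ∧
    Tendsto (fun k => eLpNorm (fun z => fderiv ℝ (φ k) z 1 - ux z) 2 (volume.restrict D))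
      atTop (𝓝 0) ∧
    Tendsto (fun k => eLpNorm (fun z => fderiv ℝ (φ k) z Complex.I - uy z) 2
      (volume.restrict D)) atTop (𝓝 0)

/-- The real part of a complex multiple of an `H₀¹` function. -/
theorem IsH10.re_mul {D : Set ℂ} {u ux uy : ℂ → ℂ} (h : IsH10 D u ux uy) (c : ℂ) :
    RealH10 D (fun z => (c * u z).re) (fun z => (c * ux z).re) (fun z => (c * uy z).re) := by
  obtain ⟨φ, hφ, h0, h1, h2⟩ := h.approx
  have hre : ∀ {f : ℂ → ℂ}, MemLp f 2 (volume.restrict D) →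
      MemLp (fun z => (c * f z).re) 2 (volume.restrict D) := fun hf => (hf.const_mul c).re
  have key : ∀ (f : ℕ → ℂ → ℂ) (g : ℂ → ℂ),
      Tendsto (fun k => eLpNorm (fun z => f k z - g z) 2 (volume.restrict D)) atTop (𝓝 0) →
      Tendsto (fun k => eLpNorm (fun z => (c * f k z).re - (c * g z).re) 2 (volume.restrict D))
        atTop (𝓝 0) := by
    intro f g hfg
    have hb : ∀ k, eLpNorm (fun z => (c * f k z).re - (c * g z).re) 2 (volume.restrict D) ≤
        ENNReal.ofReal ‖c‖ * eLpNorm (fun z => f k z - g z) 2 (volume.restrict D) := by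
      intro k
      refine eLpNorm_le_mul_eLpNorm_of_ae_le_mul (Eventually.of_forall fun z => ?_) 2
      rw [← norm_mul, ← Complex.sub_re, ← mul_sub]
      exact Complex.abs_re_le_norm _
    have := ENNReal.Tendsto.const_mul hfg (a := ENNReal.ofReal ‖c‖) (Or.inr ENNReal.ofReal_ne_top)
    rw [mul_zero] at this
    exact tendsto_of_tendsto_of_tendsto_of_le_of_le tendsto_const_nhds this (fun _ => zero_le) hb
  let A : ℂ →L[ℝ] ℝ := Complex.reCLM.comp (ContinuousLinearMap.mul ℝ ℂ c)
  have hA : ∀ k z e, fderiv ℝ (fun z => (c * φ k z).re) z e = (c * fderiv ℝ (φ k) z e).re := by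
    intro k z e
    have := (A.hasFDerivAt.comp z
      (((hφ k).contDiff_one.differentiable one_ne_zero) z).hasFDerivAt).fderiv
    exact congrArg (fun T : ℂ →L[ℝ] ℝ => T e) this
  refine ⟨hre h.isH1.memLp, hre h.isH1.memLp_x, hre h.isH1.memLp_y,
    fun k z => (c * φ k z).re, fun k => ⟨A.contDiff.comp (hφ k).smooth, ?_, ?_⟩, key _ _ h0, ?_, ?_⟩
  · exact (hφ k).compact.comp_left (g := A) (map_zero A)
  · exact (closure_mono (Function.support_comp_subset (map_zero A) (φ k))).trans (hφ k).support
  · simp_rw [hA]; exact key _ _ h1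
  · simp_rw [hA]; exact key _ _ h2

section RealH10

variable {D : Set ℂ} {u ux uy : ℂ → ℝ}

theorem IsTestFunction.memLp {F : Type*} [NormedAddCommGroup F] [NormedSpace ℝ F]
    [SecondCountableTopology F] (hD : IsOpen D) (hb : Bornology.IsBounded D) {φ : ℂ → F}
    (h : IsTestFunction D φ) : MemLp φ 2 (volume.restrict D) :=
  h.smooth.continuous.memLp_restrict hD hb 2

theorem IsTestFunction.memLp_fderiv {F : Type*} [NormedAddCommGroup F] [NormedSpace ℝ F]
    [SecondCountableTopology F] (hD : IsOpen D) (hb : Bornology.IsBounded D) {φ : ℂ → F}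
    (h : IsTestFunction D φ) (e : ℂ) :
    MemLp (fun z => fderiv ℝ φ z e) 2 (volume.restrict D) :=
  h.contDiff_one.memLp_fderiv_restrict hD hb e 2

/-- A weak equation tested with `C_c^∞(D)` may be tested with `H₀¹(D)`. -/
theorem RealH10.integral_eq {F : Type*} [NormedAddCommGroup F] [NormedSpace ℝ F]
    (hD : IsOpen D) (hb : Bornology.IsBounded D) (hu : RealH10 D u ux uy) {a b c : ℂ → F}
    (ha : MemLp a 2 (volume.restrict D)) (hb' : MemLp b 2 (volume.restrict D))
    (hc : MemLp c 2 (volume.restrict D))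
    (h : ∀ φ : ℂ → ℝ, IsTestFunction D φ →
      ∫ z in D, (fderiv ℝ φ z 1 • a z + fderiv ℝ φ z Complex.I • b z + φ z • c z) = 0) :
    ∫ z in D, (ux z • a z + uy z • b z + u z • c z) = 0 := by
  obtain ⟨φ, hφ, h0, h1, h2⟩ := hu.approx
  have int : ∀ {f : ℂ → ℝ} {g : ℂ → F}, MemLp f 2 (volume.restrict D) →
      MemLp g 2 (volume.restrict D) → Integrable (fun z => f z • g z) (volume.restrict D) :=
    fun hf hg => memLp_one_iff_integrable.1 (hg.smul hf)
  have t0 := tendsto_integral_smul_of_tendsto_eLpNorm (fun k => (hφ k).memLp hD hb) hu.memLp hc h0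
  have t1 := tendsto_integral_smul_of_tendsto_eLpNorm (fun k => (hφ k).memLp_fderiv hD hb 1)
    hu.memLp_x ha h1
  have t2 := tendsto_integral_smul_of_tendsto_eLpNorm
    (fun k => (hφ k).memLp_fderiv hD hb Complex.I) hu.memLp_y hb' h2
  have t := (t1.add t2).add t0
  have hsum : ∀ {f g h : ℂ → ℝ}, MemLp f 2 (volume.restrict D) → MemLp g 2 (volume.restrict D) →
      MemLp h 2 (volume.restrict D) → ∫ z in D, (f z • a z + g z • b z + h z • c z) =
        (∫ z in D, f z • a z) + (∫ z in D, g z • b z) + ∫ z in D, h z • c z := by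
    intro f g h hf hg hh
    rw [integral_add (f := fun z => f z • a z + g z • b z) ((int hf ha).add (int hg hb'))
      (int hh hc), integral_add (int hf ha) (int hg hb')]
  rw [hsum hu.memLp_x hu.memLp_y hu.memLp]
  refine tendsto_nhds_unique t (tendsto_const_nhds.congr fun k => ?_)
  rw [← hsum ((hφ k).memLp_fderiv hD hb 1) ((hφ k).memLp_fderiv hD hb Complex.I)
    ((hφ k).memLp hD hb)]
  exact (h _ (hφ k)).symm

/-- The endpoint Sobolev inequality: `2` is the conjugate exponent of the dimension `2`. Having the
gradient in `L¹` rather than `L²` later yields a factor equal to the measure of a level set. -/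
theorem exists_eLpNorm_le_fderiv : ∃ C : ENNReal, C ≠ ⊤ ∧ ∀ f : ℂ → ℝ, ContDiff ℝ 1 f →
    HasCompactSupport f → eLpNorm f 2 volume ≤ C * eLpNorm (fderiv ℝ f) 1 volume := by
  have hp : NNReal.HolderConjugate (Module.finrank ℝ ℂ) 2 := by
    rw [Complex.finrank_real_complex]
    exact_mod_cast (NNReal.HolderConjugate.two_two)
  exact ⟨((eLpNormLESNormFDerivOneConst (volume : Measure ℂ) (2 : NNReal) : NNReal) : ENNReal),
    ENNReal.coe_ne_top, fun f hf hc => eLpNorm_le_eLpNorm_fderiv_one volume hf hc hp⟩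

/-- The Gagliardo–Nirenberg–Sobolev inequality in `H₀¹`. -/
theorem exists_eLpNorm_le : ∃ C : ENNReal, C ≠ ⊤ ∧ ∀ (D : Set ℂ), IsOpen D →
    Bornology.IsBounded D → ∀ u ux uy : ℂ → ℝ, RealH10 D u ux uy →
    eLpNorm u 2 (volume.restrict D) ≤
      C * (eLpNorm ux 1 (volume.restrict D) + eLpNorm uy 1 (volume.restrict D)) := by
  obtain ⟨C, hCtop, hC⟩ := exists_eLpNorm_le_fderiv
  refine ⟨C, hCtop, ?_⟩
  intro D hD hb u ux uy hu
  have hfin := isFiniteMeasure_restrict hb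
  obtain ⟨φ, hφ, h0, h1, h2⟩ := hu.approx
  have base : ∀ k, eLpNorm (φ k) 2 (volume.restrict D) ≤
      C * (eLpNorm (fun z => fderiv ℝ (φ k) z 1) 1 (volume.restrict D) +
        eLpNorm (fun z => fderiv ℝ (φ k) z Complex.I) 1 (volume.restrict D)) := by
    intro k
    have hcd := (hφ k).contDiff_one
    have i1 := hC _ hcd (hφ k).compact
    have hsub : Function.support (fderiv ℝ (φ k)) ⊆ D :=
      (support_fderiv_subset ℝ).trans (hφ k).support
    have i2 : eLpNorm (fderiv ℝ (φ k)) 1 volume = eLpNorm (fderiv ℝ (φ k)) 1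
        (volume.restrict D) := by
      rw [← eLpNorm_norm, ← eLpNorm_norm (fderiv ℝ (φ k))]
      refine (eLpNorm_restrict_eq_of_support_subset ?_).symm
      exact fun z hz => hsub (by simpa using hz)
    have i3 : eLpNorm (fderiv ℝ (φ k)) 1 (volume.restrict D) ≤
        eLpNorm (fun z => ‖fderiv ℝ (φ k) z 1‖ + ‖fderiv ℝ (φ k) z Complex.I‖) 1
          (volume.restrict D) := by
      refine eLpNorm_mono_real fun z => ?_
      refine ContinuousLinearMap.opNorm_le_bound _ (by positivity) fun w => ?_
      have : w = w.re • (1 : ℂ) + w.im • Complex.I := by simp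
      conv_lhs => rw [this]
      rw [map_add, map_smul, map_smul]
      refine (norm_add_le _ _).trans ?_
      rw [norm_smul, norm_smul, add_mul, mul_comm ‖w.re‖, mul_comm ‖w.im‖]
      gcongr
      · exact Complex.abs_re_le_norm w
      · exact Complex.abs_im_le_norm w
    have c1 : ∀ e, AEStronglyMeasurable (fun z => ‖fderiv ℝ (φ k) z e‖) (volume.restrict D) :=
      fun e => ((hφ k).memLp_fderiv hD hb e).1.norm
    have i4 := eLpNorm_add_le (c1 1) (c1 Complex.I) le_rfl
    rw [eLpNorm_norm, eLpNorm_norm] at i4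
    calc eLpNorm (φ k) 2 (volume.restrict D) ≤ eLpNorm (φ k) 2 volume :=
          eLpNorm_mono_measure _ Measure.restrict_le_self
      _ ≤ C * eLpNorm (fderiv ℝ (φ k)) 1 (volume.restrict D) := by rw [← i2]; exact i1
      _ ≤ _ := by gcongr; exact i3.trans i4
  -- The Hölder factor `|D|^(1/2)`: the approximation is in `L²`, but the inequality needs the
  -- gradients in `L¹`.
  set m : ENNReal := volume.restrict D univ ^ (1 / (1 : ENNReal).toReal - 1 / (2 : ENNReal).toReal)
  have hm : m ≠ ⊤ := ENNReal.rpow_ne_top_of_nonneg (by norm_num) (measure_ne_top _ _)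
  have step : ∀ (f : ℕ → ℂ → ℝ) (g : ℂ → ℝ), (∀ k, MemLp (f k) 2 (volume.restrict D)) →
      MemLp g 2 (volume.restrict D) → ∀ k, eLpNorm (f k) 1 (volume.restrict D) ≤
      eLpNorm g 1 (volume.restrict D) +
        eLpNorm (fun z => f k z - g z) 2 (volume.restrict D) * m := by
    intro f g hf hg k
    have := eLpNorm_add_le hg.1 ((hf k).1.sub hg.1) le_rfl
    rw [add_sub_cancel] at this
    refine this.trans ?_
    gcongr
    exact eLpNorm_le_eLpNorm_mul_rpow_measure_univ one_le_two ((hf k).1.sub hg.1)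
  have final : ∀ k, eLpNorm u 2 (volume.restrict D) ≤
      eLpNorm (fun z => φ k z - u z) 2 (volume.restrict D) +
      C * ((eLpNorm ux 1 (volume.restrict D) +
        eLpNorm (fun z => fderiv ℝ (φ k) z 1 - ux z) 2 (volume.restrict D) * m) +
        (eLpNorm uy 1 (volume.restrict D) +
        eLpNorm (fun z => fderiv ℝ (φ k) z Complex.I - uy z) 2 (volume.restrict D) * m)) := by
    intro k
    have hk := (hφ k).memLp hD hb
    have h3 := eLpNorm_add_le (hu.memLp.1.sub hk.1) hk.1 one_le_two
    rw [sub_add_cancel, eLpNorm_sub_comm] at h3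
    refine h3.trans (add_le_add le_rfl ((base k).trans ?_))
    gcongr
    · exact step _ _ (fun k => (hφ k).memLp_fderiv hD hb 1) hu.memLp_x k
    · exact step _ _ (fun k => (hφ k).memLp_fderiv hD hb Complex.I) hu.memLp_y k
  have tm : ∀ {a : ℕ → ENNReal}, Tendsto a atTop (𝓝 0) →
      Tendsto (fun k => a k * m) atTop (𝓝 0) := fun ha => by
    simpa using ENNReal.Tendsto.mul_const ha (Or.inr hm)
  have lim := h0.add (ENNReal.Tendsto.const_mul (a := C)
    ((tendsto_const_nhds (x := eLpNorm ux 1 (volume.restrict D)).add (tm h1)).add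
    (tendsto_const_nhds (x := eLpNorm uy 1 (volume.restrict D)).add (tm h2)))
    (Or.inr hCtop))
  simp only [add_zero, zero_add] at lim
  exact ge_of_tendsto' lim final

end RealH10

end

section

/-! ### Truncation -/

/-- A smooth version of the positive part. -/
structure IsSmoothPosPart (θ : ℝ → ℝ) : Prop where
  contDiff : ContDiff ℝ ∞ θ
  eq_zero : ∀ t ≤ 0, θ t = 0
  pos : ∀ t > 0, 0 < θ t
  deriv_nonneg : ∀ t, 0 ≤ deriv θ t
  deriv_le_one : ∀ t, deriv θ t ≤ 1

namespace IsSmoothPosPart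

variable {θ : ℝ → ℝ}

theorem differentiable (h : IsSmoothPosPart θ) : Differentiable ℝ θ := h.contDiff.differentiable (by simp)

theorem continuous_deriv (h : IsSmoothPosPart θ) : Continuous (deriv θ) := h.contDiff.continuous_deriv (by simp)

theorem nonneg (h : IsSmoothPosPart θ) (t : ℝ) : 0 ≤ θ t := by
  rcases le_or_gt t 0 with ht | ht
  · exact (h.eq_zero t ht).ge
  · exact (h.pos t ht).le

/-- A zero of the nonnegative function `θ` is a minimum; this covers `t = 0` as well. -/
theorem deriv_eq_zero (h : IsSmoothPosPart θ) {t : ℝ} (ht : t ≤ 0) : deriv θ t = 0 := by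
  refine IsLocalMin.deriv_eq_zero (Eventually.of_forall fun s => ?_)
  rw [h.eq_zero t ht]; exact h.nonneg s

theorem abs_sub_le (h : IsSmoothPosPart θ) (s t : ℝ) : |θ s - θ t| ≤ |s - t| := by
  have := Convex.norm_image_sub_le_of_norm_deriv_le (f := θ) (C := 1) (s := univ)
    (fun x _ => h.differentiable x) (fun x _ => by
      rw [Real.norm_of_nonneg (h.deriv_nonneg x)]; exact h.deriv_le_one x) convex_univ
    (mem_univ t) (mem_univ s)
  simpa using this

theorem monotone (h : IsSmoothPosPart θ) : Monotone θ := monotone_of_deriv_nonneg h.differentiable h.deriv_nonneg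

/-- The slope stays between `0` and `1`, while the value at `δ` becomes `δ * θ 1`, so the truncation
adapts to the gap between two levels. -/
theorem rescale (h : IsSmoothPosPart θ) {δ : ℝ} (hδ : 0 < δ) :
    IsSmoothPosPart (fun t => δ * θ (t / δ)) := by
  have hd : ∀ t, deriv (fun t => δ * θ (t / δ)) t = deriv θ (t / δ) := by
    intro t
    have h1 : HasDerivAt (fun t : ℝ => t / δ) (1 / δ) t := (hasDerivAt_id t).div_const δ
    have := (((h.differentiable (t / δ)).hasDerivAt.comp t h1).const_mul δ).deriv
    rw [show (fun t => δ * θ (t / δ)) = fun t => δ * (θ ∘ fun t => t / δ) t from rfl, this]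
    field_simp
  refine ⟨contDiff_const.mul (h.contDiff.comp (contDiff_id.div_const δ)), fun t ht => ?_,
    fun t ht => mul_pos hδ (h.pos _ (by positivity)), fun t => ?_, fun t => ?_⟩
  · rw [h.eq_zero _ (div_nonpos_of_nonpos_of_nonneg ht hδ.le), mul_zero]
  · rw [hd]; exact h.deriv_nonneg _
  · rw [hd]; exact h.deriv_le_one _

end IsSmoothPosPart

/-- The primitive of `Real.smoothTransition` from `0` has all the properties, since its derivative
lies between `0` and `1` and is positive exactly on the positive axis. -/
theorem exists_isSmoothPosPart : ∃ θ : ℝ → ℝ, IsSmoothPosPart θ ∧ 0 < θ 1 := by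
  set θ : ℝ → ℝ := fun t => ∫ s in (0 : ℝ)..t, Real.smoothTransition s with hθ
  have hd : ∀ t, HasDerivAt θ (Real.smoothTransition t) t := fun t =>
    Real.smoothTransition.continuous.integral_hasStrictDerivAt 0 t |>.hasDerivAt
  have hd' : deriv θ = Real.smoothTransition := funext fun t => (hd t).deriv
  have hpos : ∀ t > 0, 0 < θ t := by
    intro t ht
    exact intervalIntegral.intervalIntegral_pos_of_pos_on
      (Real.smoothTransition.continuous.intervalIntegrable _ _)
      (fun x hx => Real.smoothTransition.pos_of_pos hx.1) ht
  refine ⟨θ, ⟨?_, fun t ht => ?_, hpos, fun t => ?_, fun t => ?_⟩, hpos 1 one_pos⟩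
  · rw [contDiff_infty_iff_deriv, hd']
    exact ⟨fun t => (hd t).differentiableAt, Real.smoothTransition.contDiff⟩
  · rw [hθ]
    refine (intervalIntegral.integral_congr (g := fun _ => 0) fun x hx => ?_).trans (by simp)
    rw [uIcc_of_ge ht] at hx
    exact Real.smoothTransition.zero_of_nonpos hx.2
  · rw [hd']; exact Real.smoothTransition.nonneg t
  · rw [hd']; exact Real.smoothTransition.le_one t

variable {D : Set ℂ} {u ux uy : ℂ → ℝ}

/-- `(u - b)₊`, smoothly truncated, belongs to `H₀¹` if `b` is nonnegative. -/
theorem RealH10.truncate (hD : IsOpen D) (hb : Bornology.IsBounded D) (hu : RealH10 D u ux uy)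
    {b : ℂ → ℝ} (hbs : ContDiff ℝ ∞ b) (hb0 : ∀ z ∈ D, 0 ≤ b z) {θ : ℝ → ℝ}
    (hθ : IsSmoothPosPart θ) :
    RealH10 D (fun z => θ (u z - b z)) (fun z => deriv θ (u z - b z) * (ux z - fderiv ℝ b z 1))
      (fun z => deriv θ (u z - b z) * (uy z - fderiv ℝ b z Complex.I)) := by
  have hb1 : ContDiff ℝ 1 b := hbs.of_le (by simp)
  have hbm : MemLp b 2 (volume.restrict D) := hbs.continuous.memLp_restrict hD hb 2
  have hbd : ∀ e, MemLp (fun z => fderiv ℝ b z e) 2 (volume.restrict D) := fun e =>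
    hb1.memLp_fderiv_restrict hD hb e 2
  have hD' : ∀ᵐ z ∂(volume.restrict D), z ∈ D := ae_restrict_mem hD.measurableSet
  have hθ' : ∀ t, ‖deriv θ t‖ ≤ 1 := fun t => by
    rw [Real.norm_of_nonneg (hθ.deriv_nonneg t)]; exact hθ.deriv_le_one t
  have hmul : ∀ {f : ℂ → ℝ} (g : ℂ → ℝ), AEStronglyMeasurable g (volume.restrict D) →
      MemLp f 2 (volume.restrict D) → MemLp (fun z => deriv θ (g z) * f z) 2
      (volume.restrict D) := by
    intro f g hg hf
    refine hf.mono ((hθ.continuous_deriv.comp_aestronglyMeasurable hg).mul hf.1)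
      (Eventually.of_forall fun z => ?_)
    rw [norm_mul]
    exact mul_le_of_le_one_left (norm_nonneg _) (hθ' _)
  have hsm : AEStronglyMeasurable (fun z => u z - b z) (volume.restrict D) :=
    hu.memLp.1.sub hbm.1
  obtain ⟨φ₀, hφ₀, h00, h01, h02⟩ := hu.approx
  -- Along a subsequence the approximants converge almost everywhere, which the nonlinear factor
  -- `deriv θ (φ k - b)` requires for dominated convergence.
  obtain ⟨ns, hns, hae⟩ := (tendstoInMeasure_of_tendsto_eLpNorm two_ne_zero
    (fun k => ((hφ₀ k).memLp hD hb).1) hu.memLp.1 h00).exists_seq_tendsto_ae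
  set φ : ℕ → ℂ → ℝ := fun k => φ₀ (ns k)
  have hφ : ∀ k, IsTestFunction D (φ k) := fun k => hφ₀ _
  have h0 := h00.comp hns.tendsto_atTop
  have h1 := h01.comp hns.tendsto_atTop
  have h2 := h02.comp hns.tendsto_atTop
  -- Subtracting `θ (-b)` makes the function vanish wherever `φ k` does, hence compactly supported.
  -- On `D` nothing is subtracted, as `b ≥ 0` there.
  set χ : ℕ → ℂ → ℝ := fun k z => θ (φ k z - b z) - θ (-b z) with hχ
  have hχ0 : ∀ k, Function.support (χ k) ⊆ tsupport (φ k) := by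
    intro k z hz
    by_contra h
    exact hz (by simp [hχ, image_eq_zero_of_notMem_tsupport h])
  have hχt : ∀ k, IsTestFunction D (χ k) := fun k =>
    ⟨(hθ.contDiff.comp ((hφ k).smooth.sub hbs)).sub (hθ.contDiff.comp hbs.neg),
      (hφ k).compact.mono' (hχ0 k),
      (closure_minimal (hχ0 k) (isClosed_tsupport _)).trans (hφ k).support⟩
  have hχd : ∀ k e, ∀ z ∈ D, fderiv ℝ (χ k) z e =
      deriv θ (φ k z - b z) * (fderiv ℝ (φ k) z e - fderiv ℝ b z e) := by
    intro k e z hz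
    have d1 : HasFDerivAt (fun z => φ k z - b z) (fderiv ℝ (φ k) z - fderiv ℝ b z) z :=
      (((hφ k).contDiff_one.differentiable one_ne_zero) z).hasFDerivAt.sub
        ((hb1.differentiable one_ne_zero) z).hasFDerivAt
    have d2 : HasFDerivAt (fun z => -b z) (-fderiv ℝ b z) z :=
      ((hb1.differentiable one_ne_zero) z).hasFDerivAt.neg
    have d3 := ((hθ.differentiable _).hasDerivAt.comp_hasFDerivAt z d1).sub
      ((hθ.differentiable _).hasDerivAt.comp_hasFDerivAt z d2)
    have := congrArg (fun T : ℂ →L[ℝ] ℝ => T e) d3.fderiv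
    refine this.trans ?_
    simp [hθ.deriv_eq_zero (neg_nonpos.2 (hb0 z hz))]
  have hder : ∀ (e : ℂ) (ue : ℂ → ℝ), MemLp ue 2 (volume.restrict D) →
      Tendsto (fun k => eLpNorm (fun z => fderiv ℝ (φ k) z e - ue z) 2 (volume.restrict D))
        atTop (𝓝 0) →
      Tendsto (fun k => eLpNorm (fun z => fderiv ℝ (χ k) z e -
        deriv θ (u z - b z) * (ue z - fderiv ℝ b z e)) 2 (volume.restrict D)) atTop (𝓝 0) := by
    intro e ue hue hlim
    have hX : MemLp (fun z => ue z - fderiv ℝ b z e) 2 (volume.restrict D) := hue.sub (hbd e)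
    have hφm : ∀ k, AEStronglyMeasurable (fun z => φ k z - b z) (volume.restrict D) :=
      fun k => ((hφ k).memLp hD hb).1.sub hbm.1
    have hdom : Tendsto (fun k => eLpNorm (fun z => (deriv θ (φ k z - b z) - deriv θ (u z - b z)) *
        (ue z - fderiv ℝ b z e)) 2 (volume.restrict D)) atTop (𝓝 0) := by
      refine tendsto_eLpNorm_two_of_dominated (G := fun z => 2 * ‖ue z - fderiv ℝ b z e‖)
        (fun k => ((hθ.continuous_deriv.comp_aestronglyMeasurable (hφm k)).sub
          (hθ.continuous_deriv.comp_aestronglyMeasurable hsm)).mul hX.1)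
        (hX.norm.const_mul 2) (fun k => Eventually.of_forall fun z => ?_) ?_
      · rw [norm_mul]
        gcongr
        exact (norm_sub_le _ _).trans (by linarith [hθ' (φ k z - b z), hθ' (u z - b z)])
      · filter_upwards [hae] with z hz
        have := ((hθ.continuous_deriv.tendsto (u z - b z)).comp (hz.sub_const (b z))).sub_const
          (deriv θ (u z - b z))
        rw [sub_self] at this
        simpa using this.mul_const (ue z - fderiv ℝ b z e)
    refine tendsto_eLpNorm_of_le_add (fun k => ?_) hlim hdom
    have hm1 : MemLp (fun z => fderiv ℝ (φ k) z e - ue z) 2 (volume.restrict D) :=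
      ((hφ k).memLp_fderiv hD hb e).sub hue
    have hm2 := hmul _ (hφm k) hm1
    -- The error splits into `θ'(φ - b)` times the error of the derivative of `φ`, small in `L²`,
    -- and the error of `θ'(φ - b)` times a fixed square-integrable function, small by domination.
    calc eLpNorm (fun z => fderiv ℝ (χ k) z e - deriv θ (u z - b z) * (ue z - fderiv ℝ b z e)) 2
          (volume.restrict D)
        = eLpNorm ((fun z => deriv θ (φ k z - b z) * (fderiv ℝ (φ k) z e - ue z)) +
          fun z => (deriv θ (φ k z - b z) - deriv θ (u z - b z)) * (ue z - fderiv ℝ b z e)) 2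
          (volume.restrict D) := by
          refine eLpNorm_congr_ae ?_
          filter_upwards [hD'] with z hz
          rw [hχd k e z hz, Pi.add_apply]
          ring
      _ ≤ eLpNorm (fun z => deriv θ (φ k z - b z) * (fderiv ℝ (φ k) z e - ue z)) 2
          (volume.restrict D) + eLpNorm (fun z => (deriv θ (φ k z - b z) - deriv θ (u z - b z)) *
          (ue z - fderiv ℝ b z e)) 2 (volume.restrict D) :=
          eLpNorm_add_le hm2.1 (((hθ.continuous_deriv.comp_aestronglyMeasurable (hφm k)).sub
          (hθ.continuous_deriv.comp_aestronglyMeasurable hsm)).mul hX.1) one_le_two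
      _ ≤ _ := by
          refine add_le_add (eLpNorm_mono fun z => ?_) le_rfl
          rw [norm_mul]
          exact mul_le_of_le_one_left (norm_nonneg _) (hθ' _)
  refine ⟨?_, hmul _ hsm (hu.memLp_x.sub (hbd 1)), hmul _ hsm (hu.memLp_y.sub (hbd Complex.I)),
    χ, hχt, ?_, hder _ _ hu.memLp_x h1, hder _ _ hu.memLp_y h2⟩
  · refine (hu.memLp.sub hbm).mono (hθ.contDiff.continuous.comp_aestronglyMeasurable hsm)
      (Eventually.of_forall fun z => ?_)
    have := hθ.abs_sub_le (u z - b z) 0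
    rw [hθ.eq_zero 0 le_rfl, sub_zero, sub_zero] at this
    exact this
  · refine tendsto_of_tendsto_of_tendsto_of_le_of_le tendsto_const_nhds h0 (fun _ => zero_le)
      fun k => eLpNorm_mono_ae ?_
    filter_upwards [hD'] with z hz
    simp only [hχ]
    rw [hθ.eq_zero _ (neg_nonpos.2 (hb0 z hz)), sub_zero, Real.norm_eq_abs, Real.norm_eq_abs]
    refine (hθ.abs_sub_le _ _).trans (le_of_eq ?_)
    congr 1; ring

end

section

variable {D : Set ℂ} {u ux uy : ℂ → ℝ}

/-! ### The weak maximum principle and Stampacchia's bound -/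

/-- The quadratic polynomial `t ↦ ∫ (t f + g)²` is nonnegative, so its discriminant is not positive.
-/
theorem sq_integral_mul_le {α : Type*} {mα : MeasurableSpace α} {μ : Measure α} {f g : α → ℝ}
    (hf : MemLp f 2 μ) (hg : MemLp g 2 μ) :
    (∫ x, f x * g x ∂μ) ^ 2 ≤ (∫ x, f x ^ 2 ∂μ) * ∫ x, g x ^ 2 ∂μ := by
  have i1 : Integrable (fun x => f x * g x) μ := memLp_one_iff_integrable.1 (hg.mul hf)
  have i2 := hf.integrable_sq
  have i3 := hg.integrable_sq
  have key : ∀ t : ℝ, 0 ≤ (∫ x, f x ^ 2 ∂μ) * (t * t) + (2 * ∫ x, f x * g x ∂μ) * t +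
      ∫ x, g x ^ 2 ∂μ := by
    intro t
    have : ∫ x, (t * f x + g x) ^ 2 ∂μ = (∫ x, f x ^ 2 ∂μ) * (t * t) +
        (2 * ∫ x, f x * g x ∂μ) * t + ∫ x, g x ^ 2 ∂μ := by
      have e : ∀ x, (t * f x + g x) ^ 2 = (t * t) * f x ^ 2 + (2 * t) * (f x * g x) + g x ^ 2 :=
        fun x => by ring
      simp_rw [e]
      rw [integral_add (f := fun x => (t * t) * f x ^ 2 + (2 * t) * (f x * g x))
        ((i2.const_mul _).add (i1.const_mul _)) i3,
        integral_add (i2.const_mul _) (i1.const_mul _), integral_const_mul, integral_const_mul]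
      ring
    rw [← this]
    exact integral_nonneg fun x => sq_nonneg _
  have := discrim_le_zero key
  rw [discrim] at this
  linarith

/-- The Sobolev inequality of `H₀¹` in terms of integrals. -/
theorem exists_integral_sq_le : ∃ C : ℝ, 0 ≤ C ∧ ∀ (D : Set ℂ), IsOpen D →
    Bornology.IsBounded D → ∀ u ux uy : ℂ → ℝ, RealH10 D u ux uy →
    ∫ z in D, u z ^ 2 ≤ C * ((∫ z in D, |ux z|) ^ 2 + (∫ z in D, |uy z|) ^ 2) := by
  obtain ⟨C, hC, h⟩ := exists_eLpNorm_le
  -- The factor `2` comes from `(p + q)² ≤ 2 (p² + q²)`.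
  refine ⟨2 * C.toReal ^ 2, by positivity, fun D hD hb u ux uy hu => ?_⟩
  have hfin := isFiniteMeasure_restrict hb
  have h1 := h D hD hb u ux uy hu
  have ix : Integrable ux (volume.restrict D) := hu.memLp_x.integrable one_le_two
  have iy : Integrable uy (volume.restrict D) := hu.memLp_y.integrable one_le_two
  have e1 : ∀ {f : ℂ → ℝ}, Integrable f (volume.restrict D) →
      eLpNorm f 1 (volume.restrict D) = ENNReal.ofReal (∫ z in D, |f z|) := by
    intro f hf
    rw [eLpNorm_one_eq_lintegral_enorm, ← ofReal_integral_norm_eq_lintegral_enorm hf]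
    rfl
  have e2 : eLpNorm u 2 (volume.restrict D) = ENNReal.ofReal (Real.sqrt (∫ z in D, u z ^ 2)) := by
    rw [hu.memLp.eLpNorm_eq_integral_rpow_norm two_ne_zero ENNReal.ofNat_ne_top, Real.sqrt_eq_rpow]
    simp
  have p1 : 0 ≤ ∫ z in D, |ux z| := integral_nonneg fun _ => abs_nonneg _
  have p2 : 0 ≤ ∫ z in D, |uy z| := integral_nonneg fun _ => abs_nonneg _
  rw [e1 ix, e1 iy, e2, ← ENNReal.ofReal_toReal hC, ← ENNReal.ofReal_add p1 p2,
    ← ENNReal.ofReal_mul ENNReal.toReal_nonneg, ENNReal.ofReal_le_ofReal_iff (by positivity)] at h1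
  have h2 := Real.sqrt_le_left (by positivity) |>.1 h1
  refine h2.trans ?_
  nlinarith [sq_nonneg ((∫ z in D, |ux z|) - ∫ z in D, |uy z|), sq_nonneg C.toReal]

/-- The weak maximum principle: `u ≤ b` in `D` for `u ∈ H₀¹(D)` and `b ≥ 0` with `Δb ≤ Δu`. -/
theorem RealH10.le_of_laplacian_le (hD : IsOpen D) (hb : Bornology.IsBounded D)
    (hu : RealH10 D u ux uy) {h : ℂ → ℝ} (hh : MemLp h 2 (volume.restrict D))
    (heq : ∀ φ : ℂ → ℝ, IsTestFunction D φ →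
      ∫ z in D, (fderiv ℝ φ z 1 • ux z + fderiv ℝ φ z Complex.I • uy z + φ z • h z) = 0)
    {b B : ℂ → ℝ} (hbs : ContDiff ℝ ∞ b) (hb0 : ∀ z ∈ D, 0 ≤ b z)
    (hB : MemLp B 2 (volume.restrict D))
    (hbeq : ∀ φ : ℂ → ℝ, IsTestFunction D φ → ∫ z in D, (fderiv ℝ φ z 1 • fderiv ℝ b z 1 +
      fderiv ℝ φ z Complex.I • fderiv ℝ b z Complex.I + φ z • B z) = 0)
    (hle : ∀ᵐ z ∂(volume.restrict D), B z ≤ h z) :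
    ∀ᵐ z ∂(volume.restrict D), u z ≤ b z := by
  obtain ⟨θ, hθ, -⟩ := exists_isSmoothPosPart
  have hw := hu.truncate hD hb hbs hb0 hθ
  have hb1 : ContDiff ℝ 1 b := hbs.of_le (by simp)
  have hbd : ∀ e, MemLp (fun z => fderiv ℝ b z e) 2 (volume.restrict D) := fun e =>
    hb1.memLp_fderiv_restrict hD hb e 2
  have int : ∀ {f g : ℂ → ℝ}, MemLp f 2 (volume.restrict D) →
      MemLp g 2 (volume.restrict D) → Integrable (fun z => f z • g z) (volume.restrict D) :=
    fun hf hg => memLp_one_iff_integrable.1 (hg.smul hf)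
  have int3 : ∀ {f g k a b c : ℂ → ℝ}, MemLp f 2 (volume.restrict D) →
      MemLp g 2 (volume.restrict D) → MemLp k 2 (volume.restrict D) →
      MemLp a 2 (volume.restrict D) → MemLp b 2 (volume.restrict D) →
      MemLp c 2 (volume.restrict D) →
      Integrable (fun z => f z • a z + g z • b z + k z • c z) (volume.restrict D) :=
    fun hf hg hk ha hb hc => ((int hf ha).add (int hg hb)).add (int hk hc)
  -- Test the equation of `u - b` with `θ (u - b)`. The integrand is `θ'(u - b) |∇u - ∇b|² + θ(u -
  -- b) (h - B)`, whose terms are nonnegative, so each vanishes almost everywhere.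
  have key := hw.integral_eq hD hb (hu.memLp_x.sub (hbd 1)) (hu.memLp_y.sub (hbd Complex.I))
    (hh.sub hB) (fun φ hφ => by
      have t0 := hφ.memLp hD hb
      have t1 := hφ.memLp_fderiv hD hb 1
      have t2 := hφ.memLp_fderiv hD hb Complex.I
      have := integral_sub (int3 t1 t2 t0 hu.memLp_x hu.memLp_y hh)
        (int3 t1 t2 t0 (hbd 1) (hbd Complex.I) hB)
      rw [heq φ hφ, hbeq φ hφ, sub_zero] at this
      rw [← this]
      congr 1; ext z
      simp only [Pi.sub_apply, smul_eq_mul]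
      ring)
  rw [integral_eq_zero_iff_of_nonneg_ae] at key
  · have hx : ∀ᵐ z ∂(volume.restrict D),
        deriv θ (u z - b z) * (ux z - fderiv ℝ b z 1) = 0 ∧
        deriv θ (u z - b z) * (uy z - fderiv ℝ b z Complex.I) = 0 := by
      filter_upwards [key, hle] with z hz hz'
      simp only [Pi.sub_apply, smul_eq_mul, Pi.zero_apply] at hz
      have a1 := mul_nonneg (hθ.deriv_nonneg (u z - b z)) (sq_nonneg (ux z - fderiv ℝ b z 1))
      have a2 := mul_nonneg (hθ.deriv_nonneg (u z - b z))
        (sq_nonneg (uy z - fderiv ℝ b z Complex.I))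
      have a3 := mul_nonneg (hθ.nonneg (u z - b z)) (sub_nonneg.2 hz')
      have b1 : deriv θ (u z - b z) * (ux z - fderiv ℝ b z 1) ^ 2 = 0 := by nlinarith
      have b2 : deriv θ (u z - b z) * (uy z - fderiv ℝ b z Complex.I) ^ 2 = 0 := by nlinarith
      constructor
      · rcases mul_eq_zero.1 b1 with h | h
        · rw [h, zero_mul]
        · rw [pow_eq_zero_iff two_ne_zero |>.1 h, mul_zero]
      · rcases mul_eq_zero.1 b2 with h | h
        · rw [h, zero_mul]
        · rw [pow_eq_zero_iff two_ne_zero |>.1 h, mul_zero]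
    -- The gradient of `θ (u - b)` vanishes, and the Sobolev inequality makes `θ (u - b)` itself
    -- vanish; since `θ` is positive on the positive axis, `u ≤ b`.
    obtain ⟨C, hC, hS⟩ := exists_integral_sq_le
    have h1 := hS D hD hb _ _ _ hw
    have z1 : ∫ z in D, |deriv θ (u z - b z) * (ux z - fderiv ℝ b z 1)| = 0 :=
      integral_eq_zero_of_ae (hx.mono fun z hz => by simp only [hz.1, abs_zero, Pi.zero_apply])
    have z2 : ∫ z in D, |deriv θ (u z - b z) * (uy z - fderiv ℝ b z Complex.I)| = 0 :=
      integral_eq_zero_of_ae (hx.mono fun z hz => by simp only [hz.2, abs_zero, Pi.zero_apply])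
    rw [z1, z2] at h1
    have h2 : ∫ z in D, θ (u z - b z) ^ 2 = 0 :=
      le_antisymm (by simpa using h1) (integral_nonneg fun _ => sq_nonneg _)
    rw [integral_eq_zero_iff_of_nonneg (fun _ => sq_nonneg _) hw.memLp.integrable_sq] at h2
    filter_upwards [h2] with z hz
    by_contra hlt
    have := hθ.pos (u z - b z) (by linarith)
    simp only [Pi.zero_apply] at hz
    rw [pow_eq_zero_iff two_ne_zero] at hz
    linarith
  · filter_upwards [hle] with z hz
    simp only [Pi.sub_apply, smul_eq_mul, Pi.zero_apply]
    have a1 := mul_nonneg (hθ.deriv_nonneg (u z - b z)) (sq_nonneg (ux z - fderiv ℝ b z 1))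
    have a2 := mul_nonneg (hθ.deriv_nonneg (u z - b z))
      (sq_nonneg (uy z - fderiv ℝ b z Complex.I))
    have a3 := mul_nonneg (hθ.nonneg (u z - b z)) (sub_nonneg.2 hz)
    nlinarith
  · exact int3 hw.memLp_x hw.memLp_y hw.memLp (hu.memLp_x.sub (hbd 1))
      (hu.memLp_y.sub (hbd Complex.I)) (hh.sub hB)

/-- The energy estimate above the level `k`. -/
theorem exists_levelSet_le : ∃ C : ℝ, 0 ≤ C ∧ ∀ (D : Set ℂ), IsOpen D →
    Bornology.IsBounded D → ∀ u ux uy h : ℂ → ℝ, RealH10 D u ux uy →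
    MemLp h 2 (volume.restrict D) → (∀ φ : ℂ → ℝ, IsTestFunction D φ →
      ∫ z in D, (fderiv ℝ φ z 1 • ux z + fderiv ℝ φ z Complex.I • uy z + φ z • h z) = 0) →
    ∀ k l : ℝ, 0 ≤ k → k < l → (volume.restrict D).real {z | l < u z} ≤
      (C * √(∫ z in D, h z ^ 2) / (l - k) * (volume.restrict D).real {z | k < u z}) ^ 2 := by
  obtain ⟨C, hC, hS⟩ := exists_integral_sq_le
  obtain ⟨θ₀, hθ₀, hθ1⟩ := exists_isSmoothPosPart
  -- The division by `θ₀ 1` anticipates Chebyshev's inequality: where `u > l`, the truncation is at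
  -- least `(l - k) * θ₀ 1`.
  refine ⟨C / θ₀ 1, by positivity, fun D hD hb u ux uy h hu hh heq k l hk hkl => ?_⟩
  have hfin := isFiniteMeasure_restrict hb
  set δ := l - k with hδ
  have hδ0 : 0 < δ := sub_pos.2 hkl
  set θ : ℝ → ℝ := fun t => δ * θ₀ (t / δ) with hθdef
  have hθ : IsSmoothPosPart θ := hθ₀.rescale hδ0
  have hw := hu.truncate hD hb (b := fun _ => k) contDiff_const (fun _ _ => hk) hθ
  simp only [fderiv_fun_const, Pi.zero_apply, zero_apply, sub_zero] at hw
  set w : ℂ → ℝ := fun z => θ (u z - k)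
  set wx : ℂ → ℝ := fun z => deriv θ (u z - k) * ux z
  set wy : ℂ → ℝ := fun z => deriv θ (u z - k) * uy z
  set A := (volume.restrict D).real {z | k < u z}
  have hA : 0 ≤ A := measureReal_nonneg
  set H := ∫ z in D, h z ^ 2
  have hH : 0 ≤ H := integral_nonneg fun _ => sq_nonneg _
  set W := ∫ z in D, w z ^ 2
  have hW : 0 ≤ W := integral_nonneg fun _ => sq_nonneg _
  have key := hw.integral_eq hD hb hu.memLp_x hu.memLp_y hh heq
  have int : ∀ {f g : ℂ → ℝ}, MemLp f 2 (volume.restrict D) →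
      MemLp g 2 (volume.restrict D) → Integrable (fun z => f z • g z) (volume.restrict D) :=
    fun hf hg => memLp_one_iff_integrable.1 (hg.smul hf)
  rw [integral_add (f := fun z => wx z • ux z + wy z • uy z)
    ((int hw.memLp_x hu.memLp_x).add (int hw.memLp_y hu.memLp_y)) (int hw.memLp hh)] at key
  -- From `0 ≤ θ' ≤ 1` follows `θ'² ≤ θ'`, so the Dirichlet energy of the truncation is at most its
  -- pairing with `∇u`.
  have hE : (∫ z in D, wx z ^ 2) + (∫ z in D, wy z ^ 2) ≤
      ∫ z in D, (wx z • ux z + wy z • uy z) := by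
    rw [← integral_add hw.memLp_x.integrable_sq hw.memLp_y.integrable_sq]
    refine integral_mono (hw.memLp_x.integrable_sq.add hw.memLp_y.integrable_sq)
      ((int hw.memLp_x hu.memLp_x).add (int hw.memLp_y hu.memLp_y)) fun z => ?_
    have d0 := hθ.deriv_nonneg (u z - k)
    have d1 := hθ.deriv_le_one (u z - k)
    simp only [wx, wy, smul_eq_mul]
    have : deriv θ (u z - k) ^ 2 ≤ deriv θ (u z - k) := by nlinarith
    nlinarith [mul_le_mul_of_nonneg_right this (sq_nonneg (ux z)),
      mul_le_mul_of_nonneg_right this (sq_nonneg (uy z))]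
  have hCS : (∫ z in D, w z • h z) ^ 2 ≤ W * H := sq_integral_mul_le hw.memLp hh
  -- Cauchy–Schwarz against the indicator of `{u > k}`, which carries the gradient of the
  -- truncation: this is where the factor `A` is gained.
  have hloc : ∀ {f : ℂ → ℝ}, MemLp f 2 (volume.restrict D) → (∀ z, u z ≤ k → f z = 0) →
      (∫ z in D, |f z|) ^ 2 ≤ A * ∫ z in D, f z ^ 2 := by
    intro f hf h0
    have hnm : NullMeasurableSet {z | k < u z} (volume.restrict D) :=
      nullMeasurableSet_lt aemeasurable_const hu.memLp.1.aemeasurable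
    have m1 : MemLp ({z | k < u z}.indicator fun _ => (1 : ℝ)) 2 (volume.restrict D) :=
      MemLp.of_bound ((aestronglyMeasurable_const).indicator₀ hnm) 1
        (Eventually.of_forall fun z => by
          by_cases hz : k < u z <;> simp [indicator, hz])
    have := sq_integral_mul_le m1 hf.abs
    have e1 : ∀ z, ({z | k < u z}.indicator (fun _ => (1 : ℝ)) z) * |f| z = |f z| := by
      intro z
      by_cases hz : k < u z
      · simp [indicator, hz]
      · simp [indicator, hz, h0 z (not_lt.1 hz)]
    have e2 : ∀ z, ({z | k < u z}.indicator (fun _ => (1 : ℝ)) z) ^ 2 =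
        {z | k < u z}.indicator (fun _ => (1 : ℝ)) z := by
      intro z
      by_cases hz : k < u z <;> simp [indicator, hz]
    simp_rw [e1, e2] at this
    rw [integral_indicator₀ hnm] at this
    simpa [A] using this
  have hx := hloc hw.memLp_x fun z hz => by simp [wx, hθ.deriv_eq_zero (sub_nonpos.2 hz)]
  have hy := hloc hw.memLp_y fun z hz => by simp [wy, hθ.deriv_eq_zero (sub_nonpos.2 hz)]
  have hS' : W ≤ C * (_ + _) := hS D hD hb _ _ _ hw
  -- Sobolev bounds `W` by `C * A` times the energy, and the equation bounds the energy by `√W √H`.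
  -- One factor `√W` then cancels, leaving a bound quadratic in `A`.
  have hWle : W ≤ C * A * (√W * √H) := by
    have a1 : -(∫ z in D, w z • h z) ≤ √W * √H := by
      rw [← Real.sqrt_mul hW]
      exact Real.le_sqrt_of_sq_le (by rw [neg_sq]; exact hCS)
    calc W ≤ C * (A * (∫ z in D, wx z ^ 2) + A * ∫ z in D, wy z ^ 2) :=
          hS'.trans (by gcongr)
      _ = C * A * ((∫ z in D, wx z ^ 2) + ∫ z in D, wy z ^ 2) := by ring
      _ ≤ C * A * (√W * √H) := by gcongr; linarith
  have hWs : √W ≤ C * A * √H := by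
    rcases hW.eq_or_lt with h0 | h0
    · rw [← h0, Real.sqrt_zero]; positivity
    · have := Real.sqrt_pos.2 h0
      have e : √W * √W = W := Real.mul_self_sqrt hW
      by_contra hcon
      nlinarith
  have hM := mul_meas_ge_le_integral_of_nonneg (μ := volume.restrict D)
    (Eventually.of_forall fun z => sq_nonneg (w z)) hw.memLp.integrable_sq ((δ * θ₀ 1) ^ 2)
  have hsub : (volume.restrict D).real {z | l < u z} ≤
      (volume.restrict D).real {z | (δ * θ₀ 1) ^ 2 ≤ w z ^ 2} := by
    refine measureReal_mono fun z hz => ?_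
    simp only [mem_ofPred_eq] at hz ⊢
    have : θ δ ≤ w z := hθ.monotone (by simp only [hδ]; linarith)
    have e : θ δ = δ * θ₀ 1 := by simp [hθdef, hδ0.ne']
    rw [e] at this
    exact pow_le_pow_left₀ (by positivity) this 2
  have hfinal : (δ * θ₀ 1) ^ 2 * (volume.restrict D).real {z | l < u z} ≤ (C * A * √H) ^ 2 := by
    calc _ ≤ (δ * θ₀ 1) ^ 2 * (volume.restrict D).real {z | (δ * θ₀ 1) ^ 2 ≤ w z ^ 2} := by gcongr
      _ ≤ W := hM
      _ = √W ^ 2 := (Real.sq_sqrt hW).symm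
      _ ≤ _ := by gcongr
  rw [mul_comm, ← le_div_iff₀ (by positivity), ← div_pow] at hfinal
  refine hfinal.trans (le_of_eq ?_)
  congr 1
  field_simp

/-- Stampacchia's bound: `u ≤ C ‖Δu‖₂` for `u ∈ H₀¹(D)`. -/
theorem exists_le_sqrt_integral (D : Set ℂ) (hD : IsOpen D) (hb : Bornology.IsBounded D) :
    ∃ C : ℝ, 0 ≤ C ∧ ∀ u ux uy h : ℂ → ℝ, RealH10 D u ux uy →
    MemLp h 2 (volume.restrict D) → (∀ φ : ℂ → ℝ, IsTestFunction D φ →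
      ∫ z in D, (fderiv ℝ φ z 1 • ux z + fderiv ℝ φ z Complex.I • uy z + φ z • h z) = 0) →
    ∀ᵐ z ∂(volume.restrict D), u z ≤ C * √(∫ z in D, h z ^ 2) := by
  obtain ⟨C, hC, hS⟩ := exists_levelSet_le
  have hfin := isFiniteMeasure_restrict hb
  set V := (volume.restrict D).real univ
  have hV : 0 ≤ V := measureReal_nonneg
  refine ⟨4 * C * √V, by positivity, fun u ux uy h hu hh heq => ?_⟩
  set M := C * √(∫ z in D, h z ^ 2)
  have hM : 0 ≤ M := by positivity
  -- The iteration divides by the level `K`, which must therefore be positive; the value `4 * M *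
  -- √V` itself is reached at the end as a limit.
  have main : ∀ K : ℝ, 0 < K → 4 * M * √V ≤ K → ∀ᵐ z ∂(volume.restrict D), u z ≤ K := by
    intro K hK hKM
    have hK2 : 16 * M ^ 2 * V ≤ K ^ 2 := by
      have := pow_le_pow_left₀ (by positivity) hKM 2
      rw [mul_pow, mul_pow, Real.sq_sqrt hV] at this
      linarith
    -- The levels increase to `K` with gaps `K / 2^(j+1)`. The energy estimate squares the previous
    -- measure, so a decay `4^(-j)` becomes `16^(-j)`, which outweighs the growth `4^j` from the
    -- inverse square of the gap; the condition `16 M² V ≤ K²` absorbs the constants.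
    have step : ∀ j : ℕ, (volume.restrict D).real {z | K * (1 - (1 / 2) ^ j) < u z} ≤
        V * (1 / 4) ^ j := by
      intro j
      induction j with
      | zero => simpa using measureReal_mono (subset_univ _)
      | succ j ih =>
        have hp : (0 : ℝ) < (1 / 2) ^ j := by positivity
        have hp1 : ((1 : ℝ) / 2) ^ j ≤ 1 := pow_le_one₀ (by norm_num) (by norm_num)
        have hd : K * (1 - (1 / 2) ^ (j + 1)) - K * (1 - (1 / 2) ^ j) = K * (1 / 2) ^ j / 2 := by
          rw [pow_succ]; ring
        have h1 := hS D hD hb u ux uy h hu hh heq (K * (1 - (1 / 2) ^ j))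
          (K * (1 - (1 / 2) ^ (j + 1))) (mul_nonneg hK.le (by linarith))
          (by rw [← sub_pos, hd]; positivity)
        rw [hd] at h1
        refine h1.trans ?_
        have h2 : M / (K * (1 / 2) ^ j / 2) *
            (volume.restrict D).real {z | K * (1 - (1 / 2) ^ j) < u z} ≤
            M / (K * (1 / 2) ^ j / 2) * (V * (1 / 4) ^ j) := by gcongr
        refine (pow_le_pow_left₀ (by positivity) h2 2).trans ?_
        have e4 : ((1 : ℝ) / 4) ^ j = ((1 / 2) ^ j) ^ 2 := by
          rw [← pow_mul, mul_comm, pow_mul]; norm_num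
        rw [pow_succ ((1 : ℝ) / 4), e4]
        generalize ((1 : ℝ) / 2) ^ j = q at *
        have e5 : (M / (K * q / 2) * (V * q ^ 2)) ^ 2 = 4 * M ^ 2 * V / K ^ 2 * (V * q ^ 2) := by
          field_simp; ring
        rw [e5]
        have : 4 * M ^ 2 * V / K ^ 2 ≤ 1 / 4 := by
          rw [div_le_iff₀ (by positivity)]; linarith
        nlinarith [mul_le_mul_of_nonneg_right this (by positivity : 0 ≤ V * q ^ 2)]
    have hlim : Tendsto (fun j : ℕ => V * (1 / 4 : ℝ) ^ j) atTop (𝓝 0) := by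
      simpa using (tendsto_pow_atTop_nhds_zero_of_lt_one (by norm_num : (0 : ℝ) ≤ 1 / 4)
        (by norm_num)).const_mul V
    have hz : (volume.restrict D).real {z | K < u z} ≤ 0 := by
      refine ge_of_tendsto' hlim fun j => le_trans (measureReal_mono fun z hz => ?_) (step j)
      have : (0 : ℝ) < (1 / 2) ^ j := by positivity
      simp only [mem_ofPred_eq] at hz ⊢
      nlinarith
    have hz' : (volume.restrict D) {z | K < u z} = 0 :=
      (measureReal_eq_zero_iff).1 (le_antisymm hz measureReal_nonneg)
    rw [ae_iff]
    simpa using hz'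
  have hall : ∀ᵐ z ∂(volume.restrict D), ∀ j : ℕ, u z ≤ 4 * M * √V + 1 / ((j : ℝ) + 1) :=
    ae_all_iff.2 fun j => main _ (by positivity) (by
      have : (0 : ℝ) < 1 / ((j : ℝ) + 1) := by positivity
      linarith)
  filter_upwards [hall] with z hz
  have hl := (tendsto_one_div_add_atTop_nhds_zero_nat (𝕜 := ℝ)).const_add (4 * M * √V)
  rw [add_zero] at hl
  refine (ge_of_tendsto' hl hz).trans (le_of_eq ?_)
  simp only [M]; ring

end

section

variable {D : Set ℂ}

/-! ### The Hilbert space `H₀¹(D)` -/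

section TestAlgebra

variable {F : Type*} [NormedAddCommGroup F] [NormedSpace ℝ F] {φ ψ : ℂ → F}

theorem IsTestFunction.add (hφ : IsTestFunction D φ) (hψ : IsTestFunction D ψ) :
    IsTestFunction D (φ + ψ) :=
  ⟨hφ.smooth.add hψ.smooth, hφ.compact.add hψ.compact,
    (tsupport_add φ ψ).trans (union_subset hφ.support hψ.support)⟩

theorem IsTestFunction.clm_comp {G : Type*} [NormedAddCommGroup G] [NormedSpace ℝ G]
    (hφ : IsTestFunction D φ) (A : F →L[ℝ] G) : IsTestFunction D (fun z => A (φ z)) :=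
  ⟨A.contDiff.comp hφ.smooth, hφ.compact.comp_left (g := A) (map_zero A),
    (closure_mono (Function.support_comp_subset (map_zero A) φ)).trans hφ.support⟩

theorem IsTestFunction.fderiv_clm_comp {G : Type*} [NormedAddCommGroup G] [NormedSpace ℝ G]
    (hφ : IsTestFunction D φ) (A : F →L[ℝ] G) (z e : ℂ) :
    fderiv ℝ (fun z => A (φ z)) z e = A (fderiv ℝ φ z e) := by
  have := (A.hasFDerivAt.comp z
    ((hφ.contDiff_one.differentiable one_ne_zero) z).hasFDerivAt).fderiv
  exact congrArg (fun T : ℂ →L[ℝ] G => T e) this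

theorem IsTestFunction.fderiv_add (hφ : IsTestFunction D φ) (hψ : IsTestFunction D ψ) (z : ℂ) :
    fderiv ℝ (φ + ψ) z = fderiv ℝ φ z + fderiv ℝ ψ z :=
  _root_.fderiv_add ((hφ.contDiff_one.differentiable one_ne_zero) z)
    ((hψ.contDiff_one.differentiable one_ne_zero) z)

theorem isTestFunction_zero : IsTestFunction D (0 : ℂ → F) :=
  ⟨contDiff_const, HasCompactSupport.zero, by simp [tsupport]⟩

end TestAlgebra

/-- Square-integrable triples of functions. -/
abbrev L2Triple (D : Set ℂ) := PiLp 2 (fun _ : Fin 3 => Lp ℂ 2 (volume.restrict D))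

/-- The triples `(φ, ∂φ/∂x, ∂φ/∂y)` of the test functions. -/
noncomputable def testTriples (D : Set ℂ) : Submodule ℂ (L2Triple D) where
  carrier := {x | ∃ φ : ℂ → ℂ, IsTestFunction D φ ∧ x 0 =ᵐ[volume.restrict D] φ ∧
    (x 1 =ᵐ[volume.restrict D] fun z => fderiv ℝ φ z 1) ∧
    x 2 =ᵐ[volume.restrict D] fun z => fderiv ℝ φ z Complex.I}
  add_mem' := by
    rintro x y ⟨φ, hφ, h0, h1, h2⟩ ⟨ψ, hψ, k0, k1, k2⟩
    refine ⟨φ + ψ, hφ.add hψ, ?_, ?_, ?_⟩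
    · filter_upwards [Lp.coeFn_add (x 0) (y 0), h0, k0] with z a b c
      exact a.trans (by rw [Pi.add_apply, b, c]; rfl)
    · filter_upwards [Lp.coeFn_add (x 1) (y 1), h1, k1] with z a b c
      exact a.trans (by rw [Pi.add_apply, b, c, hφ.fderiv_add hψ]; rfl)
    · filter_upwards [Lp.coeFn_add (x 2) (y 2), h2, k2] with z a b c
      exact a.trans (by rw [Pi.add_apply, b, c, hφ.fderiv_add hψ]; rfl)
  zero_mem' := by
    refine ⟨0, isTestFunction_zero, ?_, ?_, ?_⟩ <;>
    · filter_upwards [Lp.coeFn_zero ℂ 2 (volume.restrict D)] with z a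
      exact a.trans (by simp)
  smul_mem' := by
    rintro c x ⟨φ, hφ, h0, h1, h2⟩
    refine ⟨fun z => c * φ z, hφ.clm_comp (ContinuousLinearMap.mul ℝ ℂ c), ?_, ?_, ?_⟩
    · filter_upwards [Lp.coeFn_smul c (x 0), h0] with z a b
      exact a.trans (by rw [Pi.smul_apply, b, smul_eq_mul])
    · filter_upwards [Lp.coeFn_smul c (x 1), h1] with z a b
      have := hφ.fderiv_clm_comp (ContinuousLinearMap.mul ℝ ℂ c) z 1
      exact a.trans (by rw [Pi.smul_apply, b, smul_eq_mul]; exact this.symm)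
    · filter_upwards [Lp.coeFn_smul c (x 2), h2] with z a b
      have := hφ.fderiv_clm_comp (ContinuousLinearMap.mul ℝ ℂ c) z Complex.I
      exact a.trans (by rw [Pi.smul_apply, b, smul_eq_mul]; exact this.symm)

/-- `H₀¹(D)` as a closed subspace of the square-integrable triples. -/
noncomputable def sobolevSpace (D : Set ℂ) : Submodule ℂ (L2Triple D) := (testTriples D).topologicalClosure

theorem tendsto_eLpNorm_congr {f : ℕ → ℂ → ℂ} {f' : ℕ → ℂ → ℂ} {g g' : ℂ → ℂ} {μ : Measure ℂ}
    (h : Tendsto (fun k => eLpNorm (fun z => f k z - g z) 2 μ) atTop (𝓝 0))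
    (hf : ∀ k, f k =ᵐ[μ] f' k) (hg : g =ᵐ[μ] g') :
    Tendsto (fun k => eLpNorm (fun z => f' k z - g' z) 2 μ) atTop (𝓝 0) := by
  refine h.congr fun k => eLpNorm_congr_ae ?_
  filter_upwards [hf k, hg] with z a b
  rw [a, b]

theorem IsWeakDeriv.congr {e : ℂ} {u g u' g' : ℂ → ℂ} (h : IsWeakDeriv D e u g)
    (hu : u =ᵐ[volume.restrict D] u') (hg : g =ᵐ[volume.restrict D] g') :
    IsWeakDeriv D e u' g' := by
  intro φ hφ
  rw [integral_congr_ae (g := fun z => fderiv ℝ φ z e • u z), h φ hφ,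
    integral_congr_ae (g := fun z => φ z • g' z)]
  · filter_upwards [hg] with z a using by rw [a]
  · filter_upwards [hu] with z a using by rw [a]

theorem IsH10.congr {u ux uy u' ux' uy' : ℂ → ℂ} (h : IsH10 D u ux uy)
    (h0 : u =ᵐ[volume.restrict D] u') (h1 : ux =ᵐ[volume.restrict D] ux')
    (h2 : uy =ᵐ[volume.restrict D] uy') : IsH10 D u' ux' uy' := by
  obtain ⟨φ, hφ, a, b, c⟩ := h.approx
  exact ⟨⟨h.isH1.memLp.ae_eq h0, h.isH1.memLp_x.ae_eq h1, h.isH1.memLp_y.ae_eq h2,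
    h.isH1.deriv_x.congr h0 h1, h.isH1.deriv_y.congr h0 h2⟩, φ, hφ,
    tendsto_eLpNorm_congr a (fun _ => EventuallyEq.rfl) h0,
    tendsto_eLpNorm_congr b (fun _ => EventuallyEq.rfl) h1,
    tendsto_eLpNorm_congr c (fun _ => EventuallyEq.rfl) h2⟩

/-- The weak derivatives need not be assumed: integration by parts holds for the approximating test
functions and passes to the `L²` limit. -/
theorem isH10_of_approx (hD : IsOpen D) (hb : Bornology.IsBounded D) {u ux uy : ℂ → ℂ}
    (h0 : MemLp u 2 (volume.restrict D)) (h1 : MemLp ux 2 (volume.restrict D))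
    (h2 : MemLp uy 2 (volume.restrict D)) {φ : ℕ → ℂ → ℂ} (hφ : ∀ k, IsTestFunction D (φ k))
    (t0 : Tendsto (fun k => eLpNorm (fun z => φ k z - u z) 2 (volume.restrict D)) atTop (𝓝 0))
    (t1 : Tendsto (fun k => eLpNorm (fun z => fderiv ℝ (φ k) z 1 - ux z) 2 (volume.restrict D))
      atTop (𝓝 0))
    (t2 : Tendsto (fun k => eLpNorm (fun z => fderiv ℝ (φ k) z Complex.I - uy z) 2
      (volume.restrict D)) atTop (𝓝 0)) : IsH10 D u ux uy := by
  have key : ∀ (e : ℂ) (ue : ℂ → ℂ), MemLp ue 2 (volume.restrict D) →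
      Tendsto (fun k => eLpNorm (fun z => fderiv ℝ (φ k) z e - ue z) 2 (volume.restrict D))
        atTop (𝓝 0) → IsWeakDeriv D e u ue := by
    intro e ue hue te χ hχ
    have m1 : MemLp (fun z => (fderiv ℝ χ z e : ℂ)) 2 (volume.restrict D) :=
      (hχ.memLp_fderiv hD hb e).ofReal
    have m2 : MemLp (fun z => (χ z : ℂ)) 2 (volume.restrict D) := (hχ.memLp hD hb).ofReal
    have a1 := tendsto_integral_smul_of_tendsto_eLpNorm (fun k => (hφ k).memLp hD hb) h0 m1 t0
    have a2 := (tendsto_integral_smul_of_tendsto_eLpNorm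
      (fun k => (hφ k).memLp_fderiv hD hb e) hue m2 te).neg
    have e1 : ∀ k, ∫ z in D, φ k z • (fderiv ℝ χ z e : ℂ) =
        -∫ z in D, fderiv ℝ (φ k) z e • (χ z : ℂ) := by
      intro k
      have := setIntegral_fderiv_smul_eq_neg hD hχ.contDiff_one hχ.compact hχ.support
        ((hφ k).contDiff_one.contDiffOn (s := D)) e
      simpa only [Complex.real_smul, smul_eq_mul, mul_comm] using this
    simp_rw [e1] at a1
    have := tendsto_nhds_unique a1 a2
    simpa only [Complex.real_smul, smul_eq_mul, mul_comm] using this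
  exact ⟨⟨h0, h1, h2, key _ _ h1 t1, key _ _ h2 t2⟩, φ, hφ, t0, t1, t2⟩

/-- With `IsH10.exists_mem_sobolevSpace`, this is the dictionary between the predicate on honest
functions and a complete space of classes, where Hilbert space methods and linearity are available.
-/
theorem isH10_of_mem_sobolevSpace (hD : IsOpen D) (hb : Bornology.IsBounded D) {x : L2Triple D}
    (hx : x ∈ sobolevSpace D) : IsH10 D (x 0) (x 1) (x 2) := by
  have hx' : x ∈ closure (testTriples D : Set (L2Triple D)) := hx
  obtain ⟨y, hy, hlim⟩ := mem_closure_iff_seq_limit.1 hx'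
  choose φ hφ h0 h1 h2 using hy
  have ht : ∀ i : Fin 3, Tendsto (fun k => eLpNorm (fun z => y k i z - x i z) 2
      (volume.restrict D)) atTop (𝓝 0) := by
    intro i
    have := ((PiLp.continuous_apply 2 _ i).tendsto x).comp hlim
    exact (Lp.tendsto_Lp_iff_tendsto_eLpNorm' _ _).1 this
  exact isH10_of_approx hD hb (Lp.memLp _) (Lp.memLp _) (Lp.memLp _) hφ
    (tendsto_eLpNorm_congr (ht 0) h0 EventuallyEq.rfl)
    (tendsto_eLpNorm_congr (ht 1) h1 EventuallyEq.rfl)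
    (tendsto_eLpNorm_congr (ht 2) h2 EventuallyEq.rfl)

theorem IsH10.exists_mem_sobolevSpace (hD : IsOpen D) (hb : Bornology.IsBounded D)
    {u ux uy : ℂ → ℂ} (h : IsH10 D u ux uy) : ∃ x ∈ sobolevSpace D,
    x 0 =ᵐ[volume.restrict D] u ∧ x 1 =ᵐ[volume.restrict D] ux ∧
    x 2 =ᵐ[volume.restrict D] uy := by
  obtain ⟨φ, hφ, h0, h1, h2⟩ := h.approx
  let x : L2Triple D := WithLp.toLp 2
    ![h.isH1.memLp.toLp u, h.isH1.memLp_x.toLp ux, h.isH1.memLp_y.toLp uy]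
  let y : ℕ → L2Triple D := fun k => WithLp.toLp 2 ![((hφ k).memLp hD hb).toLp (φ k),
    ((hφ k).memLp_fderiv hD hb 1).toLp (fun z => fderiv ℝ (φ k) z 1),
    ((hφ k).memLp_fderiv hD hb Complex.I).toLp (fun z => fderiv ℝ (φ k) z Complex.I)]
  refine ⟨x, ?_, h.isH1.memLp.coeFn_toLp, h.isH1.memLp_x.coeFn_toLp, h.isH1.memLp_y.coeFn_toLp⟩
  change x ∈ closure (testTriples D : Set (L2Triple D))
  refine mem_closure_iff_seq_limit.2 ⟨y, fun k => ⟨φ k, hφ k,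
    ((hφ k).memLp hD hb).coeFn_toLp, ((hφ k).memLp_fderiv hD hb 1).coeFn_toLp,
    ((hφ k).memLp_fderiv hD hb Complex.I).coeFn_toLp⟩, ?_⟩
  have hlim : Tendsto (fun k => WithLp.ofLp (y k)) atTop (𝓝 (WithLp.ofLp x)) := by
    refine tendsto_pi_nhds.2 fun i => ?_
    fin_cases i
    · exact (Lp.tendsto_Lp_iff_tendsto_eLpNorm'' _ (fun k => (hφ k).memLp hD hb) _
        h.isH1.memLp).2 h0
    · exact (Lp.tendsto_Lp_iff_tendsto_eLpNorm'' _ (fun k => (hφ k).memLp_fderiv hD hb 1) _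
        h.isH1.memLp_x).2 h1
    · exact (Lp.tendsto_Lp_iff_tendsto_eLpNorm'' _
        (fun k => (hφ k).memLp_fderiv hD hb Complex.I) _ h.isH1.memLp_y).2 h2
  exact ((PiLp.continuous_toLp 2 _).tendsto _).comp hlim

theorem IsH10.sub (hD : IsOpen D) (hb : Bornology.IsBounded D)
    {u ux uy w wx wy : ℂ → ℂ} (h : IsH10 D u ux uy) (k : IsH10 D w wx wy) :
    IsH10 D (fun z => u z - w z) (fun z => ux z - wx z) (fun z => uy z - wy z) := by
  obtain ⟨x, hx, a0, a1, a2⟩ := h.exists_mem_sobolevSpace hD hb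
  obtain ⟨y, hy, b0, b1, b2⟩ := k.exists_mem_sobolevSpace hD hb
  have := isH10_of_mem_sobolevSpace hD hb (Submodule.sub_mem _ hx hy)
  refine this.congr ?_ ?_ ?_
  · filter_upwards [Lp.coeFn_sub (x 0) (y 0), a0, b0] with z a b c
    exact a.trans (by rw [Pi.sub_apply, b, c])
  · filter_upwards [Lp.coeFn_sub (x 1) (y 1), a1, b1] with z a b c
    exact a.trans (by rw [Pi.sub_apply, b, c])
  · filter_upwards [Lp.coeFn_sub (x 2) (y 2), a2, b2] with z a b c
    exact a.trans (by rw [Pi.sub_apply, b, c])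

/-! ### Weak equations for complex-valued functions -/

section Weak

variable {a b c : ℂ → ℂ}

theorem integrable_weak {F G : Type*} [NormedRing F] [NormedAddCommGroup G] [Module F G]
    [IsBoundedSMul F G] {μ : Measure ℂ} {f g h : ℂ → F}
    {a b c : ℂ → G} (hf : MemLp f 2 μ) (hg : MemLp g 2 μ) (hh : MemLp h 2 μ)
    (ha : MemLp a 2 μ) (hb : MemLp b 2 μ) (hc : MemLp c 2 μ) :
    Integrable (fun z => f z • a z + g z • b z + h z • c z) μ :=
  ((memLp_one_iff_integrable.1 (ha.smul hf)).add (memLp_one_iff_integrable.1 (hb.smul hg))).add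
    (memLp_one_iff_integrable.1 (hc.smul hh))

/-- `IsWeakLaplacian` only speaks of real test functions; a complex one is handled through its real
and imaginary parts. -/
theorem IsWeakLaplacian.integral_testFunction (hD : IsOpen D) (hb' : Bornology.IsBounded D)
    (h : IsWeakLaplacian D a b c)
    (ha : MemLp a 2 (volume.restrict D)) (hb : MemLp b 2 (volume.restrict D))
    (hc : MemLp c 2 (volume.restrict D)) {φ : ℂ → ℂ} (hφ : IsTestFunction D φ) :
    ∫ z in D, (fderiv ℝ φ z 1 • a z + fderiv ℝ φ z Complex.I • b z + φ z • c z) = 0 := by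
  have hr := hφ.clm_comp Complex.reCLM
  have hi := hφ.clm_comp Complex.imCLM
  have er := h _ hr
  have ei := h _ hi
  have int : ∀ {ψ : ℂ → ℝ}, IsTestFunction D ψ → Integrable (fun z => fderiv ℝ ψ z 1 • a z +
      fderiv ℝ ψ z Complex.I • b z + ψ z • c z) (volume.restrict D) := fun hψ =>
    integrable_weak (hψ.memLp_fderiv hD hb' 1) (hψ.memLp_fderiv hD hb' Complex.I)
      (hψ.memLp hD hb') ha hb hc
  have := integral_add (int hr) ((int hi).const_mul Complex.I)
  rw [er, integral_const_mul, ei, mul_zero, add_zero] at this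
  rw [← this]
  congr 1; ext z
  have d1 := hφ.fderiv_clm_comp Complex.reCLM z 1
  have d2 := hφ.fderiv_clm_comp Complex.reCLM z Complex.I
  have d3 := hφ.fderiv_clm_comp Complex.imCLM z 1
  have d4 := hφ.fderiv_clm_comp Complex.imCLM z Complex.I
  rw [d1, d2, d3, d4]
  simp only [Complex.reCLM_apply, Complex.imCLM_apply, Complex.real_smul, smul_eq_mul]
  conv_lhs => rw [← Complex.re_add_im (fderiv ℝ φ z 1), ← Complex.re_add_im (φ z),
    ← Complex.re_add_im (fderiv ℝ φ z Complex.I)]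
  ring

/-- A weak equation may be tested with complex `H₀¹` functions. -/
theorem IsH10.integral_eq (hD : IsOpen D) (hb' : Bornology.IsBounded D) {u ux uy : ℂ → ℂ}
    (hu : IsH10 D u ux uy) (h : IsWeakLaplacian D a b c)
    (ha : MemLp a 2 (volume.restrict D)) (hb : MemLp b 2 (volume.restrict D))
    (hc : MemLp c 2 (volume.restrict D)) :
    ∫ z in D, (ux z • a z + uy z • b z + u z • c z) = 0 := by
  obtain ⟨φ, hφ, h0, h1, h2⟩ := hu.approx
  have int : ∀ {f g : ℂ → ℂ}, MemLp f 2 (volume.restrict D) →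
      MemLp g 2 (volume.restrict D) → Integrable (fun z => f z • g z) (volume.restrict D) :=
    fun hf hg => memLp_one_iff_integrable.1 (hg.smul hf)
  have t0 := tendsto_integral_smul_of_tendsto_eLpNorm (fun k => (hφ k).memLp hD hb')
    hu.isH1.memLp hc h0
  have t1 := tendsto_integral_smul_of_tendsto_eLpNorm (fun k => (hφ k).memLp_fderiv hD hb' 1)
    hu.isH1.memLp_x ha h1
  have t2 := tendsto_integral_smul_of_tendsto_eLpNorm
    (fun k => (hφ k).memLp_fderiv hD hb' Complex.I) hu.isH1.memLp_y hb h2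
  have t := (t1.add t2).add t0
  have hsum : ∀ {f g h : ℂ → ℂ}, MemLp f 2 (volume.restrict D) → MemLp g 2 (volume.restrict D) →
      MemLp h 2 (volume.restrict D) → ∫ z in D, (f z • a z + g z • b z + h z • c z) =
        (∫ z in D, f z • a z) + (∫ z in D, g z • b z) + ∫ z in D, h z • c z := by
    intro f g h hf hg hh
    rw [integral_add (f := fun z => f z • a z + g z • b z) ((int hf ha).add (int hg hb))
      (int hh hc), integral_add (int hf ha) (int hg hb)]
  rw [hsum hu.isH1.memLp_x hu.isH1.memLp_y hu.isH1.memLp]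
  refine tendsto_nhds_unique t (tendsto_const_nhds.congr fun k => ?_)
  rw [← hsum ((hφ k).memLp_fderiv hD hb' 1) ((hφ k).memLp_fderiv hD hb' Complex.I)
    ((hφ k).memLp hD hb')]
  exact (h.integral_testFunction hD hb' ha hb hc (hφ k)).symm

/-- Real parts of complex multiples of weak equations. -/
theorem IsWeakLaplacian.re_mul (hD : IsOpen D) (hb' : Bornology.IsBounded D)
    (h : IsWeakLaplacian D a b c)
    (ha : MemLp a 2 (volume.restrict D)) (hb : MemLp b 2 (volume.restrict D))
    (hc : MemLp c 2 (volume.restrict D)) (k : ℂ) (φ : ℂ → ℝ) (hφ : IsTestFunction D φ) :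
    ∫ z in D, (fderiv ℝ φ z 1 • (k * a z).re + fderiv ℝ φ z Complex.I • (k * b z).re +
      φ z • (k * c z).re) = 0 := by
  have int := integrable_weak (hφ.memLp_fderiv hD hb' 1) (hφ.memLp_fderiv hD hb' Complex.I)
    (hφ.memLp hD hb') ha hb hc
  have := (Complex.reCLM.comp (ContinuousLinearMap.mul ℝ ℂ k)).integral_comp_comm int
  rw [h φ hφ, map_zero] at this
  rw [← this]
  congr 1; ext z
  simp only [ContinuousLinearMap.comp_apply, ContinuousLinearMap.mul_apply',
    Complex.reCLM_apply, Complex.real_smul, smul_eq_mul, mul_add, Complex.add_re]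
  have e : ∀ (r : ℝ) (w : ℂ), (k * (r * w)).re = r * (k * w).re := fun r w => by
    rw [mul_left_comm, Complex.re_ofReal_mul]
  rw [e, e, e]

/-- `|u| ≤ C ‖Δu‖₂` for complex-valued `u ∈ H₀¹(D)`. -/
theorem exists_norm_le_sqrt_integral (D : Set ℂ) (hD : IsOpen D) (hb' : Bornology.IsBounded D) :
    ∃ C : ℝ, 0 ≤ C ∧ ∀ u ux uy h : ℂ → ℂ, IsH10 D u ux uy → MemLp h 2 (volume.restrict D) →
      IsWeakLaplacian D ux uy h →
      ∀ᵐ z ∂(volume.restrict D), ‖u z‖ ≤ C * √(∫ z in D, ‖h z‖ ^ 2) := by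
  obtain ⟨C, hC, hS⟩ := exists_le_sqrt_integral D hD hb'
  refine ⟨2 * C, by positivity, fun u ux uy h hu hh heq => ?_⟩
  have key : ∀ k : ℂ, ‖k‖ = 1 → ∀ᵐ z ∂(volume.restrict D),
      (k * u z).re ≤ C * √(∫ z in D, ‖h z‖ ^ 2) := by
    intro k hk
    have hm : MemLp (fun z => (k * h z).re) 2 (volume.restrict D) := (hh.const_mul k).re
    filter_upwards [hS _ _ _ _ (hu.re_mul k) hm
      (heq.re_mul hD hb' hu.isH1.memLp_x hu.isH1.memLp_y hh k)] with z hz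
    refine hz.trans ?_
    refine mul_le_mul_of_nonneg_left (Real.sqrt_le_sqrt (integral_mono hm.integrable_sq
      hh.norm.integrable_sq fun w => ?_)) hC
    · have : |(k * h w).re| ≤ ‖h w‖ := (Complex.abs_re_le_norm _).trans (by simp [hk])
      exact sq_le_sq' (neg_le_of_abs_le this) (le_of_abs_le this)
  -- Multiplication by the four units `±1, ±i` controls the real and imaginary parts from both
  -- sides; the factor `2` is the price of adding them.
  filter_upwards [key 1 (by simp), key (-1) (by simp), key Complex.I (by simp),
    key (-Complex.I) (by simp)] with z h1 h2 h3 h4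
  simp at h1 h2 h3 h4
  refine (Complex.norm_le_abs_re_add_abs_im _).trans ?_
  have a1 := abs_le.2 ⟨by linarith, h1⟩
  have a2 := abs_le.2 ⟨by linarith, h4⟩
  linarith

end Weak

end

section

variable {D : Set ℂ}

/-! ### Compactness of operators from `L²` to `L^∞` -/

section Compact

variable {α : Type*} {mα : MeasurableSpace α} {μ : Measure α} [IsFiniteMeasure μ]
  {T : Lp ℂ 2 μ →L[ℂ] Lp ℂ 2 μ} {C : ℝ}

/-- The Hilbert–Schmidt bound: for almost every `x`, the functional `a ↦ ∑ aᵢ (T eᵢ)(x)` has norm at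
most `C` on `ℓ²`, so `∑ |(T eᵢ)(x)|² ≤ C²`, and this is integrated over a finite measure. The bound
does not depend on the number of vectors. -/
theorem sum_norm_sq_le_of_ae_bound (hC : 0 ≤ C) (hT : ∀ f, ∀ᵐ x ∂μ, ‖T f x‖ ≤ C * ‖f‖) {N : ℕ}
    {e : Fin N → Lp ℂ 2 μ} (he : Orthonormal ℂ e) :
    ∑ i, ‖T (e i)‖ ^ 2 ≤ C ^ 2 * μ.real univ := by
  -- The exceptional null set depends on the coefficient vector; a countable dense family and
  -- continuity in the coefficients give one null set for all.
  let q : ℕ → EuclideanSpace ℂ (Fin N) := TopologicalSpace.denseSeq _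
  have hlin : ∀ a : EuclideanSpace ℂ (Fin N), ∀ᵐ x ∂μ, ‖∑ i, a i * T (e i) x‖ ≤ C * ‖a‖ := by
    intro a
    have hnorm : ‖∑ i, a i • e i‖ = ‖a‖ := by
      rw [EuclideanSpace.norm_eq, ← Real.sqrt_sq (norm_nonneg (∑ i, a i • e i))]
      congr 1
      have := he.inner_sum (fun i => a i) (fun i => a i) Finset.univ
      have h2 := inner_self_eq_norm_sq (𝕜 := ℂ) (∑ i, a i • e i)
      rw [this] at h2
      rw [← h2, map_sum]
      refine Finset.sum_congr rfl fun i _ => ?_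
      rw [← Complex.normSq_eq_conj_mul_self, Complex.normSq_eq_norm_sq]
      exact (Complex.ofReal_re _).symm
    have hsum : ∀ s : Finset (Fin N), ∀ᵐ x ∂μ, T (∑ i ∈ s, a i • e i) x =
        ∑ i ∈ s, a i * T (e i) x := by
      intro s
      induction s using Finset.induction_on with
      | empty =>
        simp only [Finset.sum_empty, map_zero]
        exact Lp.coeFn_zero _ _ _
      | insert i s hi ih =>
        rw [Finset.sum_insert hi, map_add, map_smul]
        filter_upwards [Lp.coeFn_add (a i • T (e i)) (T (∑ i ∈ s, a i • e i)),
          Lp.coeFn_smul (a i) (T (e i)), ih] with x h1 h2 h3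
        rw [h1, Pi.add_apply, h2, h3, Finset.sum_insert hi, Pi.smul_apply, smul_eq_mul]
    filter_upwards [hT (∑ i, a i • e i), hsum Finset.univ] with x h1 h2
    rw [← h2, ← hnorm]; exact h1
  have hall : ∀ᵐ x ∂μ, ∀ a : EuclideanSpace ℂ (Fin N), ‖∑ i, a i * T (e i) x‖ ≤ C * ‖a‖ := by
    filter_upwards [ae_all_iff.2 fun k => hlin (q k)] with x hx a
    refine (TopologicalSpace.denseRange_denseSeq _).induction_on (p := fun a :
      EuclideanSpace ℂ (Fin N) => ‖∑ i, a i * T (e i) x‖ ≤ C * ‖a‖) a ?_ hx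
    exact isClosed_le (by fun_prop) (by fun_prop)
  have hpt : ∀ᵐ x ∂μ, ∑ i, ‖T (e i) x‖ ^ 2 ≤ C ^ 2 := by
    filter_upwards [hall] with x hx
    -- The vector extremal in Cauchy–Schwarz: the conjugates of the values at `x`.
    have h1 := hx (WithLp.toLp 2 fun i => (starRingEnd ℂ) (T (e i) x))
    have h2 : ∑ i, (starRingEnd ℂ) (T (e i) x) * T (e i) x =
        ((∑ i, ‖T (e i) x‖ ^ 2 : ℝ) : ℂ) := by
      push_cast
      exact Finset.sum_congr rfl fun i _ => by
        rw [← Complex.normSq_eq_conj_mul_self, Complex.normSq_eq_norm_sq]; push_cast; rfl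
    rw [EuclideanSpace.norm_eq] at h1
    simp only [h2, RCLike.norm_conj] at h1
    set S := ∑ i, ‖T (e i) x‖ ^ 2
    have hS : 0 ≤ S := Finset.sum_nonneg fun i _ => sq_nonneg _
    rw [Complex.norm_real, Real.norm_of_nonneg hS] at h1
    have h3 : √S * √S = S := Real.mul_self_sqrt hS
    have h4 : √S ≤ C := by
      by_contra hcon
      nlinarith [Real.sqrt_nonneg S]
    nlinarith [Real.sqrt_nonneg S]
  have hn : ∀ f : Lp ℂ 2 μ, ‖f‖ ^ 2 = ∫ x, ‖f x‖ ^ 2 ∂μ := by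
    intro f
    rw [← inner_self_eq_norm_sq (𝕜 := ℂ) f, L2.inner_def, ← integral_re (L2.integrable_inner f f)]
    congr 1; ext x
    exact inner_self_eq_norm_sq (𝕜 := ℂ) _
  simp_rw [hn]
  rw [← integral_finsetSum _ fun i _ => (Lp.memLp (T (e i))).norm.integrable_sq]
  calc _ ≤ ∫ _, C ^ 2 ∂μ := integral_mono_ae
        (integrable_finsetSum _ fun i _ => (Lp.memLp (T (e i))).norm.integrable_sq)
        (integrable_const _) hpt
    _ = _ := by rw [integral_const, smul_eq_mul, mul_comm]

/-- `T` is small on the orthogonal complement of some finite-dimensional subspace, hence a norm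
limit of finite-rank operators. Otherwise orthonormal families of any length could be chosen
greedily with `‖T eᵢ‖ > ε`, against the Hilbert–Schmidt bound. -/
theorem isCompactOperator_of_ae_bound (hC : 0 ≤ C)
    (hT : ∀ f, ∀ᵐ x ∂μ, ‖T f x‖ ≤ C * ‖f‖) : IsCompactOperator T := by
  have hV : ∀ ε : ℝ, 0 < ε → ∃ V : Submodule ℂ (Lp ℂ 2 μ), FiniteDimensional ℂ V ∧
      ∀ x ∈ Vᗮ, ‖T x‖ ≤ ε * ‖x‖ := by
    intro ε hε
    by_contra! hcon
    have hseq : ∀ N : ℕ, ∃ e : Fin N → Lp ℂ 2 μ, Orthonormal ℂ e ∧ ∀ i, ε < ‖T (e i)‖ := by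
      intro N
      induction N with
      | zero => exact ⟨Fin.elim0, ⟨fun i => i.elim0, fun i => i.elim0⟩, fun i => i.elim0⟩
      | succ N ih =>
        obtain ⟨e, he, hTe⟩ := ih
        obtain ⟨x, hx, hTx⟩ := hcon (Submodule.span ℂ (range e))
          (FiniteDimensional.span_of_finite ℂ (finite_range e))
        have hx0 : x ≠ 0 := by
          rintro rfl
          simp at hTx
        have hxn : 0 < ‖x‖ := norm_pos_iff.2 hx0
        have horth : ∀ i, inner ℂ (e i) x = 0 := fun i =>
          (Submodule.mem_orthogonal _ x).1 hx (e i) (Submodule.subset_span (mem_range_self i))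
        refine ⟨Fin.cons (((‖x‖⁻¹ : ℝ) : ℂ) • x) e, ⟨?_, ?_⟩, ?_⟩
        · refine Fin.cases ?_ fun i => ?_
          · rw [Fin.cons_zero, norm_smul, Complex.norm_real, norm_inv, norm_norm,
              inv_mul_cancel₀ hxn.ne']
          · rw [Fin.cons_succ]; exact he.1 i
        · intro i j
          refine Fin.cases ?_ (fun i => ?_) i <;> refine Fin.cases ?_ (fun j => ?_) j
          · exact fun h => absurd rfl h
          · intro _
            simp only [Fin.cons_zero, Fin.cons_succ]
            rw [inner_smul_left, ← inner_conj_symm, horth]; simp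
          · intro _
            simp only [Fin.cons_zero, Fin.cons_succ]
            rw [inner_smul_right, horth, mul_zero]
          · intro h
            simp only [Fin.cons_succ]
            exact he.2 fun h' => h (by rw [h'])
        · refine Fin.cases ?_ fun i => ?_
          · rw [Fin.cons_zero, map_smul, norm_smul, Complex.norm_real, norm_inv, norm_norm,
              inv_mul_eq_div, lt_div_iff₀ hxn]
            exact hTx
          · rw [Fin.cons_succ]; exact hTe i
    obtain ⟨N, hN⟩ := exists_nat_gt (C ^ 2 * μ.real univ / ε ^ 2)
    obtain ⟨e, he, hTe⟩ := hseq N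
    have h1 := sum_norm_sq_le_of_ae_bound hC hT he
    have h2 : ∑ _i : Fin N, ε ^ 2 ≤ ∑ i, ‖T (e i)‖ ^ 2 :=
      Finset.sum_le_sum fun i _ => pow_le_pow_left₀ hε.le (hTe i).le 2
    rw [div_lt_iff₀ (by positivity)] at hN
    simp at h2
    linarith
  choose V hVf hVT using fun k : ℕ => hV (1 / ((k : ℝ) + 1)) (by positivity)
  let P : ℕ → (Lp ℂ 2 μ →L[ℂ] Lp ℂ 2 μ) := fun k =>
    haveI := hVf k
    (T ∘L (V k).subtypeL) ∘L (V k).orthogonalProjectionOnto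
  refine isCompactOperator_of_tendsto (F := P) (l := atTop) ?_ (Eventually.of_forall fun k => ?_)
  · rw [tendsto_iff_norm_sub_tendsto_zero]
    refine squeeze_zero (fun _ => norm_nonneg _) (fun k => ?_)
      (tendsto_one_div_add_atTop_nhds_zero_nat (𝕜 := ℝ))
    have := hVf k
    refine ContinuousLinearMap.opNorm_le_bound _ (by positivity) fun x => ?_
    have hx : x - (V k).starProjection x ∈ (V k)ᗮ :=
      Submodule.sub_starProjection_mem_orthogonal x
    have h1 : (P k - T) x = -T (x - (V k).starProjection x) := by
      rw [map_sub, neg_sub]; rfl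
    rw [h1, norm_neg]
    refine (hVT k _ hx).trans ?_
    gcongr
    have h2 := Submodule.norm_sq_eq_add_norm_sq_starProjection x (V k)
    rw [Submodule.starProjection_orthogonal_val] at h2
    nlinarith [norm_nonneg x, norm_nonneg (x - (V k).starProjection x),
      sq_nonneg ‖(V k).starProjection x‖]
  · have := hVf k
    have : ProperSpace (V k) := FiniteDimensional.proper ℂ (V k)
    exact (isCompactOperator_of_locallyCompactSpace_rng (T ∘L (V k).subtypeL)).comp_clm _

end Compact

/-! ### The Fredholm alternative for systems -/

/-- The Fredholm alternative for the compact operator `T ∘ M`: either `-1` is an eigenvalue, which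
injectivity excludes, or it lies in the resolvent set. The finite index set keeps the coordinatewise
action of `T` compact. -/
theorem surjective_of_compact {E ι : Type*} [NormedAddCommGroup E] [NormedSpace ℂ E]
    [CompleteSpace E] [Fintype ι] {T : E →L[ℂ] E} (hT : IsCompactOperator T)
    (M : (ι → E) →L[ℂ] (ι → E)) (hinj : ∀ x : ι → E, (∀ i, x i + T (M x i) = 0) → x = 0)
    (y : ι → E) : ∃ x : ι → E, ∀ i, x i + T (M x i) = y i := by
  let Tι : (ι → E) →L[ℂ] (ι → E) := ContinuousLinearMap.pi fun i => T ∘L ContinuousLinearMap.proj i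
  have hTι : IsCompactOperator Tι := by
    obtain ⟨K, hK, hTK⟩ := hT
    refine ⟨Set.pi univ fun _ => K, isCompact_univ_pi fun _ => hK, ?_⟩
    have : Set.pi univ (fun _ : ι => T ⁻¹' K) ∈ 𝓝 (0 : ι → E) :=
      set_pi_mem_nhds finite_univ fun i _ => hTK
    exact mem_of_superset this fun x hx i hi => hx i hi
  have hK : IsCompactOperator (Tι ∘L M) := hTι.comp_clm M
  rcases hK.hasEigenvalue_or_mem_resolventSet (μ := -1) (by norm_num) with h | h
  · exfalso
    obtain ⟨x, hx⟩ := h.exists_hasEigenvector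
    have h1 := hx.apply_eq_smul
    refine hx.2 (hinj x fun i => ?_)
    have h2 := congrFun h1 i
    have h3 : T (M x i) = -x i := by simpa [Tι] using h2
    rw [h3, add_neg_cancel]
  · rw [spectrum.mem_resolventSet_iff, ContinuousLinearMap.isUnit_iff_bijective] at h
    obtain ⟨x, hx⟩ := h.2 (-y)
    refine ⟨x, fun i => ?_⟩
    have h2 := congrFun hx i
    have h3 : -x i - T (M x i) = -y i := by
      simpa [Tι, Algebra.algebraMap_eq_smul_one] using h2
    rw [← neg_inj, ← h3]; abel

/-- Multiplication by a bounded function, as an operator of `L²`. -/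
theorem exists_mulOp {μ : Measure ℂ} {a : ℂ → ℂ} (ha : AEStronglyMeasurable a μ) {C : ℝ}
    (hC : ∀ᵐ z ∂μ, ‖a z‖ ≤ C) :
    ∃ A : Lp ℂ 2 μ →L[ℂ] Lp ℂ 2 μ, ∀ f, A f =ᵐ[μ] fun z => a z * f z := by
  have hm : ∀ f : Lp ℂ 2 μ, MemLp (fun z => a z * f z) 2 μ := fun f =>
    MemLp.of_le_mul (c := C) (Lp.memLp f) (ha.mul (Lp.memLp f).1) (by
      filter_upwards [hC] with z hz
      rw [norm_mul]; gcongr)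
  let A : Lp ℂ 2 μ →ₗ[ℂ] Lp ℂ 2 μ :=
    { toFun := fun f => (hm f).toLp _
      map_add' := fun f g => by
        ext1
        filter_upwards [(hm (f + g)).coeFn_toLp, (hm f).coeFn_toLp, (hm g).coeFn_toLp,
          Lp.coeFn_add f g, Lp.coeFn_add ((hm f).toLp _) ((hm g).toLp _)] with z h1 h2 h3 h4 h5
        rw [h1, h5, Pi.add_apply, h2, h3, h4, Pi.add_apply, mul_add]
      map_smul' := fun c f => by
        ext1
        filter_upwards [(hm (c • f)).coeFn_toLp, (hm f).coeFn_toLp, Lp.coeFn_smul c f,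
          Lp.coeFn_smul c ((hm f).toLp _)] with z h1 h2 h3 h4
        simp only [RingHom.id_apply]
        rw [h1, h4, Pi.smul_apply, h2, h3, Pi.smul_apply, smul_eq_mul, smul_eq_mul]
        ring }
  refine ⟨A.mkContinuous C fun f => ?_, fun f => (hm f).coeFn_toLp⟩
  refine Lp.norm_le_mul_norm_of_ae_le_mul ?_
  filter_upwards [(hm f).coeFn_toLp, hC] with z h1 h2
  change ‖(hm f).toLp _ z‖ ≤ _
  rw [h1, norm_mul]; gcongr

/-! ### The solution operator -/

noncomputable instance : CompleteSpace (sobolevSpace D) :=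
  Submodule.topologicalClosure.completeSpace _

/-- The solution operator of `-Δw + w = f`, `w ∈ H₀¹(D)`. -/
theorem exists_solutionOp (hD : IsOpen D) (hb : Bornology.IsBounded D) :
    ∃ T : Lp ℂ 2 (volume.restrict D) →L[ℂ] Lp ℂ 2 (volume.restrict D), ∀ f, ∃ wx wy : ℂ → ℂ,
      IsH10 D (T f) wx wy ∧ IsWeakLaplacian D wx wy (fun z => T f z - f z) := by
  let J : sobolevSpace D →L[ℂ] Lp ℂ 2 (volume.restrict D) :=
    (PiLp.proj 2 (𝕜 := ℂ) (fun _ : Fin 3 => Lp ℂ 2 (volume.restrict D)) 0) ∘L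
      (sobolevSpace D).subtypeL
  -- With `J` the inclusion of `H₀¹` in `L²`, the vector `x = J* f` satisfies `⟪y, x⟫ = ⟪J y, f⟫`
  -- for all `y`. As the inner product on the left is the full `H¹` one, this is the weak form of
  -- `-Δw + w = f`.
  refine ⟨J ∘L ContinuousLinearMap.adjoint J, fun f => ?_⟩
  set x := ContinuousLinearMap.adjoint J f
  have hx := isH10_of_mem_sobolevSpace hD hb x.2
  refine ⟨x.1 1, x.1 2, hx, fun φ hφ => ?_⟩
  have hφc : IsTestFunction D (fun z => (φ z : ℂ)) := hφ.clm_comp Complex.ofRealCLM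
  have hφd : ∀ z e, fderiv ℝ (fun z => (φ z : ℂ)) z e = (fderiv ℝ φ z e : ℂ) := fun z e =>
    hφ.fderiv_clm_comp Complex.ofRealCLM z e
  have m0 := hφc.memLp hD hb
  have m1 := hφc.memLp_fderiv hD hb 1
  have m2 := hφc.memLp_fderiv hD hb Complex.I
  let y : sobolevSpace D := ⟨WithLp.toLp 2 ![m0.toLp _, m1.toLp _, m2.toLp _],
    (testTriples D).le_topologicalClosure ⟨_, hφc, m0.coeFn_toLp, m1.coeFn_toLp, m2.coeFn_toLp⟩⟩
  have h1 : inner ℂ y x = inner ℂ (J y) f := ContinuousLinearMap.adjoint_inner_right J y f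
  have h2 : inner ℂ y x = inner ℂ (y.1 0) (x.1 0) + inner ℂ (y.1 1) (x.1 1) +
      inner ℂ (y.1 2) (x.1 2) := by
    rw [Submodule.coe_inner, PiLp.inner_apply, Fin.sum_univ_three]
  have h3 : ∀ {g : ℂ → ℝ} {h : ℂ → ℂ} (hh : MemLp h 2 (volume.restrict D))
      (k : Lp ℂ 2 (volume.restrict D)), (∀ z, h z = g z) →
      inner ℂ (hh.toLp h) k = ∫ z in D, g z • k z := by
    intro g h hh k hgh
    rw [L2.inner_def]
    refine integral_congr_ae ?_
    filter_upwards [hh.coeFn_toLp] with z hz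
    rw [hz, hgh, RCLike.inner_apply, Complex.conj_ofReal, Complex.real_smul, mul_comm]
  have e0 : inner ℂ (y.1 0) (x.1 0) = ∫ z in D, φ z • x.1 0 z := h3 m0 _ fun _ => rfl
  have e1 : inner ℂ (y.1 1) (x.1 1) = ∫ z in D, fderiv ℝ φ z 1 • x.1 1 z :=
    h3 m1 _ fun z => hφd z 1
  have e2 : inner ℂ (y.1 2) (x.1 2) = ∫ z in D, fderiv ℝ φ z Complex.I • x.1 2 z :=
    h3 m2 _ fun z => hφd z Complex.I
  have e3 : inner ℂ (J y) f = ∫ z in D, φ z • f z := h3 m0 _ fun _ => rfl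
  rw [h2, e0, e1, e2, e3] at h1
  have int : ∀ {f : ℂ → ℝ} {g : ℂ → ℂ}, MemLp f 2 (volume.restrict D) →
      MemLp g 2 (volume.restrict D) → Integrable (fun z => f z • g z) (volume.restrict D) :=
    fun hf hg => memLp_one_iff_integrable.1 (hg.smul hf)
  have i0 := int (hφ.memLp hD hb) (Lp.memLp (x.1 0))
  have i1 := int (hφ.memLp_fderiv hD hb 1) (Lp.memLp (x.1 1))
  have i2 := int (hφ.memLp_fderiv hD hb Complex.I) (Lp.memLp (x.1 2))
  have i3 := int (hφ.memLp hD hb) (Lp.memLp f)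
  have e4 : ∀ z, fderiv ℝ φ z 1 • x.1 1 z + fderiv ℝ φ z Complex.I • x.1 2 z +
      φ z • (x.1 0 z - f z) = fderiv ℝ φ z 1 • x.1 1 z + fderiv ℝ φ z Complex.I • x.1 2 z +
      (φ z • x.1 0 z - φ z • f z) := fun z => by rw [smul_sub]
  change ∫ z in D, (fderiv ℝ φ z 1 • x.1 1 z + fderiv ℝ φ z Complex.I • x.1 2 z +
      φ z • (x.1 0 z - f z)) = 0
  simp_rw [e4]
  rw [integral_add (f := fun z => fderiv ℝ φ z 1 • x.1 1 z + fderiv ℝ φ z Complex.I • x.1 2 z)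
    (g := fun z => φ z • x.1 0 z - φ z • f z) (i1.add i2) (i0.sub i3), integral_add i1 i2, integral_sub i0 i3, ← h1]
  ring

end

section

variable {D : Set ℂ} {n : ℕ}

/-! ### Solvability of the system and the transposed potential -/

theorem IsWeakLaplacian.congr {a b c c' : ℂ → ℂ} (h : IsWeakLaplacian D a b c)
    (hc : c =ᵐ[volume.restrict D] c') : IsWeakLaplacian D a b c' := by
  intro φ hφ
  rw [← h φ hφ]
  refine integral_congr_ae ?_
  filter_upwards [hc] with z hz
  rw [hz]

/-- Square-integrability of the entries of a product with a bounded potential. -/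
theorem memLp_mul_apply {μ : Measure ℂ} {v w : ℂ → Matrix (Fin n) (Fin n) ℂ}
    (hv : ∀ i j, MemLp (fun z => v z i j) ⊤ μ) {p : ℝ≥0∞} (hw : ∀ i j, MemLp (fun z => w z i j) p μ)
    (i j : Fin n) : MemLp (fun z => (v z * w z) i j) p μ := by
  simp only [Matrix.mul_apply]
  exact memLp_finsetSum _ fun k _ => (hw k j).mul (hv i k)

/-- If `0` is not a Dirichlet eigenvalue of `-Δ + v`, then `-Δw + vw = F` has a solution in
`H₀¹(D)` for every square-integrable `F`. -/
theorem exists_isH10_solution (hD : IsOpen D) (hb : Bornology.IsBounded D)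
    {v : ℂ → Matrix (Fin n) (Fin n) ℂ} (hv : ∀ i j, MemLp (fun z => v z i j) ⊤ (volume.restrict D))
    (hdir : ZeroNotDirichletEigenvalue D v) {F : ℂ → Matrix (Fin n) (Fin n) ℂ}
    (hF : ∀ i j, MemLp (fun z => F z i j) 2 (volume.restrict D)) :
    ∃ w wx wy : ℂ → Matrix (Fin n) (Fin n) ℂ, ∀ i j,
      IsH10 D (fun z => w z i j) (fun z => wx z i j) (fun z => wy z i j) ∧
      IsWeakLaplacian D (fun z => wx z i j) (fun z => wy z i j)
        (fun z => (v z * w z) i j - F z i j) := by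
  have hfin := isFiniteMeasure_restrict hb
  obtain ⟨T, hT⟩ := exists_solutionOp hD hb
  -- `T f` has weak Laplacian `T f - f`, of `L²` norm at most `(‖T‖ + 1) ‖f‖`, so Stampacchia's
  -- bound makes `T` bounded from `L²` to `L^∞`.
  have hcomp : IsCompactOperator T := by
    obtain ⟨C, hC, hbound⟩ := exists_norm_le_sqrt_integral D hD hb
    refine isCompactOperator_of_ae_bound (C := C * (‖T‖ + 1)) (by positivity) fun f => ?_
    obtain ⟨wx, wy, h1, h2⟩ := hT f
    filter_upwards [hbound _ _ _ (fun z => T f z - f z) h1 ((Lp.memLp (T f)).sub (Lp.memLp f)) h2] with z hz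
    refine hz.trans ?_
    have e : √(∫ z in D, ‖T f z - f z‖ ^ 2) = ‖T f - f‖ := by
      rw [Lp.norm_def, (Lp.memLp (T f - f)).eLpNorm_eq_integral_rpow_norm two_ne_zero
        ENNReal.ofNat_ne_top, ENNReal.toReal_ofReal (by positivity), Real.sqrt_eq_rpow]
      simp only [ENNReal.toReal_ofNat, Real.rpow_ofNat, one_div]
      congr 1
      refine integral_congr_ae ?_
      filter_upwards [Lp.coeFn_sub (T f) f] with w hw
      rw [hw, Pi.sub_apply]
    rw [e, mul_assoc]
    refine mul_le_mul_of_nonneg_left ?_ hC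
    calc ‖T f - f‖ ≤ ‖T f‖ + ‖f‖ := norm_sub_le _ _
      _ ≤ ‖T‖ * ‖f‖ + ‖f‖ := by gcongr; exact T.le_opNorm f
      _ = _ := by ring
  have hA : ∀ i j, ∃ A : Lp ℂ 2 (volume.restrict D) →L[ℂ] Lp ℂ 2 (volume.restrict D),
      ∀ f, A f =ᵐ[volume.restrict D] fun z => v z i j * f z := fun i j =>
    exists_mulOp (hv i j).1 (C := (eLpNorm (fun z => v z i j) ⊤ (volume.restrict D)).toReal) (by
      have h1 := ae_le_eLpNormEssSup (f := fun z => v z i j) (μ := volume.restrict D)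
      have h2 := (hv i j).eLpNorm_ne_top
      rw [eLpNorm_exponent_top] at h2 ⊢
      filter_upwards [h1] with z hz
      have := ENNReal.toReal_mono h2 hz
      simpa using this)
  choose A hA using hA
  let P : ∀ p : Fin n × Fin n, (Fin n × Fin n → Lp ℂ 2 (volume.restrict D)) →L[ℂ]
      Lp ℂ 2 (volume.restrict D) := fun p =>
    ContinuousLinearMap.proj (R := ℂ) (φ := fun _ => Lp ℂ 2 (volume.restrict D)) p
  -- `M` is multiplication by `v - 1`. The equation `-Δw + vw = F` is `-Δw + w = F - (v - 1)w`, that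
  -- is `w + T (M w) = T F`, for all entries together.
  let M : (Fin n × Fin n → Lp ℂ 2 (volume.restrict D)) →L[ℂ]
      (Fin n × Fin n → Lp ℂ 2 (volume.restrict D)) :=
    ContinuousLinearMap.pi fun p => (∑ k, A p.1 k ∘L P (k, p.2)) - P p
  let mat : (Fin n × Fin n → Lp ℂ 2 (volume.restrict D)) → ℂ → Matrix (Fin n) (Fin n) ℂ :=
    fun x z => Matrix.of fun i j => x (i, j) z
  have hsum : ∀ (s : Finset (Fin n)) (x : Fin n × Fin n → Lp ℂ 2 (volume.restrict D)) (i j : Fin n),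
      (∑ k ∈ s, A i k (x (k, j)) : Lp ℂ 2 (volume.restrict D)) =ᵐ[volume.restrict D]
        fun z => ∑ k ∈ s, v z i k * x (k, j) z := by
    intro s x i j
    induction s using Finset.induction_on with
    | empty =>
      simp only [Finset.sum_empty]
      exact Lp.coeFn_zero _ _ _
    | insert k s hk ih =>
      rw [Finset.sum_insert hk]
      filter_upwards [Lp.coeFn_add (A i k (x (k, j))) (∑ k ∈ s, A i k (x (k, j))),
        hA i k (x (k, j)), ih] with z h1 h2 h3
      rw [h1, Pi.add_apply, h2, h3, Finset.sum_insert hk]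
  have hM : ∀ x i j, M x (i, j) =ᵐ[volume.restrict D]
      fun z => (v z * mat x z) i j - x (i, j) z := by
    intro x i j
    have e : M x (i, j) = (∑ k, A i k (x (k, j))) - x (i, j) := by
      simp [M, P]
    rw [e]
    filter_upwards [Lp.coeFn_sub (∑ k, A i k (x (k, j))) (x (i, j)),
      hsum Finset.univ x i j] with z h1 h2
    rw [h1, Pi.sub_apply, h2, Matrix.mul_apply]
    rfl
  have hsolve : ∀ x f : Fin n × Fin n → Lp ℂ 2 (volume.restrict D),
      (∀ p, x p + T (M x p) = T (f p)) → ∀ p : Fin n × Fin n, ∃ wx wy : ℂ → ℂ,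
      IsH10 D (x p) wx wy ∧
      IsWeakLaplacian D wx wy (fun z => (v z * mat x z) p.1 p.2 - f p z) := by
    rintro x f h ⟨i, j⟩
    have hx : x (i, j) = T (f (i, j) - M x (i, j)) := by
      rw [map_sub, ← h, add_sub_cancel_right]
    obtain ⟨wx, wy, h1, h2⟩ := hT (f (i, j) - M x (i, j))
    rw [← hx] at h1 h2
    refine ⟨wx, wy, h1, h2.congr ?_⟩
    filter_upwards [hM x i j, Lp.coeFn_sub (f (i, j)) (M x (i, j))] with z h3 h4
    rw [h4, Pi.sub_apply, h3]
    ring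
  -- A solution of the homogeneous system is a Dirichlet eigenfunction for the eigenvalue `0`, hence
  -- zero by assumption.
  have hinj : ∀ x, (∀ p, x p + T (M x p) = 0) → x = 0 := by
    intro x hx
    choose wx wy h1 h2 using hsolve x 0 (fun p => by rw [hx p, Pi.zero_apply, map_zero])
    have := hdir (mat x) (fun z => Matrix.of fun i j => wx (i, j) z)
      (fun z => Matrix.of fun i j => wy (i, j) z) (fun i j => h1 (i, j))
      (fun i j => (h2 (i, j)).congr (by
        filter_upwards [Lp.coeFn_zero ℂ 2 (volume.restrict D)] with z hz
        rw [Pi.zero_apply, hz, Pi.zero_apply, sub_zero]))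
    funext p
    ext1
    filter_upwards [this, Lp.coeFn_zero ℂ 2 (volume.restrict D)] with z hz hz'
    have := congrFun (congrFun hz p.1) p.2
    rw [Pi.zero_apply, hz', Pi.zero_apply]
    exact this
  obtain ⟨x, hx⟩ := surjective_of_compact hcomp M hinj fun p => T ((hF p.1 p.2).toLp _)
  choose wx wy h1 h2 using hsolve x (fun p => (hF p.1 p.2).toLp _) hx
  refine ⟨mat x, fun z => Matrix.of fun i j => wx (i, j) z,
    fun z => Matrix.of fun i j => wy (i, j) z, fun i j => ⟨h1 (i, j), (h2 (i, j)).congr ?_⟩⟩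
  filter_upwards [(hF i j).coeFn_toLp] with z hz
  rw [hz]

theorem IsCk.memLp_top (hD : IsOpen D) (hb : Bornology.IsBounded D)
    {v : ℂ → Matrix (Fin n) (Fin n) ℂ} {k : ℕ} (hv : IsCk k D v) (i j : Fin n) (p : ℝ≥0∞) :
    MemLp (fun z => v z i j) p (volume.restrict D) := by
  obtain ⟨C, hC⟩ := hb.isCompact_closure.exists_bound_of_continuousOn (hv i j).continuousOn
  exact memLp_of_continuousOn_of_bound hD hb ((hv i j).continuousOn.mono subset_closure)
    (fun z hz => hC z (subset_closure hz)) p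

/-- If `0` is not a Dirichlet eigenvalue of `-Δ + v`, then it is not one of `-Δ + ᵗv`. -/
theorem ZeroNotDirichletEigenvalue.transpose (hD : IsOpen D) (hb : Bornology.IsBounded D)
    {v : ℂ → Matrix (Fin n) (Fin n) ℂ} (hv : ∀ i j, MemLp (fun z => v z i j) ⊤ (volume.restrict D))
    (hdir : ZeroNotDirichletEigenvalue D v) :
    ZeroNotDirichletEigenvalue D (fun z => (v z)ᵀ) := by
  intro ψ ψx ψy h1 h2
  have hvt : ∀ i j, MemLp (fun z => (v z)ᵀ i j) ⊤ (volume.restrict D) := fun i j => hv j i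
  have hψ := fun i j => (h1 i j).isH1.memLp
  have hF : ∀ i j, MemLp (fun z => ((ψ z).map (starRingEnd ℂ)) i j) 2 (volume.restrict D) :=
    fun i j => (hψ i j).star
  -- The dual problem, with right side `conj ψ`.
  obtain ⟨w, wx, wy, hw⟩ := exists_isH10_solution hD hb hv hdir hF
  have hwm := fun i j => (hw i j).1.isH1.memLp
  have mvw := memLp_mul_apply hv hwm
  have mvψ := memLp_mul_apply hvt hψ
  have int : ∀ {f g : ℂ → ℂ}, MemLp f 2 (volume.restrict D) →
      MemLp g 2 (volume.restrict D) → Integrable (fun z => f z * g z) (volume.restrict D) :=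
    fun hf hg => memLp_one_iff_integrable.1 (hg.mul hf)
  -- The equation of `w` is tested with `ψ` and that of `ψ` with `w`; the gradient terms are
  -- symmetric and cancel.
  have key : ∀ i j, ∫ z in D, (ψ z i j * ((v z * w z) i j - (starRingEnd ℂ) (ψ z i j)) -
      w z i j * ((v z)ᵀ * ψ z) i j) = 0 := by
    intro i j
    have a1 := (h1 i j).integral_eq hD hb (hw i j).2 (hw i j).1.isH1.memLp_x
      (hw i j).1.isH1.memLp_y ((mvw i j).sub (hF i j))
    have a2 := (hw i j).1.integral_eq hD hb (h2 i j) (h1 i j).isH1.memLp_x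
      (h1 i j).isH1.memLp_y (mvψ i j)
    have hd : MemLp (fun z => (v z * w z) i j - ((ψ z).map (starRingEnd ℂ)) i j) 2
      (volume.restrict D) := (mvw i j).sub (hF i j)
    have := integral_sub
      (integrable_weak (h1 i j).isH1.memLp_x (h1 i j).isH1.memLp_y (hψ i j)
        (hw i j).1.isH1.memLp_x (hw i j).1.isH1.memLp_y hd)
      (integrable_weak (hw i j).1.isH1.memLp_x (hw i j).1.isH1.memLp_y (hwm i j)
        (h1 i j).isH1.memLp_x (h1 i j).isH1.memLp_y (mvψ i j))
    rw [a1, a2, sub_zero] at this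
    rw [← this]
    congr 1; ext z
    simp only [smul_eq_mul, Matrix.map_apply]
    ring
  have hsum : ∫ z in D, ∑ i, ∑ j, ‖ψ z i j‖ ^ 2 = 0 := by
    have e : ∀ z, (((∑ i, ∑ j, ‖ψ z i j‖ ^ 2 : ℝ)) : ℂ) = -∑ i, ∑ j, (ψ z i j * ((v z * w z) i j -
        (starRingEnd ℂ) (ψ z i j)) - w z i j * ((v z)ᵀ * ψ z) i j) := by
      intro z
      -- Summed over the entries, the potential terms agree as well: under the bilinear pairing of
      -- matrices the adjoint of multiplication by `v` is multiplication by its transpose.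
      have e1 : ∑ i, ∑ j, ψ z i j * (v z * w z) i j = ∑ i, ∑ j, w z i j * ((v z)ᵀ * ψ z) i j := by
        simp only [Matrix.mul_apply, Finset.mul_sum, Matrix.transpose_apply]
        rw [Finset.sum_congr rfl fun i _ => Finset.sum_comm, Finset.sum_comm]
        refine Finset.sum_congr rfl fun k _ => ?_
        rw [Finset.sum_comm]
        refine Finset.sum_congr rfl fun j _ => Finset.sum_congr rfl fun i _ => ?_
        ring
      have e2 : ∀ i j, ψ z i j * (starRingEnd ℂ) (ψ z i j) = ((‖ψ z i j‖ ^ 2 : ℝ) : ℂ) := by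
        intro i j
        rw [mul_comm, ← Complex.normSq_eq_conj_mul_self, Complex.normSq_eq_norm_sq]
      simp only [mul_sub, Finset.sum_sub_distrib, e2, e1]
      push_cast
      ring
    have h3 : ((∫ z in D, ∑ i, ∑ j, ‖ψ z i j‖ ^ 2 : ℝ) : ℂ) = 0 := by
      rw [← integral_complex_ofReal]
      simp_rw [e]
      have hi : ∀ i j, Integrable (fun z => ψ z i j * ((v z * w z) i j -
          (starRingEnd ℂ) (ψ z i j)) - w z i j * ((v z)ᵀ * ψ z) i j) (volume.restrict D) :=
        fun i j => (int (hψ i j) ((mvw i j).sub (hF i j))).sub (int (hwm i j) (mvψ i j))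
      rw [integral_neg, integral_finsetSum _ fun i _ => integrable_finsetSum _ fun j _ => hi i j]
      simp_rw [integral_finsetSum _ fun j _ => hi _ j, key]
      simp
    exact_mod_cast h3
  rw [integral_eq_zero_iff_of_nonneg
    (fun z => Finset.sum_nonneg fun i _ => Finset.sum_nonneg fun j _ => sq_nonneg _)
    (integrable_finsetSum _ fun i _ => integrable_finsetSum _ fun j _ =>
      (hψ i j).norm.integrable_sq)] at hsum
  filter_upwards [hsum] with z hz
  ext i j
  rw [Pi.zero_apply, Finset.sum_eq_zero_iff_of_nonneg
    (fun i _ => Finset.sum_nonneg fun j _ => sq_nonneg _)] at hz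
  have := hz i (Finset.mem_univ i)
  rw [Finset.sum_eq_zero_iff_of_nonneg (fun j _ => sq_nonneg _)] at this
  simpa using this j (Finset.mem_univ j)

end

section

variable {D : Set ℂ}

/-! ### Local graph coordinates -/

/-- The height above the graph of `γ` in the coordinates `c * z`. -/
noncomputable def height (c : ℂ) (γ : ℝ → ℝ) (z : ℂ) : ℝ := (c * z).im - γ (c * z).re

/-- Near `z₀`, the set `D` lies above the graph of `γ` in the coordinates `c * z`. -/
structure IsGraphChart (D : Set ℂ) (z₀ : ℂ) (r : ℝ) (c : ℂ) (γ : ℝ → ℝ) : Prop where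
  pos : 0 < r
  norm_eq : ‖c‖ = 1
  contDiff : ContDiff ℝ 2 γ
  mem_iff : ∀ z ∈ Metric.ball z₀ r, (z ∈ D ↔ 0 < height c γ z)

theorem HasC2Boundary.exists_chart (h : HasC2Boundary D) {z₀ : ℂ} (hz₀ : z₀ ∈ frontier D) :
    ∃ r c γ, IsGraphChart D z₀ r c γ := by
  obtain ⟨r, hr, c, hc, γ, hγ, hD⟩ := h z₀ hz₀
  exact ⟨r, c, γ, hr, hc, hγ, fun z hz => by rw [hD z hz, height, sub_pos]⟩

namespace IsGraphChart

variable {z₀ : ℂ} {r : ℝ} {c : ℂ} {γ : ℝ → ℝ}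

theorem contDiff_height (h : IsGraphChart D z₀ r c γ) : ContDiff ℝ 2 (height c γ) := by
  have h1 : ContDiff ℝ 2 fun z : ℂ => c * z := contDiff_const.mul contDiff_id
  exact (Complex.imCLM.contDiff.comp h1).sub (h.contDiff.comp (Complex.reCLM.contDiff.comp h1))

theorem conj_mul (h : IsGraphChart D z₀ r c γ) : c * (starRingEnd ℂ) c = 1 := by
  rw [Complex.mul_conj, Complex.normSq_eq_norm_sq, h.norm_eq]; simp

theorem height_add (h : IsGraphChart D z₀ r c γ) (z : ℂ) (t : ℝ) :
    height c γ (z + (starRingEnd ℂ) c * (t * Complex.I)) = height c γ z + t := by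
  have e : c * (z + (starRingEnd ℂ) c * (t * Complex.I)) = c * z + t * Complex.I := by
    rw [mul_add, ← mul_assoc, h.conj_mul, one_mul]
  simp only [height, e]
  simp
  ring

/-- A point of negative height has a neighbourhood that misses `D`, and a point of height zero is a
limit of upward translates, which lie in `D`. -/
theorem mem_frontier_iff (h : IsGraphChart D z₀ r c γ) (hD : IsOpen D) {z : ℂ}
    (hz : z ∈ Metric.ball z₀ r) : z ∈ frontier D ↔ height c γ z = 0 := by
  rw [hD.frontier_eq, Set.mem_sdiff, h.mem_iff z hz, not_lt]
  have hcont : Continuous (height c γ) := h.contDiff_height.continuous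
  constructor
  · rintro ⟨h1, h2⟩
    refine le_antisymm h2 (not_lt.1 fun h3 => ?_)
    have hU : Metric.ball z₀ r ∩ height c γ ⁻¹' Iio 0 ∈ 𝓝 z :=
      (Metric.isOpen_ball.inter (isOpen_Iio.preimage hcont)).mem_nhds ⟨hz, h3⟩
    obtain ⟨w, ⟨hw1, hw2⟩, hw3⟩ := mem_closure_iff_nhds.1 h1 _ hU
    have := (h.mem_iff w hw1).1 hw3
    exact absurd hw2 (not_lt.2 this.le)
  · intro h0
    refine ⟨?_, h0.le⟩
    have hlim : Tendsto (fun t : ℝ => z + (starRingEnd ℂ) c * (t * Complex.I)) (𝓝[>] 0) (𝓝 z) := by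
      have : Continuous fun t : ℝ => z + (starRingEnd ℂ) c * (t * Complex.I) := by fun_prop
      have h2 := this.tendsto 0
      simp only [Complex.ofReal_zero, zero_mul, mul_zero, add_zero] at h2
      exact h2.mono_left nhdsWithin_le_nhds
    refine mem_closure_of_tendsto hlim ?_
    filter_upwards [hlim.eventually (Metric.isOpen_ball.mem_nhds hz), self_mem_nhdsWithin]
      with t ht ht0
    rw [h.mem_iff _ ht, h.height_add, h0, zero_add]
    exact ht0

end IsGraphChart

/-! ### The exterior ball condition -/

/-- `γ'` is Lipschitz on the interval, so by the mean value inequality for `t ↦ γ t - γ'(x) t` the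
graph lies above a tangent parabola at each of its points, with one curvature for all of them. -/
theorem exists_taylor_bound {γ : ℝ → ℝ} (hγ : ContDiff ℝ 2 γ) (a b : ℝ) : ∃ M : ℝ, 0 ≤ M ∧
    ∀ x ∈ Icc a b, ∀ y ∈ Icc a b, γ x + deriv γ x * (y - x) - M * (y - x) ^ 2 ≤ γ y := by
  have hd : ContDiff ℝ 1 (deriv γ) := ((contDiff_succ_iff_deriv (n := 1)).1 hγ).2.2
  have hγd : Differentiable ℝ γ := hγ.differentiable two_ne_zero
  obtain ⟨M, hM⟩ := (isCompact_Icc (a := a) (b := b)).exists_bound_of_continuousOn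
    (hd.continuous_deriv le_rfl).continuousOn
  refine ⟨max M 0, le_max_right _ _, fun x hx y hy => ?_⟩
  have hlip : ∀ t ∈ Icc a b, |deriv γ t - deriv γ x| ≤ max M 0 * |t - x| := fun t ht =>
    (convex_Icc a b).norm_image_sub_le_of_norm_deriv_le
      (fun s _ => (hd.differentiable one_ne_zero) s)
      (fun s hs => (hM s hs).trans (le_max_left _ _)) hx ht
  have hsub : uIcc x y ⊆ Icc a b := uIcc_subset_Icc hx hy
  have key := (convex_uIcc x y).norm_image_sub_le_of_norm_deriv_le
    (f := fun t => γ t - deriv γ x * t) (C := max M 0 * |y - x|)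
    (fun s _ => (hγd s).sub (differentiableAt_id.const_mul _)) (fun s hs => by
      have e : deriv (fun t => γ t - deriv γ x * t) s = deriv γ s - deriv γ x := by
        exact ((hγd s).hasDerivAt.sub ((hasDerivAt_id s).const_mul (deriv γ x))).deriv.trans
          (by simp)
      rw [e]
      refine (hlip s (hsub hs)).trans ?_
      exact mul_le_mul_of_nonneg_left (abs_sub_left_of_mem_uIcc hs) (le_max_right _ _)) left_mem_uIcc right_mem_uIcc
  simp only [Real.norm_eq_abs] at key
  have h2 := (abs_le.1 key).1
  rw [mul_assoc, ← sq, sq_abs] at h2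
  nlinarith

/-- A disc of small radius hung below the graph stays below the tangent parabola, whose curvature is
bounded. All radii up to `R₀` are allowed, which lets finitely many charts share one. -/
theorem IsGraphChart.exists_exterior_ball {z₀ : ℂ} {r : ℝ} {c : ℂ} {γ : ℝ → ℝ}
    (h : IsGraphChart D z₀ r c γ) (hD : IsOpen D) : ∃ R₀ > 0, ∀ R, 0 < R → R ≤ R₀ →
    ∀ z₁ ∈ Metric.ball z₀ (r / 2) ∩ frontier D, ∃ y, dist y z₁ = R ∧ ∀ z ∈ D, R ≤ dist z y := by
  obtain ⟨M, hM, hT⟩ := exists_taylor_bound h.contDiff ((c * z₀).re - r) ((c * z₀).re + r)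
  have hr := h.pos
  -- `R ≤ r / 4` settles the points at distance at least `r / 2` from `z₁` by the triangle
  -- inequality; `2 M R ≤ 1` makes the disc narrower than the parabola at the nearby points.
  refine ⟨min (r / 4) (1 / (2 * M + 1)), by positivity, fun R hR hRle z₁ hz₁ => ?_⟩
  have hR1 : R ≤ r / 4 := hRle.trans (min_le_left _ _)
  have hR2 : 2 * M * R ≤ 1 := by
    have := hRle.trans (min_le_right _ _)
    rw [le_div_iff₀ (by positivity)] at this
    nlinarith
  have hcn : ∀ w : ℂ, ‖c * w‖ = ‖w‖ := fun w => by rw [norm_mul, h.norm_eq, one_mul]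
  have hre : ∀ w ∈ Metric.ball z₀ r, (c * w).re ∈ Icc ((c * z₀).re - r) ((c * z₀).re + r) := by
    intro w hw
    have h1 := Complex.abs_re_le_norm (c * (w - z₀))
    rw [hcn, mul_sub, Complex.sub_re] at h1
    have h2 := abs_le.1 (h1.trans (mem_ball_iff_norm.1 hw).le)
    exact ⟨by linarith [h2.1], by linarith [h2.2]⟩
  have hz₁b : z₁ ∈ Metric.ball z₀ r := Metric.ball_subset_ball (by linarith) hz₁.1
  have h0 := (h.mem_frontier_iff hD hz₁b).1 hz₁.2
  set p := deriv γ (c * z₁).re with hp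
  set s := √(1 + p ^ 2) with hs
  have hs2 : s ^ 2 = 1 + p ^ 2 := Real.sq_sqrt (by positivity)
  have hs1 : 1 ≤ s := by rw [hs, Real.one_le_sqrt]; nlinarith [sq_nonneg p]
  -- The upward unit normal of the graph at `z₁`, rotated back to the original coordinates.
  set ν : ℂ := (starRingEnd ℂ) c * ⟨-p / s, 1 / s⟩ with hν
  have hcν : c * ν = ⟨-p / s, 1 / s⟩ := by rw [hν, ← mul_assoc, h.conj_mul, one_mul]
  have hνn : ‖ν‖ = 1 := by
    rw [← hcn, hcν, ← sq_eq_sq₀ (norm_nonneg _) zero_le_one, ← Complex.normSq_eq_norm_sq,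
      Complex.normSq_mk]
    field_simp
    linarith
  refine ⟨z₁ - R * ν, ?_, fun z hz => ?_⟩
  · rw [dist_eq_norm, sub_sub_cancel_left, norm_neg, norm_mul, hνn, Complex.norm_real,
      Real.norm_of_nonneg hR.le, mul_one]
  by_cases hzz : dist z z₁ < r / 2
  · have hzb : z ∈ Metric.ball z₀ r := by
      have := dist_triangle z z₁ z₀
      have h2 := Metric.mem_ball.1 hz₁.1
      exact Metric.mem_ball.2 (by linarith)
    have h3 := (h.mem_iff z hzb).1 hz
    have h4 := hT _ (hre z₁ hz₁b) _ (hre z hzb)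
    rw [← hp] at h4
    rw [height] at h0 h3
    rw [dist_eq_norm]
    refine (sq_le_sq₀ hR.le (norm_nonneg _)).1 ?_
    rw [← hcn, ← Complex.normSq_eq_norm_sq]
    have e : c * (z - (z₁ - R * ν)) = c * z - c * z₁ + R * (c * ν) := by ring
    set a := (c * z).re - (c * z₁).re
    set b := (c * z).im - (c * z₁).im with hb
    have e1 : c * z - c * z₁ + R * (⟨-p / s, 1 / s⟩ : ℂ) =
        ⟨a + R * (-p / s), b + R * (1 / s)⟩ := by
      apply Complex.ext <;> simp [a, b]
    rw [e, hcν, e1, Complex.normSq_mk]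
    have h5 : -M * a ^ 2 ≤ b - p * a := by linarith
    have e2 : (a + R * (-p / s)) * (a + R * (-p / s)) + (b + R * (1 / s)) * (b + R * (1 / s)) =
        a ^ 2 + b ^ 2 + R ^ 2 + 2 * (R / s) * (b - p * a) := by
      field_simp
      linear_combination (-R ^ 2) * hs2
    rw [e2]
    have h6 : R / s ≤ R := div_le_self hR.le hs1
    have h7 : 0 < R / s := by positivity
    have h8 : 2 * (R / s) * (-M * a ^ 2) ≤ 2 * (R / s) * (b - p * a) := by gcongr
    have h9 : (R / s) * (M * a ^ 2) ≤ R * (M * a ^ 2) := by gcongr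
    nlinarith [mul_le_mul_of_nonneg_right hR2 (sq_nonneg a), sq_nonneg b]
  · have h1 : dist z₁ (z₁ - R * ν) = R := by
      rw [dist_eq_norm, sub_sub_cancel, norm_mul, hνn, Complex.norm_real,
        Real.norm_of_nonneg hR.le, mul_one]
    have h2 := dist_triangle z (z₁ - R * ν) z₁
    rw [dist_comm (z₁ - R * ν) z₁, h1] at h2
    linarith [not_lt.1 hzz]

theorem exists_exterior_ball (hD : IsOpen D) (hb : Bornology.IsBounded D) (hC : HasC2Boundary D) :
    ∃ R > 0, ∀ z₁ ∈ frontier D, ∃ y, dist y z₁ = R ∧ ∀ z ∈ D, R ≤ dist z y := by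
  have hK : IsCompact (frontier D) :=
    hb.isCompact_closure.of_isClosed_subset isClosed_frontier frontier_subset_closure
  have key : ∃ R₀ > 0, ∀ R, 0 < R → R ≤ R₀ →
      ∀ z₁ ∈ frontier D ∩ frontier D, ∃ y, dist y z₁ = R ∧ ∀ z ∈ D, R ≤ dist z y := by
    refine hK.induction_on (p := fun s => ∃ R₀ > 0, ∀ R, 0 < R → R ≤ R₀ →
      ∀ z₁ ∈ s ∩ frontier D, ∃ y, dist y z₁ = R ∧ ∀ z ∈ D, R ≤ dist z y)
      ⟨1, one_pos, by simp⟩ ?_ ?_ ?_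
    · rintro s t hst ⟨R₀, hR₀, h⟩
      exact ⟨R₀, hR₀, fun R h1 h2 z hz => h R h1 h2 z ⟨hst hz.1, hz.2⟩⟩
    · rintro s t ⟨R₀, hR₀, h⟩ ⟨R₁, hR₁, h'⟩
      refine ⟨min R₀ R₁, by positivity, ?_⟩
      rintro R h1 h2 z ⟨hz | hz, hzf⟩
      · exact h R h1 (h2.trans (min_le_left _ _)) z ⟨hz, hzf⟩
      · exact h' R h1 (h2.trans (min_le_right _ _)) z ⟨hz, hzf⟩
    · intro z₀ hz₀
      obtain ⟨r, c, γ, hch⟩ := hC.exists_chart hz₀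
      exact ⟨_, mem_nhdsWithin_of_mem_nhds (Metric.ball_mem_nhds z₀ (half_pos hch.pos)),
        hch.exists_exterior_ball hD⟩
  obtain ⟨R, hR, h⟩ := key
  exact ⟨R, hR, fun z hz => h R hR le_rfl z ⟨hz, hz⟩⟩

end

section

variable {D : Set ℂ}

/-! ### The Laplacian of a `C²` function -/

section Laplacian

variable {F : Type*} [NormedAddCommGroup F] [NormedSpace ℝ F]

theorem laplacian_eq_fderiv {u : ℂ → F} {z : ℂ} (hu : ContDiffAt ℝ 2 u z) :
    Laplacian.laplacian u z =
      fderiv ℝ (fun w => fderiv ℝ u w 1) z 1 +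
        fderiv ℝ (fun w => fderiv ℝ u w Complex.I) z Complex.I := by
  have hd : DifferentiableAt ℝ (fderiv ℝ u) z :=
    (hu.fderiv_right (m := 1) (by norm_num)).differentiableAt one_ne_zero
  have e : ∀ v : ℂ, fderiv ℝ (fun w => fderiv ℝ u w v) z v = fderiv ℝ (fderiv ℝ u) z v v := by
    intro v
    rw [fderiv_clm_apply hd (differentiableAt_const v)]
    simp
  rw [InnerProductSpace.laplacian_eq_iteratedFDeriv_complexPlane, e, e]
  simp [iteratedFDeriv_two_apply]

theorem integrableOn_smul_of_hasCompactSupport {φ : ℂ → ℝ} {g : ℂ → F}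
    (hφ : Continuous φ) (hc : HasCompactSupport φ) (hs : tsupport φ ⊆ D)
    (hg : ContinuousOn g D) : IntegrableOn (fun z => φ z • g z) D := by
  have hsupp : Function.support (fun z => φ z • g z) ⊆ tsupport φ := by
    intro z hz
    by_contra h
    exact hz (by simp [image_eq_zero_of_notMem_tsupport h])
  have i : Integrable (fun z => φ z • g z) := by
    rw [← integrableOn_iff_integrable_of_support_subset hsupp]
    exact (hφ.continuousOn.smul (hg.mono hs)).integrableOn_compact hc
  exact i.integrableOn

/-- Green's formula against a compactly supported `C¹` function. -/
theorem integral_fderiv_add_laplacian_eq_zero (hD : IsOpen D) {φ : ℂ → ℝ} {u : ℂ → F}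
    (hφ : ContDiff ℝ 1 φ) (hc : HasCompactSupport φ) (hs : tsupport φ ⊆ D)
    (hu : ContDiffOn ℝ 2 u D) :
    ∫ z in D, (fderiv ℝ φ z 1 • fderiv ℝ u z 1 + fderiv ℝ φ z Complex.I • fderiv ℝ u z Complex.I +
      φ z • Laplacian.laplacian u z) = 0 := by
  have hu' : ContDiffOn ℝ 1 (fderiv ℝ u) D := hu.fderiv_of_isOpen hD (by norm_num)
  have hue : ∀ e : ℂ, ContDiffOn ℝ 1 (fun z => fderiv ℝ u z e) D := fun e =>
    hu'.clm_apply contDiffOn_const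
  have hue' : ∀ e : ℂ, ContinuousOn (fun z => fderiv ℝ (fun w => fderiv ℝ u w e) z e) D :=
    fun e => ((hue e).continuousOn_fderiv_of_isOpen hD le_rfl).clm_apply continuousOn_const
  have i1 : ∀ e : ℂ, IntegrableOn (fun z => fderiv ℝ φ z e • fderiv ℝ u z e) D := fun e =>
    integrableOn_smul_of_hasCompactSupport
      ((hφ.continuous_fderiv one_ne_zero).clm_apply continuous_const)
      (hc.fderiv_apply ℝ e) ((tsupport_fderiv_apply_subset ℝ e).trans hs)
      (hue e).continuousOn
  have i2 : ∀ e : ℂ, IntegrableOn (fun z => φ z • fderiv ℝ (fun w => fderiv ℝ u w e) z e) D :=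
    fun e => integrableOn_smul_of_hasCompactSupport hφ.continuous hc hs (hue' e)
  have key : ∀ e : ℂ, ∫ z in D, (fderiv ℝ φ z e • fderiv ℝ u z e +
      φ z • fderiv ℝ (fun w => fderiv ℝ u w e) z e) = 0 := by
    intro e
    rw [integral_add (i1 e) (i2 e), setIntegral_fderiv_smul_eq_neg hD hφ hc hs (hue e) e,
      neg_add_cancel]
  have h := integral_add ((i1 1).add (i2 1)) ((i1 Complex.I).add (i2 Complex.I))
  simp only [Pi.add_apply] at h
  rw [key, key, add_zero] at h
  rw [← h]
  refine setIntegral_congr_fun hD.measurableSet fun z hz => ?_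
  rw [laplacian_eq_fderiv (hu.contDiffAt (hD.mem_nhds hz)), smul_add]
  abel

end Laplacian

/-! ### Boundary decay -/

/-- A radial barrier outside the ball of radius `R` about `y`. -/
theorem exists_barrier {R L H : ℝ} (hR : 0 < R) (hH : 0 ≤ H) : ∃ C, 0 ≤ C ∧ ∀ y : ℂ,
    ∃ b : ℂ → ℝ, ContDiff ℝ ∞ b ∧ ∀ z, R ≤ dist z y → dist z y ≤ L →
      0 ≤ b z ∧ b z ≤ C * (dist z y - R) ∧ Laplacian.laplacian b z ≤ -H := by
  -- If `L < R`, there is no point to control.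
  by_cases hL : R ≤ L
  swap
  · exact ⟨0, le_rfl, fun y => ⟨0, contDiff_const, fun z h1 h2 => absurd (h1.trans h2) hL⟩⟩
  -- The barrier is `A (1 - exp (-β (|z - y|² - R²)))`, with Laplacian `A β E (4 - 4 β |z - y|²)`,
  -- where `E` is the exponential. This `β` makes the bracket at most `-4` outside the disc, and `A`
  -- below is large enough for the resulting bound to be `-H` up to radius `L`.
  set β := 2 / R ^ 2 with hβ
  have hβ0 : 0 < β := by positivity
  have hβR : β * R ^ 2 = 2 := by rw [hβ]; field_simp
  set A := H * Real.exp (β * L ^ 2) / (4 * β) with hA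
  have hA0 : 0 ≤ A := by positivity
  have hA4 : 4 * (A * β) = H * Real.exp (β * L ^ 2) := by rw [hA]; field_simp
  refine ⟨A * β * (2 * L), mul_nonneg (by positivity) (by linarith), fun y => ?_⟩
  set q : ℂ → ℝ := fun z => (z.re - y.re) ^ 2 + (z.im - y.im) ^ 2 with hq
  set E : ℂ → ℝ := fun z => Real.exp (-β * (q z - R ^ 2)) with hE
  have hqd : ∀ z, q z = dist z y ^ 2 := by
    intro z
    rw [dist_eq_norm, ← Complex.normSq_eq_norm_sq, Complex.normSq_apply]
    simp only [hq, Complex.sub_re, Complex.sub_im]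
    ring
  have hre : ∀ z, HasFDerivAt (fun z : ℂ => z.re - y.re) Complex.reCLM z := fun z =>
    (Complex.reCLM.hasFDerivAt).sub_const _
  have him : ∀ z, HasFDerivAt (fun z : ℂ => z.im - y.im) Complex.imCLM z := fun z =>
    (Complex.imCLM.hasFDerivAt).sub_const _
  have hEd : ∀ z, HasFDerivAt E ((E z * -β) • ((2 * (z.re - y.re)) • Complex.reCLM +
      (2 * (z.im - y.im)) • Complex.imCLM)) z := by
    intro z
    have h := (((((hre z).pow 2).add ((him z).pow 2)).sub_const (R ^ 2)).const_mul (-β)).exp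
    refine HasFDerivAt.congr_fderiv (f := E) h ?_
    ext v
    simp [E, q]
    ring
  set b : ℂ → ℝ := fun z => A * (1 - E z) with hb
  have hbd : ∀ z, HasFDerivAt b ((A * β * E z) • ((2 * (z.re - y.re)) • Complex.reCLM +
      (2 * (z.im - y.im)) • Complex.imCLM)) z := by
    intro z
    have h := ((hEd z).const_sub 1).const_mul A
    refine HasFDerivAt.congr_fderiv (f := b) h ?_
    ext v
    simp
    ring
  have hbs : ContDiff ℝ ∞ b := by
    have h1 : ContDiff ℝ ∞ fun z : ℂ => z.re := Complex.reCLM.contDiff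
    have h2 : ContDiff ℝ ∞ fun z : ℂ => z.im := Complex.imCLM.contDiff
    exact contDiff_const.mul (contDiff_const.sub (Real.contDiff_exp.comp (contDiff_const.mul
      ((((h1.sub contDiff_const).pow 2).add ((h2.sub contDiff_const).pow 2)).sub
        contDiff_const))))
  have e1 : (fun w => fderiv ℝ b w 1) = fun w => (A * β) * (E w * (2 * (w.re - y.re))) := by
    funext w
    rw [(hbd w).fderiv]
    simp
    ring
  have eI : (fun w => fderiv ℝ b w Complex.I) =
      fun w => (A * β) * (E w * (2 * (w.im - y.im))) := by
    funext w
    rw [(hbd w).fderiv]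
    simp
    ring
  have hlap : ∀ z, Laplacian.laplacian b z = A * β * E z * (4 - 4 * β * q z) := by
    intro z
    rw [laplacian_eq_fderiv (hbs.contDiffAt.of_le (WithTop.coe_le_coe.2 le_top)), e1, eI,
      HasFDerivAt.fderiv (f := fun w => A * β * (E w * (2 * (w.re - y.re))))
        (((hEd z).mul ((hre z).const_mul 2)).const_mul (A * β)),
      HasFDerivAt.fderiv (f := fun w => A * β * (E w * (2 * (w.im - y.im))))
        (((hEd z).mul ((him z).const_mul 2)).const_mul (A * β))]
    simp [q]
    ring
  refine ⟨b, hbs, fun z h1 h2 => ?_⟩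
  have hE0 : 0 < E z := Real.exp_pos _
  have hq1 : R ^ 2 ≤ q z := by rw [hqd]; gcongr
  have hq2 : q z ≤ L ^ 2 := by rw [hqd]; gcongr
  have hE1 : E z ≤ 1 := by
    rw [hE]
    simp only [Real.exp_le_one_iff]
    nlinarith
  have hE2 : 1 - E z ≤ β * (q z - R ^ 2) := by
    have := Real.add_one_le_exp (-β * (q z - R ^ 2))
    simp only [hE]
    linarith
  refine ⟨mul_nonneg hA0 (by linarith), ?_, ?_⟩
  · calc b z ≤ A * (β * (q z - R ^ 2)) := by simp only [hb]; gcongr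
      _ = A * β * ((dist z y + R) * (dist z y - R)) := by rw [hqd]; ring
      _ ≤ A * β * (2 * L * (dist z y - R)) := by
          have : 0 ≤ dist z y - R := by linarith
          gcongr
          linarith
      _ = _ := by ring
  · rw [hlap]
    have h3 : 4 - 4 * β * q z ≤ -4 := by nlinarith
    have h4 : 1 ≤ Real.exp (β * L ^ 2) * E z := by
      simp only [hE]
      rw [← Real.exp_add]
      refine Real.one_le_exp ?_
      nlinarith
    calc A * β * E z * (4 - 4 * β * q z) ≤ A * β * E z * (-4) := by gcongr
      _ = -(H * (Real.exp (β * L ^ 2) * E z)) := by linear_combination (-E z) * hA4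
      _ ≤ -H := by nlinarith

/-- An `H₀¹` function with bounded Laplacian vanishes to first order on the boundary. -/
theorem IsH10.exists_le_infDist (hD : IsOpen D) (hb : Bornology.IsBounded D)
    (hC : HasC2Boundary D) (hf : (frontier D).Nonempty) {w wx wy h : ℂ → ℂ}
    (hw : IsH10 D w wx wy) (hh : MemLp h 2 (volume.restrict D)) (hl : IsWeakLaplacian D wx wy h)
    {H : ℝ} (hH : ∀ᵐ z ∂(volume.restrict D), ‖h z‖ ≤ H) :
    ∃ C, 0 ≤ C ∧ ∀ᵐ z ∂(volume.restrict D), ‖w z‖ ≤ C * Metric.infDist z (frontier D) := by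
  obtain ⟨R, hR, hext⟩ := exists_exterior_ball hD hb hC
  have hcb : Bornology.IsBounded (closure D) := hb.closure
  obtain ⟨C, hC0, hbar⟩ := exists_barrier (L := Metric.diam (closure D) + R) hR
    (le_max_right H 0)
  have : IsFiniteMeasure (volume.restrict D) := isFiniteMeasure_restrict hb
  -- Around a boundary point `z₁`, the barrier of the exterior disc touching there dominates each
  -- real part of `w`, and it is at most `C (|z - y| - R) ≤ C |z - z₁|`.
  have key : ∀ k : ℂ, ‖k‖ = 1 → ∀ z₁ ∈ frontier D,
      ∀ᵐ z ∂(volume.restrict D), (k * w z).re ≤ C * dist z z₁ := by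
    intro k hk z₁ hz₁
    obtain ⟨y, hy1, hy2⟩ := hext z₁ hz₁
    obtain ⟨b, hbs, hbp⟩ := hbar y
    have hL : ∀ z ∈ D, dist z y ≤ Metric.diam (closure D) + R := fun z hz => by
      have h1 := dist_triangle z z₁ y
      have h2 := Metric.dist_le_diam_of_mem hcb (subset_closure hz) (frontier_subset_closure hz₁)
      rw [dist_comm z₁ y, hy1] at h1
      linarith
    have hb2 : ContDiff ℝ 2 b := hbs.of_le (WithTop.coe_le_coe.2 le_top)
    have hlapc : Continuous (Laplacian.laplacian b) := by
      have e : Laplacian.laplacian b = fun z => fderiv ℝ (fun w => fderiv ℝ b w 1) z 1 +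
          fderiv ℝ (fun w => fderiv ℝ b w Complex.I) z Complex.I :=
        funext fun z => laplacian_eq_fderiv hb2.contDiffAt
      have h1 : ∀ e : ℂ, ContDiff ℝ 1 fun z => fderiv ℝ b z e := fun e =>
        (hb2.fderiv_right (m := 1) (by norm_num)).clm_apply contDiff_const
      rw [e]
      exact (((h1 1).continuous_fderiv one_ne_zero).clm_apply continuous_const).add
        (((h1 _).continuous_fderiv one_ne_zero).clm_apply continuous_const)
    have hle := (hw.re_mul k).le_of_laplacian_le hD hb
      (hh.const_mul k).re (hl.re_mul hD hb hw.isH1.memLp_x hw.isH1.memLp_y hh k) hbs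
      (fun z hz => (hbp z (hy2 z hz) (hL z hz)).1)
      (hlapc.memLp_restrict hD hb 2)
      (fun φ hφ => integral_fderiv_add_laplacian_eq_zero hD hφ.contDiff_one hφ.compact
        hφ.support hb2.contDiffOn) (by
        filter_upwards [hH, ae_restrict_mem hD.measurableSet] with z hz hzD
        have h1 := (hbp z (hy2 z hzD) (hL z hzD)).2.2
        have h2 := (Complex.abs_re_le_norm (k * h z))
        rw [norm_mul, hk, one_mul] at h2
        have h3 := (abs_le.1 h2).1
        have h4 := le_max_left H 0
        change _ ≤ (k * h z).re
        linarith)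
    filter_upwards [hle, ae_restrict_mem hD.measurableSet] with z hz hzD
    refine hz.trans ((hbp z (hy2 z hzD) (hL z hzD)).2.1.trans ?_)
    gcongr
    have h1 := dist_triangle z z₁ y
    rw [dist_comm z₁ y, hy1] at h1
    linarith
  have hK : IsCompact (frontier D) :=
    hb.isCompact_closure.of_isClosed_subset isClosed_frontier frontier_subset_closure
  -- The null set depends on `z₁`. Countably many boundary points suffice, as the bound is closed in
  -- `z₁`; it is then used at the boundary point nearest to `z`.
  obtain ⟨S, hSf, hSc, hSd⟩ := hK.isSeparable.exists_countable_dense_subset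
  refine ⟨2 * C, by positivity, ?_⟩
  have hall : ∀ᵐ z ∂(volume.restrict D), ∀ z₁ ∈ S, ‖w z‖ ≤ 2 * C * dist z z₁ := by
    refine (ae_ball_iff hSc).2 fun z₁ hz₁ => ?_
    filter_upwards [key 1 (by simp) z₁ (hSf hz₁), key (-1) (by simp) z₁ (hSf hz₁),
      key Complex.I (by simp) z₁ (hSf hz₁), key (-Complex.I) (by simp) z₁ (hSf hz₁)]
      with z h1 h2 h3 h4
    simp at h1 h2 h3 h4
    refine (Complex.norm_le_abs_re_add_abs_im _).trans ?_
    have a1 := abs_le.2 ⟨by linarith, h1⟩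
    have a2 := abs_le.2 ⟨by linarith, h4⟩
    linarith
  filter_upwards [hall] with z hz
  obtain ⟨z₁, hz₁, he⟩ := hK.exists_infDist_eq_dist hf z
  rw [he]
  have hcl : IsClosed {x : ℂ | ‖w z‖ ≤ 2 * C * dist z x} :=
    isClosed_le continuous_const (continuous_const.mul (continuous_const.dist continuous_id))
  exact closure_minimal hz hcl (hSd hz₁)

end

section

variable {D : Set ℂ} {z₀ : ℂ} {r : ℝ} {c : ℂ} {γ : ℝ → ℝ}

/-! ### Arc length of a graph and area of a thin strip above it -/

/-- The parametrization of the graph of `γ` in the coordinates `c * z`. -/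
noncomputable def graphMap (c : ℂ) (γ : ℝ → ℝ) (x : ℝ) : ℂ := (starRingEnd ℂ) c * ⟨x, γ x⟩

namespace IsGraphChart

theorem mul_graphMap (h : IsGraphChart D z₀ r c γ) (x : ℝ) : c * graphMap c γ x = ⟨x, γ x⟩ := by
  rw [graphMap, ← mul_assoc, h.conj_mul, one_mul]

theorem height_graphMap (h : IsGraphChart D z₀ r c γ) (x : ℝ) :
    height c γ (graphMap c γ x) = 0 := by
  rw [height, h.mul_graphMap, sub_self]

theorem dist_graphMap (h : IsGraphChart D z₀ r c γ) (z : ℂ) :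
    dist z (graphMap c γ (c * z).re) = |height c γ z| := by
  have e : c * (z - graphMap c γ (c * z).re) = (height c γ z : ℝ) * Complex.I := by
    rw [mul_sub, h.mul_graphMap]
    apply Complex.ext <;> simp [height]
  have e2 := congrArg norm e
  rw [norm_mul, h.norm_eq, one_mul] at e2
  rw [dist_eq_norm, e2]
  simp

theorem graphMap_eq (h : IsGraphChart D z₀ r c γ) {z : ℂ} (hz : height c γ z = 0) :
    graphMap c γ (c * z).re = z := by
  rw [eq_comm, ← dist_eq_zero, h.dist_graphMap, hz, abs_zero]

theorem contDiff_graphMap (h : IsGraphChart D z₀ r c γ) : ContDiff ℝ 2 (graphMap c γ) := by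
  have e : graphMap c γ = fun x : ℝ => (starRingEnd ℂ) c * ((x : ℂ) + (γ x : ℂ) * Complex.I) := by
    funext x
    rw [graphMap, ← Complex.mk_eq_add_mul_I]
  rw [e]
  exact contDiff_const.mul (Complex.ofRealCLM.contDiff.add
    ((Complex.ofRealCLM.contDiff.comp h.contDiff).mul contDiff_const))

/-- The abscissa is a `1`-Lipschitz function, so it does not increase length: `dx ≤ ds` along the
graph. The opposite comparison is never needed. -/
theorem map_graphMap_le (h : IsGraphChart D z₀ r c γ) :
    (volume : Measure ℝ).map (graphMap c γ) ≤ Measure.hausdorffMeasure 1 := by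
  refine Measure.le_iff.2 fun A hA => ?_
  rw [Measure.map_apply h.contDiff_graphMap.continuous.measurable hA, ← hausdorffMeasure_real]
  have hL : LipschitzWith 1 fun z : ℂ => (c * z).re := LipschitzWith.of_dist_le_mul fun z w => by
    rw [NNReal.coe_one, one_mul, dist_eq_norm, dist_eq_norm, ← Complex.sub_re, ← mul_sub]
    refine (Complex.abs_re_le_norm _).trans ?_
    rw [norm_mul, h.norm_eq, one_mul]
  have h1 := hL.hausdorffMeasure_image_le zero_le_one A
  simp only [ENNReal.coe_one, ENNReal.one_rpow, one_mul] at h1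
  have hsub : graphMap c γ ⁻¹' A ⊆ (fun z : ℂ => (c * z).re) '' A := fun x hx =>
    ⟨graphMap c γ x, hx, by beta_reduce; rw [h.mul_graphMap]⟩
  exact (measure_mono hsub).trans h1

/-- A rotation followed by a vertical shear. -/
theorem measurePreserving (h : IsGraphChart D z₀ r c γ) :
    MeasurePreserving (fun z : ℂ => ((c * z).re, height c γ z)) := by
  have h1 : MeasurePreserving (fun z : ℂ => c * z) := by
    have hc : c ∈ Submonoid.unitSphere ℂ := by
      simp [Submonoid.unitSphere, h.norm_eq]
    exact (rotation (⟨c, hc⟩ : Circle)).measurePreserving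
  have h2 := Complex.volume_preserving_equiv_real_prod
  have h3 : MeasurePreserving (fun p : ℝ × ℝ => (p.1, p.2 - γ p.1)) :=
    MeasurePreserving.skew_product (g := fun x y => y - γ x) (MeasurePreserving.id _)
      (by
        have := h.contDiff.continuous
        fun_prop) (Eventually.of_forall fun x => (measurePreserving_sub_right volume (γ x)).map_eq)
  exact (h3.comp (h2.comp h1))

/-- In the coordinates (abscissa, height) the integrand depends on the abscissa only, so Fubini
gives `τ` times an integral in `dx`, which is at most the one in arc length. -/
theorem lintegral_strip_le (h : IsGraphChart D z₀ r c γ) {g : ℂ → ℝ≥0∞} (hg : Measurable g)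
    (τ : ℝ) :
    ∫⁻ z in {z | 0 < height c γ z ∧ height c γ z < τ}, g (graphMap c γ (c * z).re) ≤
      ENNReal.ofReal τ * ∫⁻ z, g z ∂(Measure.hausdorffMeasure 1 : Measure ℂ) := by
  have hG := h.contDiff_graphMap.continuous.measurable
  have e : {z | 0 < height c γ z ∧ height c γ z < τ} =
      (fun z : ℂ => ((c * z).re, height c γ z)) ⁻¹' (univ ×ˢ Ioo 0 τ) := by
    ext z; simp
  have hS : MeasurableSet ((univ : Set ℝ) ×ˢ Ioo 0 τ) := MeasurableSet.univ.prod measurableSet_Ioo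
  have h1 := (h.measurePreserving.restrict_preimage hS).lintegral_comp
    (f := fun p : ℝ × ℝ => g (graphMap c γ p.1)) (hg.comp (hG.comp measurable_fst))
  rw [e]
  refine h1.le.trans ?_
  rw [Measure.volume_eq_prod, ← Measure.prod_restrict, Measure.restrict_univ,
    lintegral_prod (fun p : ℝ × ℝ => g (graphMap c γ p.1))
      (hg.comp (hG.comp measurable_fst)).aemeasurable]
  simp only [lintegral_const, Measure.restrict_apply MeasurableSet.univ, univ_inter,
    Real.volume_Ioo, sub_zero]
  rw [lintegral_mul_const (f := fun x => g (graphMap c γ x)) _ (hg.comp hG), mul_comm, ← lintegral_map hg hG]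
  gcongr
  exact h.map_graphMap_le

end IsGraphChart

/-- Locally the boundary lies in the Lipschitz image of a bounded interval; compactness does the
rest. -/
theorem hausdorffMeasure_frontier_lt_top (hD : IsOpen D) (hb : Bornology.IsBounded D)
    (hC : HasC2Boundary D) : (Measure.hausdorffMeasure 1 : Measure ℂ) (frontier D) < ⊤ := by
  have hK : IsCompact (frontier D) :=
    hb.isCompact_closure.of_isClosed_subset isClosed_frontier frontier_subset_closure
  refine hK.measure_lt_top_of_nhdsWithin fun z₀ hz₀ => ?_
  obtain ⟨r, c, γ, h⟩ := hC.exists_chart hz₀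
  refine ⟨frontier D ∩ Metric.ball z₀ r, inter_mem_nhdsWithin _ (Metric.ball_mem_nhds _ h.pos), ?_⟩
  set a := (c * z₀).re - r
  set b := (c * z₀).re + r
  have hsub : frontier D ∩ Metric.ball z₀ r ⊆ graphMap c γ '' Icc a b := by
    rintro z ⟨h1, h2⟩
    refine ⟨(c * z).re, ?_, h.graphMap_eq ((h.mem_frontier_iff hD h2).1 h1)⟩
    have h3 := Complex.abs_re_le_norm (c * (z - z₀))
    rw [norm_mul, h.norm_eq, one_mul, mul_sub, Complex.sub_re] at h3
    have h4 := abs_le.1 (h3.trans (mem_ball_iff_norm.1 h2).le)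
    exact ⟨by simp only [a]; linarith [h4.1], by simp only [b]; linarith [h4.2]⟩
  have hGd : ContDiff ℝ 1 (graphMap c γ) := h.contDiff_graphMap.of_le one_le_two
  obtain ⟨M, hM⟩ := (isCompact_Icc (a := a) (b := b)).exists_bound_of_continuousOn
    (hGd.continuous_deriv le_rfl).continuousOn
  have hL : LipschitzOnWith M.toNNReal (graphMap c γ) (Icc a b) :=
    (convex_Icc a b).lipschitzOnWith_of_nnnorm_deriv_le
      (fun x _ => hGd.differentiable one_ne_zero x) fun x hx => by
        rw [← NNReal.coe_le_coe, coe_nnnorm]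
        exact (hM x hx).trans (Real.le_coe_toNNReal M)
  refine (measure_mono hsub).trans_lt ((hL.hausdorffMeasure_image_le zero_le_one).trans_lt ?_)
  rw [hausdorffMeasure_real, Real.volume_Icc]
  exact ENNReal.mul_lt_top (by simp) ENNReal.ofReal_lt_top

theorem isFiniteMeasure_arcLength (hD : IsOpen D) (hb : Bornology.IsBounded D)
    (hC : HasC2Boundary D) : IsFiniteMeasure (arcLength D) :=
  ⟨by rw [arcLength, Measure.restrict_apply_univ]; exact hausdorffMeasure_frontier_lt_top hD hb hC⟩

/-- Vertical projection to the graph moves a point by its height, so a point of `K` of small height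
is projected within the ball of the chart, where the graph is the boundary. -/
theorem IsGraphChart.exists_graphMap_mem_frontier (h : IsGraphChart D z₀ r c γ) (hD : IsOpen D)
    {K : Set ℂ} (hK : IsCompact K) (hKr : K ⊆ Metric.ball z₀ r) : ∃ ε₀ > 0, ∀ z ∈ K,
    |height c γ z| < ε₀ → graphMap c γ (c * z).re ∈ frontier D := by
  obtain ⟨δ₀, hδ₀, hδ₀'⟩ := hK.exists_cthickening_subset_open Metric.isOpen_ball hKr
  refine ⟨δ₀, hδ₀, fun z hz hlt => (h.mem_frontier_iff hD (hδ₀' ?_)).2 (h.height_graphMap _)⟩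
  exact Metric.mem_cthickening_of_dist_le _ z _ _ hz (by rw [dist_comm, h.dist_graphMap]; exact hlt.le)

/-- By uniform continuity `f` is within `δ` of its value at the vertical projection, so its integral
over the strip is the width times its boundary integral, up to `δ`. -/
theorem IsGraphChart.exists_strip_le (h : IsGraphChart D z₀ r c γ) (hD : IsOpen D)
    (hb : Bornology.IsBounded D) {K : Set ℂ} (hK : IsCompact K) (hKr : K ⊆ Metric.ball z₀ r)
    {f : ℂ → ℝ} (hf : ContinuousOn f (closure D)) {δ : ℝ} (hδ : 0 < δ) :
    ∃ ε₀ > 0, ∀ ε, 0 < ε → ε < ε₀ →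
      ∫⁻ z in {z | z ∈ D ∧ z ∈ K ∧ height c γ z < 2 * ε}, ‖f z‖ₑ ≤
        ENNReal.ofReal (2 * ε) * ∫⁻ z, (‖f z‖ₑ + ENNReal.ofReal δ) ∂(arcLength D) := by
  obtain ⟨δ₀, hδ₀, hfr⟩ := h.exists_graphMap_mem_frontier hD hK hKr
  have hcl : IsCompact (closure D) := hb.isCompact_closure
  obtain ⟨δ₁, hδ₁, hu⟩ := Metric.uniformContinuousOn_iff.1
    (hcl.uniformContinuousOn_of_continuous hf) δ hδ
  refine ⟨min δ₀ δ₁ / 2, by positivity, fun ε hε hεlt => ?_⟩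
  have hε1 : 2 * ε < δ₀ := by linarith [min_le_left δ₀ δ₁]
  have hε2 : 2 * ε < δ₁ := by linarith [min_le_right δ₀ δ₁]
  have hfm : MeasurableSet (frontier D) := isClosed_frontier.measurableSet
  classical
  -- `f` is only controlled on `D̄`; the indicator makes the integrand measurable on the whole
  -- plane.
  set g : ℂ → ℝ≥0∞ := (frontier D).indicator fun z => ‖f z‖ₑ + ENNReal.ofReal δ with hg
  have hgm : Measurable g := by
    have h1 : ContinuousOn (fun z => ‖f z‖ₑ + ENNReal.ofReal δ) (frontier D) :=
      (continuous_enorm.comp_continuousOn (hf.mono frontier_subset_closure)).add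
        continuousOn_const
    rw [hg, ← piecewise_eq_indicator]
    exact h1.measurable_piecewise continuousOn_const hfm
  have hsub : {z | z ∈ D ∧ z ∈ K ∧ height c γ z < 2 * ε} ⊆
      {z | 0 < height c γ z ∧ height c γ z < 2 * ε} := fun z ⟨h1, h2, h3⟩ =>
    ⟨(h.mem_iff z (hKr h2)).1 h1, h3⟩
  have hms : MeasurableSet {z | z ∈ D ∧ z ∈ K ∧ height c γ z < 2 * ε} :=
    hD.measurableSet.inter (hK.measurableSet.inter
      (measurableSet_lt h.contDiff_height.continuous.measurable measurable_const))
  calc ∫⁻ z in {z | z ∈ D ∧ z ∈ K ∧ height c γ z < 2 * ε}, ‖f z‖ₑ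
      ≤ ∫⁻ z in {z | z ∈ D ∧ z ∈ K ∧ height c γ z < 2 * ε}, g (graphMap c γ (c * z).re) := by
        refine setLIntegral_mono' hms fun z hz => ?_
        obtain ⟨h1, h2, h3⟩ := hz
        have h0 := (h.mem_iff z (hKr h2)).1 h1
        have hd := h.dist_graphMap z
        rw [abs_of_pos h0] at hd
        set y := graphMap c γ (c * z).re with hy
        have hyf : y ∈ frontier D := hfr z h2 (by rw [abs_of_pos h0]; linarith)
        rw [hg, indicator_of_mem hyf]
        have h4 := hu z (subset_closure h1) y (frontier_subset_closure hyf)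
          (by rw [hd]; linarith)
        rw [dist_eq_norm] at h4
        calc ‖f z‖ₑ = ‖f y + (f z - f y)‖ₑ := by rw [add_sub_cancel]
          _ ≤ ‖f y‖ₑ + ‖f z - f y‖ₑ := enorm_add_le _ _
          _ ≤ _ := by
            gcongr
            rw [← ofReal_norm]
            exact ENNReal.ofReal_le_ofReal h4.le
    _ ≤ ∫⁻ z in {z | 0 < height c γ z ∧ height c γ z < 2 * ε}, g (graphMap c γ (c * z).re) :=
        lintegral_mono_set hsub
    _ ≤ _ := h.lintegral_strip_le hgm _
    _ = _ := by rw [hg, lintegral_indicator hfm, arcLength]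

theorem IsGraphChart.exists_strip_integral_le (h : IsGraphChart D z₀ r c γ) (hD : IsOpen D)
    (hb : Bornology.IsBounded D) (hC : HasC2Boundary D) {K : Set ℂ} (hK : IsCompact K)
    (hKr : K ⊆ Metric.ball z₀ r) {f : ℂ → ℝ} (hf : ContinuousOn f (closure D)) {δ : ℝ}
    (hδ : 0 < δ) : ∃ ε₀ > 0, ∀ ε, 0 < ε → ε < ε₀ →
      ∫ z in D ∩ {z | z ∈ K ∧ height c γ z < 2 * ε}, ‖f z‖ ≤
        2 * ε * (∫ z, ‖f z‖ ∂(arcLength D) + δ * (arcLength D).real univ) := by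
  have := isFiniteMeasure_arcLength hD hb hC
  obtain ⟨ε₀, hε₀, hs⟩ := h.exists_strip_le hD hb hK hKr hf hδ
  have hms : ∀ ε, MeasurableSet (D ∩ {z | z ∈ K ∧ height c γ z < 2 * ε}) := fun ε =>
    hD.measurableSet.inter (hK.measurableSet.inter
      (measurableSet_lt h.contDiff_height.continuous.measurable measurable_const))
  have hcl : IsCompact (closure D) := hb.isCompact_closure
  have hi : Integrable f (arcLength D) := by
    obtain ⟨M, hM⟩ := hcl.exists_bound_of_continuousOn hf
    have hfm : MeasurableSet (frontier D) := isClosed_frontier.measurableSet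
    refine Integrable.of_bound ((hf.mono frontier_subset_closure).aestronglyMeasurable hfm) M ?_
    filter_upwards [ae_restrict_mem hfm] with z hz using hM z (frontier_subset_closure hz)
  refine ⟨ε₀, hε₀, fun ε h1 h2 => ?_⟩
  rw [integral_norm_eq_lintegral_enorm ((hf.mono (inter_subset_left.trans
    subset_closure)).aestronglyMeasurable (hms ε)),
    integral_norm_eq_lintegral_enorm hi.aestronglyMeasurable]
  have h3 := ENNReal.toReal_mono ?_ (hs ε h1 h2)
  · refine h3.trans (le_of_eq ?_)
    rw [lintegral_add_right _ measurable_const, lintegral_const, ENNReal.toReal_mul,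
      ENNReal.toReal_ofReal (by positivity), ENNReal.toReal_add hi.hasFiniteIntegral.ne
      (ENNReal.mul_ne_top ENNReal.ofReal_ne_top (measure_ne_top _ _)), ENNReal.toReal_mul,
      ENNReal.toReal_ofReal hδ.le, Measure.real]
  · refine ENNReal.mul_ne_top ENNReal.ofReal_ne_top ?_
    rw [lintegral_add_right _ measurable_const, lintegral_const]
    exact ENNReal.add_ne_top.2 ⟨hi.hasFiniteIntegral.ne,
      ENNReal.mul_ne_top ENNReal.ofReal_ne_top (measure_ne_top _ _)⟩

end

section

variable {D : Set ℂ} {z₀ : ℂ} {r : ℝ} {c : ℂ} {γ : ℝ → ℝ}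

/-! ### Weak equations tested with compactly supported `C¹` functions -/

/-- Extension by zero across `∂D` is `C¹`, since its support is a compact subset of `D`. The values
of `φ` outside `D` are thereby discarded. -/
theorem exists_contDiff_eqOn {F : Type*} [NormedAddCommGroup F] [NormedSpace ℝ F]
    (hD : IsOpen D) {φ : ℂ → F} (hφ : ContDiffOn ℝ 1 φ D) {K : Set ℂ}
    (hK : IsCompact K) (hKD : K ⊆ D) (h0 : ∀ z ∈ D, z ∉ K → φ z = 0) :
    ∃ φ' : ℂ → F, ContDiff ℝ 1 φ' ∧ HasCompactSupport φ' ∧ tsupport φ' ⊆ D ∧ EqOn φ' φ D := by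
  have hs : Function.support (D.indicator φ) ⊆ K := by
    intro z hz
    by_contra hzK
    by_cases hzD : z ∈ D
    · exact hz (by rw [indicator_of_mem hzD, h0 z hzD hzK])
    · exact hz (indicator_of_notMem hzD _)
  have ht : tsupport (D.indicator φ) ⊆ K := closure_minimal hs hK.isClosed
  refine ⟨D.indicator φ, contDiff_iff_contDiffAt.2 fun z => ?_,
    HasCompactSupport.of_support_subset_isCompact hK hs, ht.trans hKD,
    fun z hz => indicator_of_mem hz _⟩
  by_cases hz : z ∈ tsupport (D.indicator φ)
  swap
  · exact contDiffAt_const.congr_of_eventuallyEq (notMem_tsupport_iff_eventuallyEq.1 hz)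
  have hz' : D ∈ 𝓝 z := hD.mem_nhds (hKD (ht hz))
  exact (hφ.contDiffAt hz').congr_of_eventuallyEq
    (eventuallyEq_of_mem hz' fun w hw => indicator_of_mem hw _)

/-- Uniform `C¹` approximation by test functions needs the coefficients only in `L¹`. The cutoffs at
the boundary are merely `C²` and their products with `C¹` functions merely `C¹`, hence this
extension. -/
theorem IsWeakLaplacian.integral_eq_zero (hD : IsOpen D) {a b d : ℂ → ℂ}
    (h : IsWeakLaplacian D a b d) (ha : IntegrableOn a D) (hb : IntegrableOn b D)
    (hd : IntegrableOn d D) {φ : ℂ → ℝ} (hφ : ContDiffOn ℝ 1 φ D) {K : Set ℂ}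
    (hK : IsCompact K) (hKD : K ⊆ D) (h0 : ∀ z ∈ D, z ∉ K → φ z = 0) :
    ∫ z in D, (fderiv ℝ φ z 1 • a z + fderiv ℝ φ z Complex.I • b z + φ z • d z) = 0 := by
  obtain ⟨φ', h1, h2, h3, h4⟩ := exists_contDiff_eqOn hD hφ hK hKD h0
  have hfd : ∀ z ∈ D, fderiv ℝ φ' z = fderiv ℝ φ z := fun z hz =>
    (h4.eventuallyEq_of_mem (hD.mem_nhds hz)).fderiv_eq
  have e : ∫ z in D, (fderiv ℝ φ z 1 • a z + fderiv ℝ φ z Complex.I • b z + φ z • d z) =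
      ∫ z in D, (fderiv ℝ φ' z 1 • a z + fderiv ℝ φ' z Complex.I • b z + φ' z • d z) :=
    setIntegral_congr_fun hD.measurableSet fun z hz => by
      rw [hfd z hz, h4 hz]
  rw [e]
  have hint : ∀ {f : ℂ → ℝ} {g : ℂ → ℂ}, Continuous f → HasCompactSupport f → IntegrableOn g D →
      IntegrableOn (fun z => f z • g z) D := by
    intro f g hf hfc hg
    obtain ⟨M, hM⟩ := hfc.exists_bound_of_continuous hf
    exact Integrable.bdd_smul hg M hf.aestronglyMeasurable (Eventually.of_forall hM)
  have hint3 : ∀ {f : ℂ → ℝ}, ContDiff ℝ 1 f → HasCompactSupport f → IntegrableOn (fun z =>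
      fderiv ℝ f z 1 • a z + fderiv ℝ f z Complex.I • b z + f z • d z) D := by
    intro f hf hfc
    have hf' : ∀ e : ℂ, Continuous fun z => fderiv ℝ f z e := fun e =>
      (hf.continuous_fderiv one_ne_zero).clm_apply continuous_const
    exact ((hint (hf' 1) (hfc.fderiv_apply ℝ 1) ha).add
      (hint (hf' Complex.I) (hfc.fderiv_apply ℝ Complex.I) hb)).add (hint hf.continuous hfc hd)
  have hi : IntegrableOn (fun z => ‖a z‖ + ‖b z‖ + ‖d z‖) D := (ha.norm.add hb.norm).add hd.norm
  rw [← norm_le_zero_iff]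
  refine le_of_forall_pos_le_add fun ε hε => ?_
  rw [zero_add]
  set I := ∫ z in D, (‖a z‖ + ‖b z‖ + ‖d z‖) with hI
  have hI0 : 0 ≤ I := integral_nonneg fun z => by positivity
  -- The error is this tolerance times `I`; the added `1` avoids a case distinction when `I = 0`.
  obtain ⟨χ, hχ, hχ1, hχ2⟩ := exists_isTestFunction_near hD h1 h2 h3
    (ε := ε / (I + 1)) (by positivity)
  have hsub := integral_sub (hint3 h1 h2) (hint3 hχ.contDiff_one hχ.compact)
  rw [h χ hχ, sub_zero] at hsub
  rw [← hsub]
  calc _ ≤ ∫ z in D, ε / (I + 1) * (‖a z‖ + ‖b z‖ + ‖d z‖) := by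
        refine norm_integral_le_of_norm_le (hi.const_mul _) (Eventually.of_forall fun z => ?_)
        have k1 : ∀ e : ℂ, ‖e‖ = 1 → ‖fderiv ℝ φ' z e - fderiv ℝ χ z e‖ ≤ ε / (I + 1) := by
          intro e he
          have := (fderiv ℝ χ z - fderiv ℝ φ' z).le_of_opNorm_le (hχ2 z) e
          rwa [he, mul_one, _root_.sub_apply, norm_sub_rev] at this
        have k2 : ‖φ' z - χ z‖ ≤ ε / (I + 1) := by rw [norm_sub_rev]; exact hχ1 z
        have e2 : fderiv ℝ φ' z 1 • a z + fderiv ℝ φ' z Complex.I • b z + φ' z • d z -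
            (fderiv ℝ χ z 1 • a z + fderiv ℝ χ z Complex.I • b z + χ z • d z) =
            (fderiv ℝ φ' z 1 - fderiv ℝ χ z 1) • a z +
            (fderiv ℝ φ' z Complex.I - fderiv ℝ χ z Complex.I) • b z + (φ' z - χ z) • d z := by
          module
        rw [e2]
        refine (norm_add₃_le).trans ?_
        rw [norm_smul, norm_smul, norm_smul, mul_add, mul_add]
        gcongr
        · exact k1 1 (by simp)
        · exact k1 _ (by simp)
    _ = ε * (I / (I + 1)) := by rw [integral_const_mul, ← hI]; ring
    _ ≤ ε * 1 := by
        gcongr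
        rw [div_le_one (by positivity)]
        linarith
    _ = ε := mul_one ε

/-! ### The strip cutoff -/

/-- A smooth cutoff on the line: `1` up to `1` and `0` from `2` on. -/
noncomputable def cutoff (t : ℝ) : ℝ := 1 - Real.smoothTransition (t - 1)

theorem contDiff_cutoff {m : ℕ∞} : ContDiff ℝ m cutoff :=
  contDiff_const.sub (Real.smoothTransition.contDiff.comp (contDiff_id.sub contDiff_const))

theorem cutoff_of_le {t : ℝ} (ht : t ≤ 1) : cutoff t = 1 := by
  rw [cutoff, Real.smoothTransition.zero_of_nonpos (by linarith), sub_zero]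

theorem cutoff_of_ge {t : ℝ} (ht : 2 ≤ t) : cutoff t = 0 := by
  rw [cutoff, Real.smoothTransition.one_of_one_le (by linarith), sub_self]

theorem cutoff_mem_Icc (t : ℝ) : cutoff t ∈ Icc (0 : ℝ) 1 :=
  ⟨sub_nonneg.2 (Real.smoothTransition.le_one _),
    sub_le_self _ (Real.smoothTransition.nonneg _)⟩

theorem deriv_cutoff_of_le {t : ℝ} (ht : t ≤ 1) : deriv cutoff t = 0 := by
  have hc : ContDiff ℝ 1 cutoff := contDiff_cutoff (m := 1)
  have hcl : IsClosed {t | deriv cutoff t = 0} :=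
    isClosed_eq (hc.continuous_deriv le_rfl) continuous_const
  have hs : Iio (1 : ℝ) ⊆ {t | deriv cutoff t = 0} := fun s hs => by
    have : cutoff =ᶠ[𝓝 s] fun _ => 1 := eventuallyEq_of_mem (Iio_mem_nhds hs) fun x hx =>
      cutoff_of_le (le_of_lt hx)
    change deriv cutoff s = 0
    rw [this.deriv_eq, deriv_const]
  have := closure_minimal hs hcl
  rw [closure_Iio] at this
  exact this ht

theorem deriv_eq_zero_of_const_of_ge {f : ℝ → ℝ} (hf : ContDiff ℝ 1 f) {a k : ℝ}
    (h : ∀ t, a ≤ t → f t = k) {t : ℝ} (ht : a ≤ t) : deriv f t = 0 := by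
  have hcl : IsClosed {t | deriv f t = 0} :=
    isClosed_eq (hf.continuous_deriv le_rfl) continuous_const
  have hs : Ioi a ⊆ {t | deriv f t = 0} := fun s hs => by
    have : f =ᶠ[𝓝 s] fun _ => k := eventuallyEq_of_mem (Ioi_mem_nhds hs) fun x hx =>
      h x (le_of_lt hx)
    change deriv f s = 0
    rw [this.deriv_eq, deriv_const]
  have := closure_minimal hs hcl
  rw [closure_Ioi] at this
  exact this ht

theorem contDiff_deriv_cutoff : ContDiff ℝ 1 (deriv cutoff) :=
  ((contDiff_succ_iff_deriv (n := 1)).1 (contDiff_cutoff (m := 2))).2.2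

theorem deriv_cutoff_of_ge {t : ℝ} (ht : 2 ≤ t) : deriv cutoff t = 0 :=
  deriv_eq_zero_of_const_of_ge (contDiff_cutoff (m := 1)) (fun _ => cutoff_of_ge) ht

theorem deriv_deriv_cutoff_of_ge {t : ℝ} (ht : 2 ≤ t) : deriv (deriv cutoff) t = 0 :=
  deriv_eq_zero_of_const_of_ge contDiff_deriv_cutoff (fun _ => deriv_cutoff_of_ge) ht

theorem exists_norm_deriv_cutoff_le : ∃ M, 0 ≤ M ∧ ∀ t, ‖deriv cutoff t‖ ≤ M := by
  obtain ⟨M, hM⟩ := (isCompact_Icc (a := (0 : ℝ)) (b := 2)).exists_bound_of_continuousOn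
    contDiff_deriv_cutoff.continuous.continuousOn
  have hM0 : 0 ≤ M := (norm_nonneg _).trans (hM 0 (by simp))
  refine ⟨M, hM0, fun t => ?_⟩
  by_cases ht : t ∈ Icc (0 : ℝ) 2
  · exact hM _ ht
  · rw [mem_Icc, not_and_or, not_le, not_le] at ht
    rcases ht with ht | ht
    · rw [deriv_cutoff_of_le (by linarith)]; simpa using hM0
    · rw [deriv_cutoff_of_ge ht.le]; simpa using hM0

/-- A cutoff to the strip of width `2 * ε` above the graph of `γ`. -/
noncomputable def stripCutoff (c : ℂ) (γ : ℝ → ℝ) (ε : ℝ) (z : ℂ) : ℝ :=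
  cutoff (height c γ z / ε)

namespace IsGraphChart

theorem contDiff_stripCutoff (h : IsGraphChart D z₀ r c γ) (ε : ℝ) :
    ContDiff ℝ 2 (stripCutoff c γ ε) :=
  (contDiff_cutoff (m := 2)).comp (h.contDiff_height.div_const ε)

theorem hasFDerivAt_stripCutoff (h : IsGraphChart D z₀ r c γ) (ε : ℝ) (z : ℂ) :
    HasFDerivAt (stripCutoff c γ ε)
      ((deriv cutoff (height c γ z / ε) * ε⁻¹) • fderiv ℝ (height c γ) z) z := by
  have h1 := (h.contDiff_height.differentiable two_ne_zero z).hasFDerivAt.mul_const ε⁻¹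
  have h2 : HasDerivAt cutoff (deriv cutoff (height c γ z / ε)) (height c γ z / ε) :=
    ((contDiff_cutoff (m := 1)).differentiable (by simp) _).hasDerivAt
  have h3 := h2.comp_hasFDerivAt z (f := fun z => height c γ z * ε⁻¹) h1
  rwa [smul_smul] at h3

theorem fderiv_stripCutoff_eq_zero (h : IsGraphChart D z₀ r c γ) {ε : ℝ} (hε : 0 < ε) {z : ℂ}
    (hz : height c γ z ≤ ε ∨ 2 * ε ≤ height c γ z) : fderiv ℝ (stripCutoff c γ ε) z = 0 := by
  rw [(h.hasFDerivAt_stripCutoff ε z).fderiv]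
  rcases hz with hz | hz
  · rw [deriv_cutoff_of_le ((div_le_one hε).2 hz), zero_mul, zero_smul]
  · rw [deriv_cutoff_of_ge ((le_div_iff₀ hε).2 hz), zero_mul, zero_smul]

theorem fderiv_fderiv_stripCutoff (h : IsGraphChart D z₀ r c γ) (ε : ℝ) (z e : ℂ) :
    fderiv ℝ (fun w => fderiv ℝ (stripCutoff c γ ε) w e) z e =
      deriv (deriv cutoff) (height c γ z / ε) * ε⁻¹ * ε⁻¹ * fderiv ℝ (height c γ) z e ^ 2 +
        deriv cutoff (height c γ z / ε) * ε⁻¹ *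
          fderiv ℝ (fun w => fderiv ℝ (height c γ) w e) z e := by
  have h1 := (h.contDiff_height.differentiable two_ne_zero z).hasFDerivAt.mul_const ε⁻¹
  have hd : ContDiff ℝ 1 (deriv cutoff) := contDiff_deriv_cutoff
  have h2 : HasDerivAt (deriv cutoff) (deriv (deriv cutoff) (height c γ z / ε))
      (height c γ z / ε) := (hd.differentiable one_ne_zero _).hasDerivAt
  have h3 := (h2.comp_hasFDerivAt z (f := fun z => height c γ z * ε⁻¹) h1).mul_const ε⁻¹
  have h4 : DifferentiableAt ℝ (fun w => fderiv ℝ (height c γ) w e) z :=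
    ((h.contDiff_height.fderiv_right (m := 1) (by norm_num)).clm_apply
      contDiff_const).differentiable one_ne_zero z
  have h5 := h3.mul h4.hasFDerivAt
  have e1 : (fun w => fderiv ℝ (stripCutoff c γ ε) w e) = fun w =>
      (deriv cutoff (height c γ w / ε) * ε⁻¹) * fderiv ℝ (height c γ) w e := by
    funext w
    rw [(h.hasFDerivAt_stripCutoff ε w).fderiv]
    simp
  rw [e1, HasFDerivAt.fderiv (f := fun w =>
      (deriv cutoff (height c γ w / ε) * ε⁻¹) * fderiv ℝ (height c γ) w e) h5]
  simp only [_root_.add_apply, _root_.smul_apply, smul_eq_mul, Function.comp_apply,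
    ← div_eq_mul_inv]
  ring

/-- Each derivative of the cutoff costs a factor `1 / ε`. In the second derivative, the term with
the Hessian of the height costs only `1 / ε`, which is absorbed because `ε ≤ 1`. -/
theorem exists_stripCutoff_bound (h : IsGraphChart D z₀ r c γ) {K : Set ℂ} (hK : IsCompact K) :
    ∃ C, 0 ≤ C ∧ ∀ ε, 0 < ε → ε ≤ 1 → ∀ z ∈ K, ∀ e : ℂ, e = 1 ∨ e = Complex.I →
      ‖fderiv ℝ (stripCutoff c γ ε) z e‖ ≤ C / ε ∧
      (0 ≤ height c γ z → height c γ z < 2 * ε →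
        ‖fderiv ℝ (fun w => fderiv ℝ (stripCutoff c γ ε) w e) z e‖ ≤ C / ε ^ 2) := by
  have hd : ContDiff ℝ 1 (deriv cutoff) := contDiff_deriv_cutoff
  obtain ⟨M₁, hM₁0, hM₁⟩ := exists_norm_deriv_cutoff_le
  obtain ⟨M₂, hM₂⟩ := (isCompact_Icc (a := (0 : ℝ)) (b := 2)).exists_bound_of_continuousOn
    (hd.continuous_deriv le_rfl).continuousOn
  have h1 : ContDiff ℝ 1 (fderiv ℝ (height c γ)) := h.contDiff_height.fderiv_right (by norm_num)
  obtain ⟨A, hA⟩ := hK.exists_bound_of_continuousOn h1.continuous.continuousOn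
  obtain ⟨B, hB⟩ := hK.exists_bound_of_continuousOn
    (h1.continuous_fderiv one_ne_zero).continuousOn
  have hM₂0 : 0 ≤ M₂ := (norm_nonneg _).trans (hM₂ 0 (by simp))
  refine ⟨M₁ * |A| + (M₂ * |A| ^ 2 + M₁ * |B|), by positivity, fun ε hε hε1 z hz e he => ?_⟩
  have hen : ‖e‖ = 1 := by rcases he with rfl | rfl <;> simp
  have kA : ‖fderiv ℝ (height c γ) z e‖ ≤ |A| := by
    have := (fderiv ℝ (height c γ) z).le_of_opNorm_le ((hA z hz).trans (le_abs_self A)) e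
    rwa [hen, mul_one] at this
  have kB : ‖fderiv ℝ (fun w => fderiv ℝ (height c γ) w e) z e‖ ≤ |B| := by
    rw [fderiv_clm_apply (h1.differentiable one_ne_zero z) (differentiableAt_const e)]
    have h2 := (fderiv ℝ (fderiv ℝ (height c γ)) z).le_of_opNorm_le
      ((hB z hz).trans (le_abs_self B)) e
    rw [hen, mul_one] at h2
    have h3 := (fderiv ℝ (fderiv ℝ (height c γ)) z e).le_of_opNorm_le h2 e
    rw [hen, mul_one] at h3
    simpa using h3
  have k1 : ‖deriv cutoff (height c γ z / ε)‖ ≤ M₁ := hM₁ _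
  have hεi : 1 ≤ ε⁻¹ := (one_le_inv₀ hε).2 hε1
  constructor
  · rw [(h.hasFDerivAt_stripCutoff ε z).fderiv, _root_.smul_apply, smul_eq_mul, norm_mul, norm_mul,
      Real.norm_of_nonneg (by positivity : 0 ≤ ε⁻¹),
      div_eq_mul_inv (M₁ * |A| + (M₂ * |A| ^ 2 + M₁ * |B|))]
    calc _ ≤ M₁ * ε⁻¹ * |A| := by gcongr
      _ = M₁ * |A| * ε⁻¹ := by ring
      _ ≤ _ := by
        gcongr
        exact le_add_of_nonneg_right (by positivity)
  · intro h0 h2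
    have k2 : ‖deriv (deriv cutoff) (height c γ z / ε)‖ ≤ M₂ :=
      hM₂ _ ⟨by positivity, ((div_lt_iff₀ hε).2 h2).le⟩
    rw [h.fderiv_fderiv_stripCutoff,
      div_eq_mul_inv (M₁ * |A| + (M₂ * |A| ^ 2 + M₁ * |B|)), ← inv_pow]
    refine (norm_add_le _ _).trans ?_
    rw [norm_mul, norm_mul, norm_mul, norm_mul, norm_mul, norm_pow,
      Real.norm_of_nonneg (by positivity : 0 ≤ ε⁻¹)]
    calc _ ≤ M₂ * ε⁻¹ * ε⁻¹ * |A| ^ 2 + M₁ * ε⁻¹ * |B| := by gcongr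
      _ ≤ M₂ * ε⁻¹ * ε⁻¹ * |A| ^ 2 + M₁ * (ε⁻¹ * ε⁻¹) * |B| := by
        gcongr
        exact le_mul_of_one_le_right (by positivity) hεi
      _ = (M₂ * |A| ^ 2 + M₁ * |B|) * ε⁻¹ ^ 2 := by ring
      _ ≤ _ := mul_le_mul_of_nonneg_right
        (le_add_of_nonneg_left (mul_nonneg hM₁0 (abs_nonneg A))) (by positivity)

end IsGraphChart

end

section

variable {D : Set ℂ} {z₀ : ℂ} {r : ℝ} {c : ℂ} {γ : ℝ → ℝ} {a b d : ℂ → ℂ}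

/-! ### The flux functional and its bound by arc length -/

theorem integrableOn_smul_of_bound (hD : IsOpen D) {f : ℂ → ℝ} {g : ℂ → ℂ}
    (hf : ContinuousOn f D) {M : ℝ} (hM : ∀ z ∈ D, ‖f z‖ ≤ M) (hg : IntegrableOn g D) :
    IntegrableOn (fun z => f z • g z) D :=
  Integrable.bdd_smul hg M (hf.aestronglyMeasurable hD.measurableSet)
    ((ae_restrict_mem hD.measurableSet).mono hM)

theorem continuousOn_fderiv_apply (hD : IsOpen D) {φ : ℂ → ℝ} (hφ : ContDiffOn ℝ 1 φ (closure D))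
    (e : ℂ) : ContinuousOn (fun z => fderiv ℝ φ z e) D :=
  ((hφ.mono subset_closure).continuousOn_fderiv_of_isOpen hD le_rfl).clm_apply continuousOn_const

theorem integrableOn_fderiv_smul (hD : IsOpen D) (hb : Bornology.IsBounded D) {φ : ℂ → ℝ}
    (hφ : ContDiffOn ℝ 1 φ (closure D)) {g : ℂ → ℂ} (hg : IntegrableOn g D) (e : ℂ) :
    IntegrableOn (fun z => fderiv ℝ φ z e • g z) D := by
  obtain ⟨M, -, hM⟩ := exists_bound_fderiv hD hb hφ
  exact integrableOn_smul_of_bound hD (continuousOn_fderiv_apply hD hφ e)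
    (fun z hz => (fderiv ℝ φ z).le_of_opNorm_le (hM z hz).2 e) hg

/-- The left hand side of Green's formula: `∫_D (∇φ · ∇u + φ Δu)`, where `∇u = (a, b)` and
`Δu = d`. -/
noncomputable def flux (D : Set ℂ) (a b d : ℂ → ℂ) (φ : ℂ → ℝ) : ℂ :=
  ∫ z in D, (fderiv ℝ φ z 1 • a z + fderiv ℝ φ z Complex.I • b z + φ z • d z)

theorem integrableOn_flux (hD : IsOpen D) (hb : Bornology.IsBounded D) (ia : IntegrableOn a D)
    (ib : IntegrableOn b D) (id : IntegrableOn d D) {φ : ℂ → ℝ}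
    (hφ : ContDiffOn ℝ 1 φ (closure D)) :
    IntegrableOn (fun z => fderiv ℝ φ z 1 • a z + fderiv ℝ φ z Complex.I • b z + φ z • d z) D := by
  obtain ⟨M, -, hM⟩ := exists_bound_fderiv hD hb hφ
  exact ((integrableOn_fderiv_smul hD hb hφ ia 1).add
    (integrableOn_fderiv_smul hD hb hφ ib _)).add
    (integrableOn_smul_of_bound hD (hφ.continuousOn.mono subset_closure)
      (fun z hz => (hM z hz).1) id)

theorem flux_add (hD : IsOpen D) (hb : Bornology.IsBounded D) (ia : IntegrableOn a D)
    (ib : IntegrableOn b D) (id : IntegrableOn d D) {φ ψ : ℂ → ℝ}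
    (hφ : ContDiffOn ℝ 1 φ (closure D)) (hψ : ContDiffOn ℝ 1 ψ (closure D)) :
    flux D a b d (fun z => φ z + ψ z) = flux D a b d φ + flux D a b d ψ := by
  rw [flux, flux, flux, ← integral_add (integrableOn_flux hD hb ia ib id hφ)
    (integrableOn_flux hD hb ia ib id hψ)]
  refine setIntegral_congr_fun hD.measurableSet fun z hz => ?_
  have hd : ∀ {f : ℂ → ℝ}, ContDiffOn ℝ 1 f (closure D) → DifferentiableAt ℝ f z := fun hf =>
    ((hf.mono subset_closure).contDiffAt (hD.mem_nhds hz)).differentiableAt one_ne_zero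
  rw [fderiv_fun_add (hd hφ) (hd hψ)]
  simp only [_root_.add_apply]
  module

theorem flux_smul (k : ℝ) {φ : ℂ → ℝ} :
    flux D a b d (fun z => k * φ z) = k • flux D a b d φ := by
  rw [flux, flux, ← integral_smul]
  congr 1
  funext z
  have : fderiv ℝ (fun z => k * φ z) z = k • fderiv ℝ φ z :=
    congrFun (fderiv_const_smul_field (f := φ) k) z
  rw [this]
  simp only [_root_.smul_apply, smul_eq_mul, mul_smul, smul_add]

/-- Control of the flux through thin strips along the boundary. -/
def HasStripBound (D : Set ℂ) (a b : ℂ → ℂ) : Prop :=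
  ∀ z₀ r c γ, IsGraphChart D z₀ r c γ → ∀ K, IsCompact K → K ⊆ Metric.ball z₀ r →
    ∃ C : ℝ, 0 ≤ C ∧ ∃ ε₀ > 0, ∀ ε, 0 < ε → ε < ε₀ → ∀ ψ : ℂ → ℝ,
      ContDiffOn ℝ 1 ψ (closure D) → (∀ z ∈ D, z ∉ K → ψ z = 0) →
      ‖∫ z in D, ψ z • (fderiv ℝ (stripCutoff c γ ε) z 1 • a z +
        fderiv ℝ (stripCutoff c γ ε) z Complex.I • b z)‖ ≤
      C * ∫ z in D ∩ {z | z ∈ K ∧ height c γ z < 2 * ε}, (‖fderiv ℝ ψ z‖ + ‖ψ z‖ / ε)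

theorem integrableOn_norm_fderiv_add (hD : IsOpen D) (hb : Bornology.IsBounded D) {ψ : ℂ → ℝ}
    (hψ : ContDiffOn ℝ 1 ψ (closure D)) :
    IntegrableOn (fun z => ‖fderiv ℝ ψ z‖) D ∧ IntegrableOn (fun z => ‖ψ z‖) D := by
  have := isFiniteMeasure_restrict hb
  obtain ⟨M, -, hM⟩ := exists_bound_fderiv hD hb hψ
  have h1 : ContinuousOn (fderiv ℝ ψ) D :=
    (hψ.mono subset_closure).continuousOn_fderiv_of_isOpen hD le_rfl
  exact ⟨(Integrable.of_bound (h1.aestronglyMeasurable hD.measurableSet) M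
    ((ae_restrict_mem hD.measurableSet).mono fun z hz => (hM z hz).2)).norm,
    (Integrable.of_bound ((hψ.continuousOn.mono subset_closure).aestronglyMeasurable
      hD.measurableSet) M
      ((ae_restrict_mem hD.measurableSet).mono fun z hz => (hM z hz).1)).norm⟩

theorem norm_setIntegral_le_strip (hD : IsOpen D) (hb : Bornology.IsBounded D) {ψ : ℂ → ℝ}
    (hψ : ContDiffOn ℝ 1 ψ (closure D)) {S : Set ℂ} (hS : MeasurableSet S) {F : ℂ → ℂ} {C ε : ℝ}
    (hin : ∀ᵐ z ∂(volume.restrict D), z ∈ S → ‖F z‖ ≤ C * (‖fderiv ℝ ψ z‖ + ‖ψ z‖ / ε))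
    (hout : ∀ z ∈ D, z ∉ S → F z = 0) :
    ‖∫ z in D, F z‖ ≤ C * ∫ z in D ∩ S, (‖fderiv ℝ ψ z‖ + ‖ψ z‖ / ε) := by
  rw [setIntegral_eq_of_subset_of_forall_sdiff_eq_zero hD.measurableSet
    (inter_subset_left (s := D) (t := S)) fun z hz => hout z hz.1 fun h => hz.2 ⟨hz.1, h⟩, ← integral_const_mul]
  obtain ⟨i1, i2⟩ := integrableOn_norm_fderiv_add hD hb hψ
  refine norm_integral_le_of_norm_le
    (IntegrableOn.mono_set ((i1.add (i2.div_const ε)).const_mul C) inter_subset_left) ?_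
  filter_upwards [ae_restrict_of_ae_restrict_of_subset inter_subset_left hin,
    ae_restrict_mem (hD.measurableSet.inter hS)] with z h1 h2 using h1 h2.2

theorem measurableSet_strip (h : IsGraphChart D z₀ r c γ) {K : Set ℂ} (hK : IsCompact K) (ε : ℝ) :
    MeasurableSet {z | z ∈ K ∧ height c γ z < 2 * ε} :=
  hK.measurableSet.inter
    (measurableSet_lt h.contDiff_height.continuous.measurable measurable_const)

theorem fderiv_eq_zero_of_forall_notMem (hD : IsOpen D) {K : Set ℂ} (hK : IsCompact K)
    {ψ : ℂ → ℝ} (h0 : ∀ z ∈ D, z ∉ K → ψ z = 0) {z : ℂ} (hz : z ∈ D) (hzK : z ∉ K) :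
    fderiv ℝ ψ z = 0 := by
  have : ψ =ᶠ[𝓝 z] fun _ => 0 := eventuallyEq_of_mem
    (inter_mem (hD.mem_nhds hz) (hK.isClosed.isOpen_compl.mem_nhds hzK))
    fun w hw => h0 w hw.1 hw.2
  rw [this.fderiv_eq]
  simp

/-- For a bounded field, the pointwise bound `C / ε` on the gradient of the cutoff is enough. -/
theorem hasStripBound_of_bound (hD : IsOpen D) (hb : Bornology.IsBounded D) {M : ℝ}
    (ha : ∀ z ∈ D, ‖a z‖ ≤ M) (hb' : ∀ z ∈ D, ‖b z‖ ≤ M) : HasStripBound D a b := by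
  intro z₀ r c γ h K hK _
  obtain ⟨C, hC, hcut⟩ := h.exists_stripCutoff_bound hK
  refine ⟨2 * (C * |M|), by positivity, 1, one_pos, fun ε hε hε1 ψ hψ h0 => ?_⟩
  refine norm_setIntegral_le_strip hD hb hψ (measurableSet_strip h hK ε) ?_ ?_
  · filter_upwards [ae_restrict_mem hD.measurableSet] with z hz hzS
    have k1 := (hcut ε hε hε1.le z hzS.1 1 (Or.inl rfl)).1
    have k2 := (hcut ε hε hε1.le z hzS.1 _ (Or.inr rfl)).1
    have k3 := (ha z hz).trans (le_abs_self M)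
    have k4 := (hb' z hz).trans (le_abs_self M)
    calc _ ≤ ‖ψ z‖ * (C / ε * |M| + C / ε * |M|) := by
          rw [norm_smul]
          gcongr
          refine (norm_add_le _ _).trans ?_
          rw [norm_smul, norm_smul]
          gcongr
      _ = 2 * (C * |M|) * (‖ψ z‖ / ε) := by ring
      _ ≤ _ := mul_le_mul_of_nonneg_left (le_add_of_nonneg_left (norm_nonneg _)) (by positivity)
  · intro z hz hzS
    by_cases hzK : z ∈ K
    · have : 2 * ε ≤ height c γ z := not_lt.1 fun h' => hzS ⟨hzK, h'⟩
      rw [h.fderiv_stripCutoff_eq_zero hε (Or.inr this)]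
      simp
    · rw [h0 z hz hzK, zero_smul]

/-- Nothing is known about `∇w` near the boundary, so the derivative is moved to `ψ ∇η`. This
produces `|ψ| / ε² + |∇ψ| / ε`, and `|w| ≤ 2 C₀ ε` on the strip restores the right power of `ε`. -/
theorem IsH10.hasStripBound (hD : IsOpen D) (hb : Bornology.IsBounded D) {w wx wy : ℂ → ℂ}
    (hw : IsH10 D w wx wy) {C₀ : ℝ} (hC₀ : 0 ≤ C₀)
    (hle : ∀ᵐ z ∂(volume.restrict D), ‖w z‖ ≤ C₀ * Metric.infDist z (frontier D)) :
    HasStripBound D wx wy := by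
  have := isFiniteMeasure_restrict hb
  intro z₀ r c γ h K hK hKr
  obtain ⟨C, hC, hcut⟩ := h.exists_stripCutoff_bound hK
  obtain ⟨ε₀, hε₀, hfr⟩ := h.exists_graphMap_mem_frontier hD hK hKr
  refine ⟨4 * (C * C₀), by positivity, min (ε₀ / 2) 1, by positivity, fun ε hε hεlt ψ hψ h0 => ?_⟩
  have hε1 : ε ≤ 1 := hεlt.le.trans (min_le_right _ _)
  have hε2 : 2 * ε < ε₀ := by linarith [min_le_left (ε₀ / 2) 1]
  set η := stripCutoff c γ ε with hη
  have hη2 : ContDiff ℝ 2 η := h.contDiff_stripCutoff ε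
  have hηe : ∀ e : ℂ, ContDiff ℝ 1 fun z => fderiv ℝ η z e := fun e =>
    (hη2.fderiv_right (m := 1) (by norm_num)).clm_apply contDiff_const
  have hY : ∀ e : ℂ, ContDiffOn ℝ 1 (fun z => ψ z * fderiv ℝ η z e) (closure D) := fun e =>
    hψ.mul (hηe e).contDiffOn
  -- `η` is constant up to height `ε`, so `ψ ∇η` is supported away from `∂D` and there is no
  -- boundary term.
  have hK' : IsCompact (closure D ∩ (K ∩ {z | ε ≤ height c γ z})) :=
    (hK.inter_right (isClosed_le continuous_const h.contDiff_height.continuous)).inter_left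
      isClosed_closure
  have hKD : closure D ∩ (K ∩ {z | ε ≤ height c γ z}) ⊆ D := fun z hz =>
    (h.mem_iff z (hKr hz.2.1)).2 (hε.trans_le hz.2.2)
  have hY0 : ∀ e : ℂ, ∀ z ∈ D, z ∉ closure D ∩ (K ∩ {z | ε ≤ height c γ z}) →
      ψ z * fderiv ℝ η z e = 0 := by
    intro e z hz hz'
    by_cases hzK : z ∈ K
    · have : height c γ z ≤ ε := le_of_not_ge fun h' => hz' ⟨subset_closure hz, hzK, h'⟩
      rw [h.fderiv_stripCutoff_eq_zero hε (Or.inl this)]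
      simp
    · rw [h0 z hz hzK, zero_mul]
  have iw : IntegrableOn w D := hw.isH1.memLp.integrable one_le_two
  have ix : IntegrableOn wx D := hw.isH1.memLp_x.integrable one_le_two
  have iy : IntegrableOn wy D := hw.isH1.memLp_y.integrable one_le_two
  obtain ⟨M, -, hM⟩ := exists_bound_fderiv hD hb hψ
  have iY : ∀ (e : ℂ) {g : ℂ → ℂ}, IntegrableOn g D →
      IntegrableOn (fun z => (ψ z * fderiv ℝ η z e) • g z) D := fun e g hg => by
    obtain ⟨M, -, hM⟩ := exists_bound_fderiv hD hb (hY e)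
    exact integrableOn_smul_of_bound hD ((hY e).continuousOn.mono subset_closure)
      (fun z hz => (hM z hz).1) hg
  have key : ∀ (e : ℂ) {g : ℂ → ℂ}, IsWeakDeriv D e w g → IntegrableOn g D → e = 1 ∨ e = Complex.I →
      ∫ z in D, (ψ z * fderiv ℝ η z e) • g z =
        - ∫ z in D, fderiv ℝ (fun z => ψ z * fderiv ℝ η z e) z e • w z := by
    intro e g hwk hg he
    rw [← add_eq_zero_iff_eq_neg', ← integral_add (integrableOn_fderiv_smul hD hb (hY e) iw e)
      (iY e hg)]
    rcases he with rfl | rfl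
    -- The definition of the weak derivative, written as a weak equation with one vanishing
    -- component, so that it can be tested with `C¹` functions.
    · have hl : IsWeakLaplacian D w (fun _ => 0) g := fun φ hφ => by
        have h1 := integrableOn_fderiv_smul hD hb hφ.contDiff_one.contDiffOn iw 1
        have h2 : IntegrableOn (fun z => φ z • g z) D := by
          obtain ⟨B, hB⟩ := hφ.compact.exists_bound_of_continuous hφ.smooth.continuous
          exact integrableOn_smul_of_bound hD hφ.smooth.continuous.continuousOn
            (fun z _ => hB z) hg
        have h3 := integral_add h1 h2
        rw [hwk φ hφ, neg_add_cancel] at h3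
        simpa using h3
      have := hl.integral_eq_zero hD iw integrableOn_zero hg ((hY 1).mono subset_closure)
        hK' hKD (hY0 1)
      simpa using this
    · have hl : IsWeakLaplacian D (fun _ => 0) w g := fun φ hφ => by
        have h1 := integrableOn_fderiv_smul hD hb hφ.contDiff_one.contDiffOn iw Complex.I
        have h2 : IntegrableOn (fun z => φ z • g z) D := by
          obtain ⟨B, hB⟩ := hφ.compact.exists_bound_of_continuous hφ.smooth.continuous
          exact integrableOn_smul_of_bound hD hφ.smooth.continuous.continuousOn
            (fun z _ => hB z) hg
        have h3 := integral_add h1 h2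
        rw [hwk φ hφ, neg_add_cancel] at h3
        simpa using h3
      have := hl.integral_eq_zero hD integrableOn_zero iw hg ((hY Complex.I).mono subset_closure)
        hK' hKD (hY0 Complex.I)
      simpa using this
  have e1 : ∫ z in D, ψ z • (fderiv ℝ η z 1 • wx z + fderiv ℝ η z Complex.I • wy z) =
      - ∫ z in D, (fderiv ℝ (fun z => ψ z * fderiv ℝ η z 1) z 1 • w z +
        fderiv ℝ (fun z => ψ z * fderiv ℝ η z Complex.I) z Complex.I • w z) := by
    simp only [smul_add, smul_smul]
    rw [integral_add (iY 1 ix) (iY _ iy), key 1 hw.isH1.deriv_x ix (Or.inl rfl),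
      key _ hw.isH1.deriv_y iy (Or.inr rfl),
      integral_add (integrableOn_fderiv_smul hD hb (hY 1) iw 1)
        (integrableOn_fderiv_smul hD hb (hY _) iw _), neg_add]
  rw [e1, norm_neg]
  have hder : ∀ z ∈ D, ∀ e : ℂ, fderiv ℝ (fun z => ψ z * fderiv ℝ η z e) z e =
      ψ z * fderiv ℝ (fun w => fderiv ℝ η w e) z e + fderiv ℝ η z e * fderiv ℝ ψ z e := by
    intro z hz e
    rw [fderiv_fun_mul (((hψ.mono subset_closure).contDiffAt (hD.mem_nhds hz)).differentiableAt
      one_ne_zero) ((hηe e).differentiable one_ne_zero z)]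
    simp
  refine norm_setIntegral_le_strip hD hb hψ (measurableSet_strip h hK ε) ?_ ?_
  · filter_upwards [hle, ae_restrict_mem hD.measurableSet] with z hwz hz hzS
    have hρ : 0 < height c γ z := (h.mem_iff z (hKr hzS.1)).1 hz
    have hdist : Metric.infDist z (frontier D) ≤ 2 * ε := by
      refine (Metric.infDist_le_dist_of_mem (hfr z hzS.1 ?_)).trans ?_
      · rw [abs_of_pos hρ]; linarith [hzS.2]
      · rw [h.dist_graphMap, abs_of_pos hρ]; exact hzS.2.le
    have hwz' : ‖w z‖ ≤ C₀ * (2 * ε) := hwz.trans (by gcongr)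
    have hY1 : ∀ e : ℂ, e = 1 ∨ e = Complex.I →
        ‖fderiv ℝ (fun z => ψ z * fderiv ℝ η z e) z e‖ ≤
          ‖ψ z‖ * (C / ε ^ 2) + C / ε * ‖fderiv ℝ ψ z‖ := by
      intro e he
      have hen : ‖e‖ = 1 := by rcases he with rfl | rfl <;> simp
      obtain ⟨k1, k2⟩ := hcut ε hε hε1 z hzS.1 e he
      have k2 := k2 hρ.le hzS.2
      have k3 : ‖fderiv ℝ ψ z e‖ ≤ ‖fderiv ℝ ψ z‖ := by
        have := (fderiv ℝ ψ z).le_opNorm e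
        rwa [hen, mul_one] at this
      rw [hder z hz]
      refine (norm_add_le _ _).trans ?_
      rw [norm_mul, norm_mul]
      gcongr
    calc _ ≤ (‖ψ z‖ * (C / ε ^ 2) + C / ε * ‖fderiv ℝ ψ z‖) * (C₀ * (2 * ε)) +
          (‖ψ z‖ * (C / ε ^ 2) + C / ε * ‖fderiv ℝ ψ z‖) * (C₀ * (2 * ε)) := by
          refine (norm_add_le _ _).trans ?_
          rw [norm_smul, norm_smul]
          gcongr
          · exact hY1 1 (Or.inl rfl)
          · exact hY1 _ (Or.inr rfl)
      _ = 4 * (C * C₀) * (‖fderiv ℝ ψ z‖ + ‖ψ z‖ / ε) := by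
          field_simp
          ring
  · intro z hz hzS
    have : ∀ e : ℂ, fderiv ℝ (fun z => ψ z * fderiv ℝ η z e) z e = 0 := by
      intro e
      by_cases hzK : z ∈ K
      · have hge : 2 * ε ≤ height c γ z := not_lt.1 fun h' => hzS ⟨hzK, h'⟩
        have e2 : fderiv ℝ (fun w => fderiv ℝ η w e) z e = 0 := by
          have ht : 2 ≤ height c γ z / ε := (le_div_iff₀ hε).2 hge
          rw [h.fderiv_fderiv_stripCutoff, deriv_deriv_cutoff_of_ge ht, deriv_cutoff_of_ge ht]
          simp
        rw [hder z hz, e2, h.fderiv_stripCutoff_eq_zero hε (Or.inr hge)]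
        simp
      · rw [hder z hz, h0 z hz hzK, fderiv_eq_zero_of_forall_notMem hD hK h0 hz hzK]
        simp
    rw [this, this]
    simp

end

/-! ### From strip bounds to a bound of the flux by the boundary norm -/

section

variable {D : Set ℂ} {z₀ : ℂ} {r : ℝ} {c : ℂ} {γ : ℝ → ℝ} {a b d : ℂ → ℂ}

theorem integrable_arcLength (hD : IsOpen D) (hb : Bornology.IsBounded D)
    (hC : HasC2Boundary D) {F : Type*} [NormedAddCommGroup F] {f : ℂ → F}
    (hf : ContinuousOn f (closure D)) : Integrable f (arcLength D) := by
  have := isFiniteMeasure_arcLength hD hb hC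
  have hcl : IsCompact (closure D) := hb.isCompact_closure
  obtain ⟨M, hM⟩ := hcl.exists_bound_of_continuousOn hf
  have hfm : MeasurableSet (frontier D) := isClosed_frontier.measurableSet
  have hfc : IsCompact (frontier D) := hcl.of_isClosed_subset isClosed_frontier
    frontier_subset_closure
  refine Integrable.of_bound ((hf.mono frontier_subset_closure).aestronglyMeasurable_of_isCompact
    hfc hfm) M ?_
  filter_upwards [ae_restrict_mem hfm] with z hz using hM z (frontier_subset_closure hz)

/-- The flux of a function supported near a boundary point is concentrated in strips. -/
theorem flux_eq_strip (h : IsGraphChart D z₀ r c γ) (hD : IsOpen D) (hb : Bornology.IsBounded D)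
    (hl : IsWeakLaplacian D a b d) (ia : IntegrableOn a D) (ib : IntegrableOn b D)
    (id : IntegrableOn d D) {K : Set ℂ} (hK : IsCompact K) (hKr : K ⊆ Metric.ball z₀ r)
    {ψ : ℂ → ℝ} (hψ : ContDiffOn ℝ 1 ψ (closure D)) (h0 : ∀ z ∈ D, z ∉ K → ψ z = 0)
    {ε : ℝ} (hε : 0 < ε) :
    flux D a b d ψ =
      (∫ z in D, stripCutoff c γ ε z • (fderiv ℝ ψ z 1 • a z + fderiv ℝ ψ z Complex.I • b z +
        ψ z • d z)) +
      ∫ z in D, ψ z • (fderiv ℝ (stripCutoff c γ ε) z 1 • a z +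
        fderiv ℝ (stripCutoff c γ ε) z Complex.I • b z) := by
  set η := stripCutoff c γ ε with hη
  have hη2 : ContDiff ℝ 2 η := h.contDiff_stripCutoff ε
  have hη1 : ContDiff ℝ 1 η := hη2.of_le one_le_two
  have hηe : ∀ e : ℂ, ContDiff ℝ 1 fun z => fderiv ℝ η z e := fun e =>
    (hη2.fderiv_right (m := 1) (by norm_num)).clm_apply contDiff_const
  have hK' : IsCompact (closure D ∩ (K ∩ {z | ε ≤ height c γ z})) :=
    (hK.inter_right (isClosed_le continuous_const h.contDiff_height.continuous)).inter_left
      isClosed_closure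
  have hKD : closure D ∩ (K ∩ {z | ε ≤ height c γ z}) ⊆ D := fun z hz =>
    (h.mem_iff z (hKr hz.2.1)).2 (hε.trans_le hz.2.2)
  -- `ψ (1 - η)` vanishes up to height `ε`, so the weak equation annihilates it and only the flux of
  -- `ψ η` is left.
  have hφ : ContDiffOn ℝ 1 (fun z => ψ z * (1 - η z)) (closure D) :=
    hψ.mul (contDiff_const.sub hη1).contDiffOn
  have hφ0 : ∀ z ∈ D, z ∉ closure D ∩ (K ∩ {z | ε ≤ height c γ z}) → ψ z * (1 - η z) = 0 := by
    intro z hz hz'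
    by_cases hzK : z ∈ K
    · have : height c γ z ≤ ε := le_of_not_ge fun h' => hz' ⟨subset_closure hz, hzK, h'⟩
      rw [hη, stripCutoff, cutoff_of_le ((div_le_one hε).2 this)]
      simp
    · rw [h0 z hz hzK, zero_mul]
  have key := hl.integral_eq_zero hD ia ib id (hφ.mono subset_closure) hK' hKD hφ0
  have iQ := integrableOn_flux hD hb ia ib id hψ
  have iηQ : IntegrableOn (fun z => η z • (fderiv ℝ ψ z 1 • a z + fderiv ℝ ψ z Complex.I • b z +
        ψ z • d z)) D :=
    integrableOn_smul_of_bound hD hη1.continuous.continuousOn (M := 1) (fun z _ => by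
      rw [hη, stripCutoff, Real.norm_of_nonneg (cutoff_mem_Icc _).1]
      exact (cutoff_mem_Icc _).2) iQ
  have iY : ∀ (e : ℂ) {g : ℂ → ℂ}, IntegrableOn g D →
      IntegrableOn (fun z => (ψ z * fderiv ℝ η z e) • g z) D := fun e g hg => by
    have hY : ContDiffOn ℝ 1 (fun z => ψ z * fderiv ℝ η z e) (closure D) :=
      hψ.mul (hηe e).contDiffOn
    obtain ⟨M, -, hM⟩ := exists_bound_fderiv hD hb hY
    exact integrableOn_smul_of_bound hD (hY.continuousOn.mono subset_closure)
      (fun z hz => (hM z hz).1) hg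
  have iS : IntegrableOn (fun z => ψ z • (fderiv ℝ η z 1 • a z +
      fderiv ℝ η z Complex.I • b z)) D := by
    simp only [smul_add, smul_smul]
    exact (iY 1 ia).add (iY _ ib)
  have e := integral_sub iQ (iηQ.add iS)
  simp only [Pi.add_apply] at e
  rw [← sub_eq_zero, ← integral_add iηQ iS, flux, ← e, ← key]
  refine setIntegral_congr_fun hD.measurableSet fun z hz => ?_
  have hder : ∀ e : ℂ, fderiv ℝ (fun z => ψ z * (1 - η z)) z e =
      (1 - η z) * fderiv ℝ ψ z e - ψ z * fderiv ℝ η z e := by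
    intro e
    have hη' := hη1.differentiable one_ne_zero z
    rw [fderiv_fun_mul (((hψ.mono subset_closure).contDiffAt (hD.mem_nhds hz)).differentiableAt
      one_ne_zero) (hη'.const_sub 1), fderiv_const_sub]
    simp
    ring
  rw [hder, hder]
  module

/-- Let `ε → 0` in `flux_eq_strip`. The first integral tends to zero by dominated convergence. In
the strip bound for the second, the gradient part is at most the area of the strip, `O(ε)`, times
the supremum of `|∇ψ|`; the part `|ψ| / ε` tends to at most twice the boundary integral, up to `δ`.
-/
theorem exists_flux_bound_local (h : IsGraphChart D z₀ r c γ) (hD : IsOpen D)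
    (hb : Bornology.IsBounded D) (hC : HasC2Boundary D)
    (hl : IsWeakLaplacian D a b d) (ia : IntegrableOn a D) (ib : IntegrableOn b D)
    (id : IntegrableOn d D) (hs : HasStripBound D a b) {K : Set ℂ} (hK : IsCompact K)
    (hKr : K ⊆ Metric.ball z₀ r) : ∃ C, 0 ≤ C ∧ ∀ ψ : ℂ → ℝ, ContDiffOn ℝ 1 ψ (closure D) →
      (∀ z ∈ D, z ∉ K → ψ z = 0) → ‖flux D a b d ψ‖ ≤ C * ∫ z, ‖ψ z‖ ∂(arcLength D) := by
  obtain ⟨C, hC0, ε₀, hε₀, hs⟩ := hs z₀ r c γ h K hK hKr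
  refine ⟨2 * C, by positivity, fun ψ hψ h0 => ?_⟩
  obtain ⟨M, hM0, hM⟩ := exists_bound_fderiv hD hb hψ
  obtain ⟨i1, i2⟩ := integrableOn_norm_fderiv_add hD hb hψ
  have hfin := isFiniteMeasure_restrict hb
  set I := ∫ z, ‖ψ z‖ ∂(arcLength D) with hI
  set L := (arcLength D).real univ with hL
  obtain ⟨ε₁, hε₁, hs1⟩ := h.exists_strip_integral_le hD hb hC hK hKr
    (f := fun _ => 1) continuousOn_const one_pos
  set Q := fun z => fderiv ℝ ψ z 1 • a z + fderiv ℝ ψ z Complex.I • b z + ψ z • d z with hQ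
  have iQ : IntegrableOn Q D := integrableOn_flux hD hb ia ib id hψ
  have hcut : ∀ ε z, ‖stripCutoff c γ ε z‖ ≤ 1 := fun ε z => by
    rw [stripCutoff, Real.norm_of_nonneg (cutoff_mem_Icc _).1]; exact (cutoff_mem_Icc _).2
  have hlim : Tendsto (fun ε : ℝ => ∫ z in D, stripCutoff c γ ε z • Q z) (𝓝[>] 0) (𝓝 0) := by
    have h1 := tendsto_integral_filter_of_dominated_convergence (μ := volume.restrict D)
      (F := fun (ε : ℝ) z => stripCutoff c γ ε z • Q z) (f := fun _ => 0) (l := 𝓝[>] (0 : ℝ))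
      (fun z => ‖Q z‖) (Eventually.of_forall fun ε =>
        (h.contDiff_stripCutoff ε).continuous.aestronglyMeasurable.smul iQ.aestronglyMeasurable)
      (Eventually.of_forall fun ε => Eventually.of_forall fun z => by
        rw [norm_smul]
        exact mul_le_of_le_one_left (norm_nonneg _) (hcut ε z)) iQ.norm ?_
    · simpa using h1
    filter_upwards [ae_restrict_mem hD.measurableSet] with z hz
    by_cases hzK : z ∈ K
    · have hρ : 0 < height c γ z := (h.mem_iff z (hKr hzK)).1 hz
      refine tendsto_const_nhds.congr' ?_
      filter_upwards [Ioo_mem_nhdsGT (half_pos hρ)] with ε hε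
      rw [stripCutoff, cutoff_of_ge ((le_div_iff₀ hε.1).2 (by linarith [hε.2])), zero_smul]
    · have : Q z = 0 := by
        simp [hQ, h0 z hz hzK, fderiv_eq_zero_of_forall_notMem hD hK h0 hz hzK]
      simp only [this, smul_zero]
      exact tendsto_const_nhds
  have main : ∀ δ > 0, ‖flux D a b d ψ‖ ≤ 2 * C * (I + δ * L) := by
    intro δ hδ
    obtain ⟨ε₂, hε₂, hs2⟩ := h.exists_strip_integral_le hD hb hC hK hKr hψ.continuousOn hδ
    have hlim2 : Tendsto (fun ε : ℝ => ‖∫ z in D, stripCutoff c γ ε z • Q z‖ +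
        C * (M * (2 * ε * (L + L)) + 2 * (I + δ * L))) (𝓝[>] 0)
        (𝓝 (0 + C * (M * (2 * 0 * (L + L)) + 2 * (I + δ * L)))) := by
      refine Tendsto.add (by simpa using hlim.norm) ?_
      have : Continuous fun ε : ℝ => C * (M * (2 * ε * (L + L)) + 2 * (I + δ * L)) := by fun_prop
      exact (this.tendsto 0).mono_left nhdsWithin_le_nhds
    have hle := ge_of_tendsto hlim2 (b := ‖flux D a b d ψ‖) (by
      have hpos : 0 < min ε₀ (min ε₁ ε₂) := by positivity
      filter_upwards [Ioo_mem_nhdsGT hpos] with ε hε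
      obtain ⟨hε0, hεlt⟩ := hε
      rw [lt_min_iff, lt_min_iff] at hεlt
      rw [flux_eq_strip h hD hb hl ia ib id hK hKr hψ h0 hε0]
      refine (norm_add_le _ _).trans (add_le_add le_rfl ((hs ε hε0 hεlt.1 ψ hψ h0).trans ?_))
      refine mul_le_mul_of_nonneg_left ?_ hC0
      set S := D ∩ {z | z ∈ K ∧ height c γ z < 2 * ε} with hS
      have hSm : MeasurableSet S := hD.measurableSet.inter (measurableSet_strip h hK ε)
      have hSD : S ⊆ D := inter_subset_left
      rw [integral_add (i1.mono_set hSD) ((i2.mono_set hSD).div_const ε)]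
      have k1 := hs1 ε hε0 hεlt.2.1
      have k2 := hs2 ε hε0 hεlt.2.2
      have k3 : ∫ z in S, ‖fderiv ℝ ψ z‖ ≤ ∫ z in S, M * ‖(1 : ℝ)‖ := by
        refine setIntegral_mono_on (i1.mono_set hSD) ?_ hSm fun z hz => by
          simpa using (hM z (hSD hz)).2
        exact (integrableOn_const (hs := ((measure_mono hSD).trans_lt
          hb.measure_lt_top).ne))
      rw [integral_const_mul] at k3
      rw [integral_div]
      refine add_le_add (k3.trans (mul_le_mul_of_nonneg_left (k1.trans (le_of_eq ?_)) hM0)) ?_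
      · simp only [norm_one, integral_const, smul_eq_mul, mul_one, one_mul, hL]
      · rw [div_le_iff₀ hε0]
        linarith)
    linarith
  have hlim3 : Tendsto (fun δ : ℝ => 2 * C * (I + δ * L)) (𝓝[>] 0) (𝓝 (2 * C * (I + 0 * L))) := by
    have : Continuous fun δ : ℝ => 2 * C * (I + δ * L) := by fun_prop
    exact (this.tendsto 0).mono_left nhdsWithin_le_nhds
  have := ge_of_tendsto hlim3 (b := ‖flux D a b d ψ‖)
    (eventually_mem_nhdsWithin.mono fun δ hδ => main δ hδ)
  linarith

/-- The flux is bounded by the `L¹` norm on the boundary. -/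
def HasFluxBound (D : Set ℂ) (a b d : ℂ → ℂ) : Prop :=
  ∃ C, 0 ≤ C ∧ ∀ φ : ℂ → ℝ, ContDiffOn ℝ 1 φ (closure D) →
    ‖flux D a b d φ‖ ≤ C * ∫ z, ‖φ z‖ ∂(arcLength D)

/-- Boundary bumps `χᵢ` are peeled off one after another, each costing a multiple of the `L¹` norm.
What remains is `∏ (1 - χᵢ) φ`, which vanishes near `∂D` and has zero flux. -/
theorem HasStripBound.hasFluxBound (hs : HasStripBound D a b) (hD : IsOpen D)
    (hb : Bornology.IsBounded D) (hC : HasC2Boundary D)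
    (hl : IsWeakLaplacian D a b d) (ia : IntegrableOn a D) (ib : IntegrableOn b D)
    (id : IntegrableOn d D) : HasFluxBound D a b d := by
  have hcl : IsCompact (closure D) := hb.isCompact_closure
  have hfc : IsCompact (frontier D) := hcl.of_isClosed_subset isClosed_frontier
    frontier_subset_closure
  have hmono : ∀ {f φ : ℂ → ℝ}, ContDiff ℝ 1 f → (∀ z, |f z| ≤ 1) →
      ContDiffOn ℝ 1 φ (closure D) →
      ∫ z, ‖f z * φ z‖ ∂(arcLength D) ≤ ∫ z, ‖φ z‖ ∂(arcLength D) := by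
    intro f φ hf hf1 hφ
    refine integral_mono (integrable_arcLength hD hb hC
      (hf.continuous.continuousOn.mul hφ.continuousOn)).norm
      (integrable_arcLength hD hb hC hφ.continuousOn).norm fun z => ?_
    beta_reduce
    rw [norm_mul]
    exact mul_le_of_le_one_left (norm_nonneg _) (hf1 z)
  -- The factor `f` is the product of the `1 - χᵢ` used so far. Being bounded by `1`, it does not
  -- increase the boundary norm when the next step is applied to the product.
  have key : ∃ f : ℂ → ℝ, ContDiff ℝ 1 f ∧ (∀ z, |f z| ≤ 1) ∧
      (∃ U, IsOpen U ∧ frontier D ∩ frontier D ⊆ U ∧ ∀ z ∈ U, f z = 0) ∧ ∃ C, 0 ≤ C ∧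
      ∀ φ : ℂ → ℝ, ContDiffOn ℝ 1 φ (closure D) →
        ‖flux D a b d φ - flux D a b d (fun z => f z * φ z)‖ ≤ C * ∫ z, ‖φ z‖ ∂(arcLength D) := by
    refine hfc.induction_on (p := fun s => ∃ f : ℂ → ℝ, ContDiff ℝ 1 f ∧ (∀ z, |f z| ≤ 1) ∧
      (∃ U, IsOpen U ∧ s ∩ frontier D ⊆ U ∧ ∀ z ∈ U, f z = 0) ∧ ∃ C, 0 ≤ C ∧
      ∀ φ : ℂ → ℝ, ContDiffOn ℝ 1 φ (closure D) →
        ‖flux D a b d φ - flux D a b d (fun z => f z * φ z)‖ ≤ C * ∫ z, ‖φ z‖ ∂(arcLength D))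
      ?_ ?_ ?_ ?_
    · exact ⟨fun _ => 1, contDiff_const, by simp, ⟨∅, isOpen_empty, by simp, by simp⟩, 0, le_rfl,
        by simp⟩
    · rintro s t hst ⟨f, h1, h2, ⟨U, h3, h4, h5⟩, h6⟩
      exact ⟨f, h1, h2, ⟨U, h3, (inter_subset_inter_left _ hst).trans h4, h5⟩, h6⟩
    · rintro s t ⟨f, hf, hf1, ⟨U, hU, hsU, hUf⟩, C, hC0, hfC⟩
        ⟨g, hg, hg1, ⟨V, hV, htV, hVg⟩, C', hC0', hgC⟩
      refine ⟨fun z => f z * g z, hf.mul hg, fun z => ?_, ⟨U ∪ V, hU.union hV, ?_, ?_⟩, C + C',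
        by positivity, fun φ hφ => ?_⟩
      · rw [abs_mul]; exact mul_le_one₀ (hf1 z) (abs_nonneg _) (hg1 z)
      · rw [union_inter_distrib_right]; exact union_subset_union hsU htV
      · rintro z (hz | hz)
        · simp [hUf z hz]
        · simp [hVg z hz]
      · have k1 := hgC φ hφ
        have k2 := (hfC (fun z => g z * φ z) (hg.contDiffOn.mul hφ)).trans
          (mul_le_mul_of_nonneg_left (hmono hg hg1 hφ) hC0)
        simp only [mul_assoc]
        calc _ = ‖(flux D a b d φ - flux D a b d fun z => g z * φ z) +
              (flux D a b d (fun z => g z * φ z) - flux D a b d fun z => f z * (g z * φ z))‖ := by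
              rw [sub_add_sub_cancel]
          _ ≤ _ := norm_add_le _ _
          _ ≤ _ := by linarith
    · intro z₀ hz₀
      obtain ⟨r, c, γ, h⟩ := hC.exists_chart hz₀
      have hr := h.pos
      let χ : ContDiffBump z₀ := ⟨r / 4, r / 2, by positivity, by linarith⟩
      have hχ : ContDiff ℝ 1 χ := χ.contDiff
      obtain ⟨C, hC0, hCb⟩ := exists_flux_bound_local h hD hb hC hl ia ib id hs
        (isCompact_closedBall z₀ (r / 2)) (Metric.closedBall_subset_ball (by linarith))
      refine ⟨Metric.ball z₀ (r / 4),
        mem_nhdsWithin_of_mem_nhds (Metric.ball_mem_nhds _ (by positivity)),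
        fun z => 1 - χ z, contDiff_const.sub hχ, fun z => ?_, ⟨Metric.ball z₀ (r / 4),
        Metric.isOpen_ball, inter_subset_left, fun z hz => ?_⟩, C, hC0, fun φ hφ => ?_⟩
      · rw [abs_of_nonneg (sub_nonneg.2 χ.le_one)]
        exact sub_le_self _ χ.nonneg
      · simp [χ.one_of_mem_closedBall (Metric.ball_subset_closedBall hz)]
      · have hχφ : ContDiffOn ℝ 1 (fun z => χ z * φ z) (closure D) := hχ.contDiffOn.mul hφ
        have hχφ' : ContDiffOn ℝ 1 (fun z => (1 - χ z) * φ z) (closure D) :=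
          (contDiff_const.sub hχ).contDiffOn.mul hφ
        have e := flux_add hD hb ia ib id hχφ hχφ'
        have e2 : (fun z => χ z * φ z + (1 - χ z) * φ z) = φ := by
          funext z; ring
        rw [e2] at e
        rw [e, add_sub_cancel_right]
        refine (hCb _ hχφ fun z _ hz => ?_).trans (mul_le_mul_of_nonneg_left
          (hmono hχ (fun z => ?_) hφ) hC0)
        · rw [χ.zero_of_le_dist (not_le.1 hz).le, zero_mul]
        · rw [abs_of_nonneg χ.nonneg]; exact χ.le_one
  obtain ⟨f, hf, -, ⟨U, hU, hfU, hUf⟩, C, hC0, hfC⟩ := key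
  refine ⟨C, hC0, fun φ hφ => ?_⟩
  have hz : flux D a b d (fun z => f z * φ z) = 0 := by
    refine hl.integral_eq_zero hD ia ib id ((hf.contDiffOn.mul hφ).mono subset_closure)
      (hcl.inter_right hU.isClosed_compl) (K := closure D ∩ Uᶜ) ?_ fun z hz hz' => ?_
    · intro z hz
      by_contra hzD
      exact hz.2 (hfU ⟨hD.frontier_eq ▸ ⟨hz.1, hzD⟩, hD.frontier_eq ▸ ⟨hz.1, hzD⟩⟩)
    · rw [hUf z (not_not.1 fun h => hz' ⟨subset_closure hz, h⟩), zero_mul]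
  have := hfC φ hφ
  rwa [hz, sub_zero] at this

theorem HasFluxBound.add (hD : IsOpen D) (hb : Bornology.IsBounded D) {a' b' d' : ℂ → ℂ}
    (h : HasFluxBound D a b d) (h' : HasFluxBound D a' b' d') (ia : IntegrableOn a D)
    (ib : IntegrableOn b D) (id : IntegrableOn d D) (ia' : IntegrableOn a' D)
    (ib' : IntegrableOn b' D) (id' : IntegrableOn d' D) :
    HasFluxBound D (fun z => a z + a' z) (fun z => b z + b' z) (fun z => d z + d' z) := by
  obtain ⟨C, hC, hb1⟩ := h
  obtain ⟨C', hC', hb2⟩ := h'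
  refine ⟨C + C', by positivity, fun φ hφ => ?_⟩
  have e : flux D (fun z => a z + a' z) (fun z => b z + b' z) (fun z => d z + d' z) φ =
      flux D a b d φ + flux D a' b' d' φ := by
    rw [flux, flux, flux, ← integral_add (integrableOn_flux hD hb ia ib id hφ)
      (integrableOn_flux hD hb ia' ib' id' hφ)]
    congr 1
    funext z
    module
  rw [e, add_mul]
  exact (norm_add_le _ _).trans (add_le_add (hb1 φ hφ) (hb2 φ hφ))

end

section

/-! ### Functionals bounded by the `L¹` norm have bounded densities -/

/-- Square integrable functions, not identified modulo null sets. -/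
def memLpTwo (μ : Measure ℂ) : Submodule ℝ (ℂ → ℝ) where
  carrier := {f | MemLp f 2 μ}
  add_mem' hf hg := hf.add hg
  zero_mem' := MemLp.zero
  smul_mem' k _ hf := hf.const_smul k

/-- Hahn–Banach with the sublinear functional `C ∫ |f|`. On honest functions `ℓ` need not be known
to depend only on almost everywhere classes; the bound itself implies it later. -/
theorem exists_linearMap_memLpTwo {μ : Measure ℂ} [IsFiniteMeasure μ] (V : Submodule ℝ (ℂ → ℝ))
    (ℓ : V →ₗ[ℝ] ℝ) {C : ℝ} (hC : 0 ≤ C) (hℓ : ∀ f : V, ℓ f ≤ C * ∫ z, ‖f.1 z‖ ∂μ) :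
    ∃ T : memLpTwo μ →ₗ[ℝ] ℝ, (∀ f (hf : f ∈ V) (hf2 : MemLp f 2 μ), T ⟨f, hf2⟩ = ℓ ⟨f, hf⟩) ∧
      ∀ f, T f ≤ C * ∫ z, ‖f.1 z‖ ∂μ := by
  let P : memLpTwo μ →ₗ.[ℝ] ℝ :=
    ⟨V.comap (memLpTwo μ).subtype, ℓ ∘ₗ (memLpTwo μ).subtype.submoduleComap V⟩
  have hhom : ∀ k : ℝ, 0 < k → ∀ f : memLpTwo μ,
      C * ∫ z, ‖(k • f).1 z‖ ∂μ = k * (C * ∫ z, ‖f.1 z‖ ∂μ) := by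
    intro k hk f
    have e : ∀ z, ‖(k • f).1 z‖ = k * ‖f.1 z‖ := fun z => by
      change ‖k * f.1 z‖ = _
      rw [norm_mul, Real.norm_of_nonneg hk.le]
    simp only [e]
    rw [integral_const_mul]
    ring
  have hadd : ∀ f g : memLpTwo μ, C * ∫ z, ‖(f + g).1 z‖ ∂μ ≤
      C * ∫ z, ‖f.1 z‖ ∂μ + C * ∫ z, ‖g.1 z‖ ∂μ := by
    intro f g
    have hf : Integrable f.1 μ := MemLp.integrable one_le_two f.2
    have hg : Integrable g.1 μ := MemLp.integrable one_le_two g.2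
    rw [← mul_add, ← integral_add hf.norm hg.norm]
    exact mul_le_mul_of_nonneg_left (integral_mono (hf.add hg).norm (hf.norm.add hg.norm)
      fun z => norm_add_le _ _) hC
  obtain ⟨T, hT1, hT2⟩ := exists_extension_of_le_sublinear P
    (fun f => C * ∫ z, ‖f.1 z‖ ∂μ) hhom hadd fun f => hℓ ⟨f.1.1, f.2⟩
  exact ⟨T, fun f hf hf2 => hT1 ⟨⟨f, hf2⟩, hf⟩, hT2⟩

/-- The `L¹` bound makes `T` well defined and continuous on `L²` of a finite measure, where Riesz
gives a density; testing with signed indicators bounds it by `C`. -/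
theorem exists_density {μ : Measure ℂ} [IsFiniteMeasure μ] (T : memLpTwo μ →ₗ[ℝ] ℝ) {C : ℝ}
    (hC : 0 ≤ C) (hT : ∀ f, T f ≤ C * ∫ z, ‖f.1 z‖ ∂μ) :
    ∃ g : ℂ → ℝ, AEStronglyMeasurable g μ ∧ (∀ᵐ z ∂μ, ‖g z‖ ≤ C) ∧
      ∀ f, T f = ∫ z, f.1 z * g z ∂μ := by
  have habs : ∀ f, |T f| ≤ C * ∫ z, ‖f.1 z‖ ∂μ := fun f => by
    refine abs_le.2 ⟨?_, hT f⟩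
    have h := hT (-f)
    rw [map_neg] at h
    have e : ∀ z, ‖(-f).1 z‖ = ‖f.1 z‖ := fun z => norm_neg _
    simp only [e] at h
    linarith
  have hcongr : ∀ f g : memLpTwo μ, f.1 =ᵐ[μ] g.1 → T f = T g := fun f g h => by
    have h1 := habs (f - g)
    have e : ∫ z, ‖(f - g).1 z‖ ∂μ = 0 := by
      rw [← integral_zero ℂ ℝ (μ := μ)]
      refine integral_congr_ae ?_
      filter_upwards [h] with z hz
      change ‖f.1 z - g.1 z‖ = 0
      rw [hz, sub_self, norm_zero]
    rw [e, mul_zero, map_sub] at h1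
    exact sub_eq_zero.1 (abs_nonpos_iff.1 h1)
  let T' : Lp ℝ 2 μ →ₗ[ℝ] ℝ :=
    { toFun := fun F => T ⟨F, Lp.memLp F⟩
      map_add' := fun F G => by
        rw [← map_add]
        exact hcongr _ _ (Lp.coeFn_add F G)
      map_smul' := fun k F => by
        rw [RingHom.id_apply, ← map_smul]
        exact hcongr _ _ (Lp.coeFn_smul k F) }
  have hbd : ∀ F : Lp ℝ 2 μ, ‖T' F‖ ≤ C * √(μ.real univ) * ‖F‖ := by
    intro F
    refine (habs ⟨F, Lp.memLp F⟩).trans ?_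
    rw [mul_assoc]
    refine mul_le_mul_of_nonneg_left ?_ hC
    have h1 := sq_integral_mul_le (μ := μ) (memLp_const (1 : ℝ)) (Lp.memLp F).norm
    have h2 : ∫ z, ‖F z‖ ^ 2 ∂μ = ‖F‖ ^ 2 := by
      rw [← real_inner_self_eq_norm_sq, L2.inner_def]
      simp [sq]
    simp only [one_mul, one_pow, integral_const, smul_eq_mul, mul_one] at h1
    rw [h2] at h1
    refine (Real.le_sqrt_of_sq_le h1).trans (le_of_eq ?_)
    rw [Real.sqrt_mul measureReal_nonneg, Real.sqrt_sq (norm_nonneg _)]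
  obtain ⟨g, hg⟩ : ∃ g : Lp ℝ 2 μ, ∀ F, T' F = ∫ z, F z * g z ∂μ := by
    refine ⟨(InnerProductSpace.toDual ℝ (Lp ℝ 2 μ)).symm (T'.mkContinuous _ hbd), fun F => ?_⟩
    have h1 := InnerProductSpace.toDual_symm_apply (𝕜 := ℝ) (x := F)
      (y := (T'.mkContinuous _ hbd : StrongDual ℝ (Lp ℝ 2 μ)))
    rw [LinearMap.mkContinuous_apply] at h1
    rw [← h1, L2.inner_def]
    refine integral_congr_ae (Eventually.of_forall fun z => ?_)
    simp
  have hTg : ∀ f : memLpTwo μ, T f = ∫ z, f.1 z * g z ∂μ := by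
    intro f
    have hf2 : MemLp f.1 2 μ := f.2
    have h1 := hg hf2.toLp
    have h2 : T' hf2.toLp = T f := hcongr _ _ hf2.coeFn_toLp
    rw [← h2, h1]
    refine integral_congr_ae ?_
    filter_upwards [hf2.coeFn_toLp] with z hz
    rw [hz]
  have hgi : Integrable g μ := (Lp.memLp g).integrable one_le_two
  have hset : ∀ s, MeasurableSet s → ∀ k : ℝ, |k| = 1 → k * ∫ z in s, g z ∂μ ≤ ∫ z in s, C ∂μ := by
    intro s hs k hk
    have hm : MemLp (s.indicator fun _ => k) 2 μ := (memLp_const k).indicator hs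
    have h1 := hT ⟨_, hm⟩
    rw [hTg] at h1
    have e1 : ∫ z, s.indicator (fun _ => k) z * g z ∂μ = k * ∫ z in s, g z ∂μ := by
      rw [← integral_const_mul, ← integral_indicator hs]
      congr 1
      funext z
      by_cases hz : z ∈ s <;> simp [hz]
    have e2 : C * ∫ z, ‖s.indicator (fun _ => k) z‖ ∂μ = ∫ z in s, C ∂μ := by
      rw [← integral_const_mul, ← integral_indicator hs]
      congr 1
      funext z
      by_cases hz : z ∈ s <;> simp [hz, hk]
    change ∫ z, s.indicator (fun _ => k) z * g z ∂μ ≤ C * ∫ z, ‖s.indicator (fun _ => k) z‖ ∂μ at h1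
    rwa [e1, e2] at h1
  refine ⟨g, (Lp.memLp g).aestronglyMeasurable, ?_, hTg⟩
  have h1 : g ≤ᵐ[μ] fun _ => C := ae_le_of_forall_setIntegral_le hgi (integrable_const C)
    fun s hs _ => by simpa using hset s hs 1 (by simp)
  have h2 : (fun z => -g z) ≤ᵐ[μ] fun _ => C :=
    ae_le_of_forall_setIntegral_le hgi.neg (integrable_const C)
      fun s hs _ => by simpa [integral_neg] using hset s hs (-1) (by simp)
  filter_upwards [h1, h2] with z k1 k2
  exact abs_le.2 ⟨by linarith, k1⟩

variable {D : Set ℂ} {a b d : ℂ → ℂ}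

/-- Real `C¹` functions on `D̄`. -/
def contDiffOnClosure (D : Set ℂ) : Submodule ℝ (ℂ → ℝ) where
  carrier := {φ | ContDiffOn ℝ 1 φ (closure D)}
  add_mem' hf hg := hf.add hg
  zero_mem' := contDiffOn_const
  smul_mem' _ _ hf := contDiffOn_const.smul hf

/-- The real and imaginary parts of the flux are represented separately. The densities are bounded,
hence in every `L^p` of the finite arc length. -/
theorem HasFluxBound.exists_hasNormalDeriv (h : HasFluxBound D a b d) (hD : IsOpen D)
    (hb : Bornology.IsBounded D) (hC : HasC2Boundary D) (ia : IntegrableOn a D)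
    (ib : IntegrableOn b D) (id : IntegrableOn d D) :
    ∃ g : ℂ → ℂ, (∀ p, MemLp g p (arcLength D)) ∧ HasNormalDeriv D a b d g := by
  have := isFiniteMeasure_arcLength hD hb hC
  obtain ⟨C, hC0, hfl⟩ := h
  have hmem : ∀ φ : ℂ → ℝ, ContDiffOn ℝ 1 φ (closure D) → MemLp φ 2 (arcLength D) := by
    intro φ hφ
    obtain ⟨M, hM⟩ := hb.isCompact_closure.exists_bound_of_continuousOn hφ.continuousOn
    refine MemLp.of_bound (integrable_arcLength hD hb hC hφ.continuousOn).aestronglyMeasurable M ?_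
    filter_upwards [ae_restrict_mem isClosed_frontier.measurableSet] with z hz
      using hM z (frontier_subset_closure hz)
  have key : ∀ L : ℂ →L[ℝ] ℝ, (∀ w, L w ≤ ‖w‖) → ∃ g : ℂ → ℝ,
      AEStronglyMeasurable g (arcLength D) ∧ (∀ᵐ z ∂(arcLength D), ‖g z‖ ≤ C) ∧
      ∀ φ : ℂ → ℝ, ContDiffOn ℝ 1 φ (closure D) →
        L (flux D a b d φ) = ∫ z, φ z * g z ∂(arcLength D) := by
    intro L hL
    let ℓ : contDiffOnClosure D →ₗ[ℝ] ℝ :=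
      { toFun := fun φ => L (flux D a b d φ.1)
        map_add' := fun φ ψ => by
          rw [← map_add]
          exact congrArg L (flux_add hD hb ia ib id φ.2 ψ.2)
        map_smul' := fun k φ => by
          rw [RingHom.id_apply, ← map_smul]
          exact congrArg L (flux_smul k (φ := φ.1)) }
    obtain ⟨T, hT1, hT2⟩ := exists_linearMap_memLpTwo (μ := arcLength D) (contDiffOnClosure D) ℓ
      hC0 fun φ => (hL _).trans (hfl φ.1 φ.2)
    obtain ⟨g, hg1, hg2, hg3⟩ := exists_density T hC0 hT2
    refine ⟨g, hg1, hg2, fun φ hφ => ?_⟩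
    rw [← hg3 ⟨φ, hmem φ hφ⟩, hT1 φ hφ]
    rfl
  obtain ⟨g₁, m₁, b₁, e₁⟩ := key Complex.reCLM fun w => (le_abs_self _).trans
    (Complex.abs_re_le_norm w)
  obtain ⟨g₂, m₂, b₂, e₂⟩ := key Complex.imCLM fun w => (le_abs_self _).trans
    (Complex.abs_im_le_norm w)
  have hm : AEStronglyMeasurable (fun z => (g₁ z : ℂ) + g₂ z * Complex.I) (arcLength D) :=
    (Complex.continuous_ofReal.comp_aestronglyMeasurable m₁).add
      ((Complex.continuous_ofReal.comp_aestronglyMeasurable m₂).mul_const _)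
  have hbd : ∀ᵐ z ∂(arcLength D), ‖(g₁ z : ℂ) + g₂ z * Complex.I‖ ≤ C + C := by
    filter_upwards [b₁, b₂] with z h1 h2
    refine (norm_add_le _ _).trans (add_le_add ?_ ?_)
    · rwa [Complex.norm_real]
    · rwa [norm_mul, Complex.norm_I, mul_one, Complex.norm_real]
  refine ⟨fun z => g₁ z + g₂ z * Complex.I, fun p => MemLp.of_bound hm _ hbd, fun φ hφ => ?_⟩
  have hi : Integrable (fun z => φ z • ((g₁ z : ℂ) + g₂ z * Complex.I)) (arcLength D) :=
    memLp_one_iff_integrable.1 ((MemLp.of_bound (p := 2) hm _ hbd).smul (hmem φ hφ))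
  change flux D a b d φ = _
  apply Complex.ext
  · have h1 := Complex.reCLM.integral_comp_comm hi
    rw [Complex.reCLM_apply] at h1
    rw [← h1, ← Complex.reCLM_apply, e₁ φ hφ]
    simp
  · have h1 := Complex.imCLM.integral_comp_comm hi
    rw [Complex.imCLM_apply] at h1
    rw [← h1, ← Complex.imCLM_apply, e₂ φ hφ]
    simp

end

section

variable {D : Set ℂ}

/-! ### Smooth functions as Sobolev functions -/

theorem isWeakLaplacian_of_contDiffOn (hD : IsOpen D) {u : ℂ → ℂ} (hu : ContDiffOn ℝ 2 u D) :
    IsWeakLaplacian D (fun z => fderiv ℝ u z 1) (fun z => fderiv ℝ u z Complex.I)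
      (Laplacian.laplacian u) := fun _ hφ =>
  integral_fderiv_add_laplacian_eq_zero hD hφ.contDiff_one hφ.compact hφ.support hu

theorem isWeakDeriv_of_contDiffOn (hD : IsOpen D) {u : ℂ → ℂ} (hu : ContDiffOn ℝ 1 u D) (e : ℂ) :
    IsWeakDeriv D e u (fun z => fderiv ℝ u z e) := fun _ hφ =>
  setIntegral_fderiv_smul_eq_neg hD hφ.contDiff_one hφ.compact hφ.support hu e

theorem memLp_fderiv_of_contDiffOn (hD : IsOpen D) (hb : Bornology.IsBounded D) {u : ℂ → ℂ}
    (hu : ContDiffOn ℝ 1 u (closure D)) (e : ℂ) :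
    MemLp (fun z => fderiv ℝ u z e) 2 (volume.restrict D) := by
  obtain ⟨C, -, hC⟩ := exists_bound_fderiv hD hb hu
  exact memLp_of_continuousOn_of_bound hD hb
    (((hu.mono subset_closure).continuousOn_fderiv_of_isOpen hD le_rfl).clm_apply
      continuousOn_const) (fun z hz => (fderiv ℝ u z).le_of_opNorm_le (hC z hz).2 e) 2

theorem isH1_of_contDiffOn (hD : IsOpen D) (hb : Bornology.IsBounded D) {u : ℂ → ℂ}
    (hu : ContDiffOn ℝ 1 u (closure D)) :
    IsH1 D u (fun z => fderiv ℝ u z 1) (fun z => fderiv ℝ u z Complex.I) := by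
  obtain ⟨C, -, hC⟩ := exists_bound_fderiv hD hb hu
  exact ⟨memLp_of_continuousOn_of_bound hD hb (hu.continuousOn.mono subset_closure)
    (fun z hz => (hC z hz).1) 2, memLp_fderiv_of_contDiffOn hD hb hu _,
    memLp_fderiv_of_contDiffOn hD hb hu _,
    isWeakDeriv_of_contDiffOn hD (hu.mono subset_closure) _,
    isWeakDeriv_of_contDiffOn hD (hu.mono subset_closure) _⟩

theorem IsWeakDeriv.ae_eq (hD : IsOpen D) {e : ℂ} {u g g' : ℂ → ℂ}
    (h : IsWeakDeriv D e u g) (h' : IsWeakDeriv D e u g') (hg : IntegrableOn g D)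
    (hg' : IntegrableOn g' D) : g =ᵐ[volume.restrict D] g' := by
  have key := hD.ae_eq_zero_of_integral_contDiff_smul_eq_zero (μ := volume)
    (hg.sub hg').locallyIntegrableOn (fun φ h1 h2 h3 => ?_)
  · refine (ae_restrict_iff' hD.measurableSet).2 (key.mono fun z hz hzD => ?_)
    exact sub_eq_zero.1 (hz hzD)
  · have hφ : IsTestFunction D φ := ⟨h1, h2, h3⟩
    have hint : ∀ {f : ℂ → ℂ}, IntegrableOn f D → IntegrableOn (fun z => φ z • f z) D := by
      intro f hf
      obtain ⟨B, hB⟩ := h2.exists_bound_of_continuous h1.continuous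
      exact integrableOn_smul_of_bound hD h1.continuous.continuousOn (fun z _ => hB z) hf
    rw [← setIntegral_eq_integral_of_forall_compl_eq_zero (s := D) fun z hz => by
      rw [image_eq_zero_of_notMem_tsupport fun h => hz (h3 h), zero_smul]]
    simp only [Pi.sub_apply, smul_sub]
    rw [integral_sub (hint hg) (hint hg'), sub_eq_zero]
    exact neg_injective ((h φ hφ).symm.trans (h' φ hφ))

/-- A `C¹(D̄)` function vanishing on `∂D` belongs to `H₀¹(D)`. -/
theorem isH10_of_eq_zero_on_frontier (hD : IsOpen D) (hb : Bornology.IsBounded D) {G : ℂ → ℂ}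
    (hG : ContDiffOn ℝ 1 G (closure D)) (h0 : ∀ z ∈ frontier D, G z = 0) :
    IsH10 D G (fun z => fderiv ℝ G z 1) (fun z => fderiv ℝ G z Complex.I) := by
  have hfin := isFiniteMeasure_restrict hb
  obtain ⟨C, hC0, hC⟩ := exists_bound_fderiv hD hb hG
  obtain ⟨M, hM0, hM⟩ := exists_norm_deriv_cutoff_le
  have hcl : IsCompact (closure D) := hb.isCompact_closure
  have hGD : ContDiffOn ℝ 1 G D := hG.mono subset_closure
  set ε : ℕ → ℝ := fun k => 1 / ((k : ℝ) + 1) with hε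
  have hε0 : ∀ k, 0 < ε k := fun k => by positivity
  have hε1 : ∀ k, ε k ≤ 1 := fun k => by
    rw [hε]
    exact div_le_one_of_le₀ (by linarith [(Nat.cast_nonneg k : (0 : ℝ) ≤ k)]) (by positivity)
  have hεlim : Tendsto ε atTop (𝓝 0) := tendsto_one_div_add_atTop_nhds_zero_nat
  -- `s k` vanishes where `|G| ≤ ε k`, in particular near `∂D`, and equals `1` where `|G|² ≥ 2 (ε
  -- k)²`. Cutting by the values of `G` makes the support compact in `D`.
  set s : ℕ → ℂ → ℝ := fun k z => 1 - cutoff (‖G z‖ ^ 2 / ε k ^ 2) with hs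
  have hsD : ∀ k, ContDiffOn ℝ 1 (s k) D := fun k =>
    contDiffOn_const.sub ((contDiff_cutoff (m := 1)).comp_contDiffOn
      ((hGD.norm_sq ℝ).div_const _))
  have hs1 : ∀ k z, ‖s k z‖ ≤ 1 := fun k z => by
    have := cutoff_mem_Icc (‖G z‖ ^ 2 / ε k ^ 2)
    rw [Real.norm_of_nonneg (sub_nonneg.2 this.2)]
    exact sub_le_self _ this.1
  have happrox : ∀ k, ∃ φ : ℂ → ℂ, IsTestFunction D φ ∧ (∀ z ∈ D, ‖φ z - s k z • G z‖ ≤ ε k) ∧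
      ∀ z ∈ D, ‖fderiv ℝ φ z - fderiv ℝ (fun z => s k z • G z) z‖ ≤ ε k := by
    intro k
    have hK : IsCompact (closure D ∩ (fun z => ‖G z‖ ^ 2) ⁻¹' Ici (ε k ^ 2)) :=
      hcl.of_isClosed_subset ((hG.continuousOn.norm.pow 2).preimage_isClosed_of_isClosed
        isClosed_closure isClosed_Ici) inter_subset_left
    obtain ⟨φ', h1, h2, h3, h4⟩ := exists_contDiff_eqOn hD ((hsD k).smul hGD) hK
      (fun z hz => by
        by_contra hzD
        have := h0 z (hD.frontier_eq ▸ ⟨hz.1, hzD⟩)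
        have h5 : ε k ^ 2 ≤ ‖G z‖ ^ 2 := hz.2
        rw [this, norm_zero] at h5
        nlinarith [hε0 k]) (fun z hz hz' => by
        have : ‖G z‖ ^ 2 ≤ ε k ^ 2 := le_of_not_ge fun h => hz' ⟨subset_closure hz, h⟩
        change (1 - cutoff (‖G z‖ ^ 2 / ε k ^ 2)) • G z = 0
        rw [cutoff_of_le (div_le_one_of_le₀ this (by positivity)), sub_self, zero_smul])
    obtain ⟨φ, hφ, a1, a2⟩ := exists_isTestFunction_near hD h1 h2 h3 (hε0 k)
    refine ⟨φ, hφ, fun z hz => ?_, fun z hz => ?_⟩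
    · have := a1 z
      rwa [h4 hz] at this
    · have := a2 z
      rwa [(h4.eventuallyEq_of_mem (hD.mem_nhds hz)).fderiv_eq] at this
  choose φ hφ hφ0 hφ1 using happrox
  have hlarge : ∀ z, G z ≠ 0 → ∀ᶠ k in atTop, 2 ≤ ‖G z‖ ^ 2 / ε k ^ 2 := by
    intro z hz
    have h1 : Tendsto (fun k => 2 * ε k ^ 2) atTop (𝓝 (2 * 0 ^ 2)) :=
      (hεlim.pow 2).const_mul 2
    have h2 : 2 * (0 : ℝ) ^ 2 < ‖G z‖ ^ 2 := by
      have := norm_pos_iff.2 hz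
      simp only [ne_eq, OfNat.ofNat_ne_zero, not_false_eq_true, zero_pow, mul_zero]
      positivity
    filter_upwards [h1.eventually (gt_mem_nhds h2)] with k hk
    rw [le_div_iff₀ (by have := hε0 k; positivity)]
    exact hk.le
  have hder : ∀ k, ∀ z ∈ D, ∀ e : ℂ, fderiv ℝ (fun z => s k z • G z) z e =
      s k z • fderiv ℝ G z e + (-(deriv cutoff (‖G z‖ ^ 2 / ε k ^ 2) *
        (2 * inner ℝ (G z) (fderiv ℝ G z e) / ε k ^ 2))) • G z := by
    intro k z hz e
    have hGd := ((hGD.contDiffAt (hD.mem_nhds hz)).differentiableAt one_ne_zero).hasFDerivAt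
    have h1 := hGd.norm_sq.mul_const (ε k ^ 2)⁻¹
    have h2 : HasDerivAt cutoff (deriv cutoff (‖G z‖ ^ 2 / ε k ^ 2)) (‖G z‖ ^ 2 / ε k ^ 2) :=
      ((contDiff_cutoff (m := 1)).differentiable (by simp) _).hasDerivAt
    have h3 := ((h2.comp_hasFDerivAt z (f := fun z => ‖G z‖ ^ 2 * (ε k ^ 2)⁻¹) h1).const_sub
      1).smul hGd
    have h4 := HasFDerivAt.fderiv (f := fun z => s k z • G z) h3
    rw [h4]
    simp [s, Function.comp_apply, div_eq_mul_inv]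
    left
    left
    ring
  -- The pointwise limit of the gradients, which is `0` on the zero set of `G`. That it equals `∇G`
  -- almost everywhere follows at the end from the uniqueness of weak derivatives.
  set X : ℂ → ℂ → ℂ := fun e z => if G z = 0 then 0 else fderiv ℝ G z e with hX
  have hXle : ∀ e : ℂ, ‖e‖ = 1 → ∀ z ∈ D, ‖X e z‖ ≤ C := by
    intro e he z hz
    simp only [hX]
    split_ifs
    · simpa using hC0
    · have := (fderiv ℝ G z).le_of_opNorm_le (hC z hz).2 e
      rwa [he, mul_one] at this
  have hlim : ∀ e : ℂ, ‖e‖ = 1 → ∀ z ∈ D,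
      Tendsto (fun k => fderiv ℝ (φ k) z e) atTop (𝓝 (X e z)) := by
    intro e he z hz
    have h1 : Tendsto (fun k => fderiv ℝ (φ k) z e - fderiv ℝ (fun z => s k z • G z) z e) atTop
        (𝓝 0) := by
      refine squeeze_zero_norm (fun k => ?_) hεlim
      have := (fderiv ℝ (φ k) z - fderiv ℝ (fun z => s k z • G z) z).le_of_opNorm_le
        (hφ1 k z hz) e
      rwa [he, mul_one] at this
    have h2 : Tendsto (fun k => fderiv ℝ (fun z => s k z • G z) z e) atTop (𝓝 (X e z)) := by
      simp only [hX]
      split_ifs with hz0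
      · refine tendsto_const_nhds.congr fun k => ?_
        rw [hder k z hz, hz0]
        simp [hs, hz0, cutoff_of_le]
      · refine tendsto_const_nhds.congr' ?_
        filter_upwards [hlarge z hz0] with k hk
        rw [hder k z hz, deriv_cutoff_of_ge hk]
        simp [hs, cutoff_of_ge hk]
    simpa using h1.add h2
  have hbd : ∀ e : ℂ, ‖e‖ = 1 → ∀ k, ∀ z ∈ D, ‖fderiv ℝ (φ k) z e‖ ≤ 1 + (C + 4 * M * C) := by
    intro e he k z hz
    have h1 := (fderiv ℝ (φ k) z - fderiv ℝ (fun z => s k z • G z) z).le_of_opNorm_le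
      (hφ1 k z hz) e
    rw [he, mul_one] at h1
    have h2 := (fderiv ℝ G z).le_of_opNorm_le (hC z hz).2 e
    rw [he, mul_one] at h2
    -- The derivative of the cutoff brings in `|G|² / ε²`, which is at most `2` wherever that
    -- derivative does not vanish.
    have h3 : ‖(-(deriv cutoff (‖G z‖ ^ 2 / ε k ^ 2) *
        (2 * inner ℝ (G z) (fderiv ℝ G z e) / ε k ^ 2))) • G z‖ ≤ 4 * M * C := by
      by_cases ht : 2 ≤ ‖G z‖ ^ 2 / ε k ^ 2
      · rw [deriv_cutoff_of_ge ht]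
        simp
        positivity
      · have hεk := hε0 k
        rw [norm_smul, norm_neg, norm_mul, norm_div, norm_mul, Real.norm_two,
          Real.norm_of_nonneg (by positivity : 0 ≤ ε k ^ 2)]
        calc _ ≤ M * (2 * (‖G z‖ * C) / ε k ^ 2) * ‖G z‖ := by
              gcongr
              · exact hM _
              · exact (norm_inner_le_norm _ _).trans (by gcongr)
          _ = 2 * M * C * (‖G z‖ ^ 2 / ε k ^ 2) := by ring
          _ ≤ 2 * M * C * 2 := by gcongr; exact (not_le.1 ht).le
          _ = _ := by ring
    have h4 : ‖fderiv ℝ (fun z => s k z • G z) z e‖ ≤ C + 4 * M * C := by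
      rw [hder k z hz]
      refine (norm_add_le _ _).trans (add_le_add ?_ h3)
      rw [norm_smul]
      exact (mul_le_of_le_one_left (norm_nonneg _) (hs1 k z)).trans h2
    calc ‖fderiv ℝ (φ k) z e‖ = ‖(fderiv ℝ (φ k) z e - fderiv ℝ (fun z => s k z • G z) z e) +
          fderiv ℝ (fun z => s k z • G z) z e‖ := by rw [sub_add_cancel]
      _ ≤ _ := norm_add_le _ _
      _ ≤ _ := add_le_add (h1.trans (hε1 k)) h4
  have hφm : ∀ k (e : ℂ), AEStronglyMeasurable (fun z => fderiv ℝ (φ k) z e)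
      (volume.restrict D) := fun k e =>
    (((hφ k).contDiff_one.continuous_fderiv one_ne_zero).clm_apply
      continuous_const).aestronglyMeasurable
  have hXm : ∀ e : ℂ, ‖e‖ = 1 → MemLp (X e) 2 (volume.restrict D) := fun e he =>
    MemLp.of_bound (aestronglyMeasurable_of_tendsto_ae atTop (fun k => hφm k e)
      ((ae_restrict_mem hD.measurableSet).mono (hlim e he))) C
      ((ae_restrict_mem hD.measurableSet).mono (hXle e he))
  have hconv : ∀ e : ℂ, ‖e‖ = 1 → Tendsto (fun k => eLpNorm (fun z => fderiv ℝ (φ k) z e - X e z) 2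
      (volume.restrict D)) atTop (𝓝 0) := by
    intro e he
    refine tendsto_eLpNorm_two_of_dominated (fun k => (hφm k e).sub (hXm e he).aestronglyMeasurable)
      (memLp_const (1 + (C + 4 * M * C) + C)) (fun k => ?_) ?_
    · filter_upwards [ae_restrict_mem hD.measurableSet] with z hz
      exact (norm_sub_le _ _).trans (add_le_add (hbd e he k z hz) (hXle e he z hz))
    · filter_upwards [ae_restrict_mem hD.measurableSet] with z hz
      simpa using (hlim e he z hz).sub_const (X e z)
  have hH1 := isH1_of_contDiffOn hD hb hG
  have hconv0 : Tendsto (fun k => eLpNorm (fun z => φ k z - G z) 2 (volume.restrict D)) atTop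
      (𝓝 0) := by
    refine tendsto_eLpNorm_two_of_dominated (fun k =>
      (hφ k).smooth.continuous.aestronglyMeasurable.sub hH1.memLp.aestronglyMeasurable)
      (memLp_const (1 + (C + C))) (fun k => ?_) ?_
    · filter_upwards [ae_restrict_mem hD.measurableSet] with z hz
      have e1 : φ k z - G z = (φ k z - s k z • G z) + (s k z • G z - G z) := by abel
      rw [e1]
      refine (norm_add_le _ _).trans (add_le_add ((hφ0 k z hz).trans (hε1 k)) ?_)
      refine (norm_sub_le _ _).trans (add_le_add ?_ (hC z hz).1)
      rw [norm_smul]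
      exact (mul_le_of_le_one_left (norm_nonneg _) (hs1 k z)).trans (hC z hz).1
    · filter_upwards [ae_restrict_mem hD.measurableSet] with z hz
      have h1 : Tendsto (fun k => φ k z - s k z • G z) atTop (𝓝 0) :=
        squeeze_zero_norm (fun k => hφ0 k z hz) hεlim
      have h2 : Tendsto (fun k => s k z • G z - G z) atTop (𝓝 0) := by
        refine tendsto_const_nhds.congr' ?_
        by_cases hz0 : G z = 0
        · exact Eventually.of_forall fun k => by simp [hz0]
        · filter_upwards [hlarge z hz0] with k hk
          simp [hs, cutoff_of_ge hk]
      simpa using h1.add h2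
  have hH10 := isH10_of_approx hD hb hH1.memLp (hXm 1 (by simp)) (hXm Complex.I (by simp)) hφ
    hconv0 (hconv 1 (by simp)) (hconv Complex.I (by simp))
  exact hH10.congr EventuallyEq.rfl
    (hH10.isH1.deriv_x.ae_eq hD hH1.deriv_x (hH10.isH1.memLp_x.integrable one_le_two)
      (hH1.memLp_x.integrable one_le_two))
    (hH10.isH1.deriv_y.ae_eq hD hH1.deriv_y (hH10.isH1.memLp_y.integrable one_le_two)
      (hH1.memLp_y.integrable one_le_two))

end

section

variable {D : Set ℂ} {n : ℕ}

/-! ### Existence of the Dirichlet-to-Neumann image -/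

theorem exists_ae_bound_of_memLp_top {μ : Measure ℂ} {f : ℂ → ℂ} (h : MemLp f ⊤ μ) :
    ∃ C : ℝ, ∀ᵐ z ∂μ, ‖f z‖ ≤ C := by
  refine ⟨(eLpNormEssSup f μ).toReal, ?_⟩
  have h2 : eLpNormEssSup f μ ≠ ⊤ := by
    rw [← eLpNorm_exponent_top]
    exact h.eLpNorm_ne_top
  filter_upwards [ae_le_eLpNormEssSup (f := f) (μ := μ)] with z hz
  rw [← toReal_enorm]
  exact ENNReal.toReal_mono h2 hz

theorem IsWeakDeriv.add (hD : IsOpen D) (hb : Bornology.IsBounded D) {e : ℂ} {u g u' g' : ℂ → ℂ}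
    (h : IsWeakDeriv D e u g) (h' : IsWeakDeriv D e u' g') (iu : IntegrableOn u D)
    (ig : IntegrableOn g D) (iu' : IntegrableOn u' D) (ig' : IntegrableOn g' D) :
    IsWeakDeriv D e (fun z => u z + u' z) (fun z => g z + g' z) := by
  intro φ hφ
  have hint : ∀ {f : ℂ → ℂ}, IntegrableOn f D → IntegrableOn (fun z => φ z • f z) D := by
    intro f hf
    obtain ⟨B, hB⟩ := hφ.compact.exists_bound_of_continuous hφ.smooth.continuous
    exact integrableOn_smul_of_bound hD hφ.smooth.continuous.continuousOn (fun z _ => hB z) hf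
  have hc := hφ.contDiff_one.contDiffOn (s := closure D)
  simp only [smul_add]
  rw [integral_add (integrableOn_fderiv_smul hD hb hc iu e)
    (integrableOn_fderiv_smul hD hb hc iu' e), integral_add (hint ig) (hint ig'), h φ hφ, h' φ hφ,
    neg_add]

theorem IsH1.add (hD : IsOpen D) (hb : Bornology.IsBounded D) {u ux uy w wx wy : ℂ → ℂ}
    (hu : IsH1 D u ux uy) (hw : IsH1 D w wx wy) :
    IsH1 D (fun z => u z + w z) (fun z => ux z + wx z) (fun z => uy z + wy z) := by
  have := isFiniteMeasure_restrict hb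
  exact ⟨hu.memLp.add hw.memLp, hu.memLp_x.add hw.memLp_x, hu.memLp_y.add hw.memLp_y,
    hu.deriv_x.add hD hb hw.deriv_x (hu.memLp.integrable one_le_two)
      (hu.memLp_x.integrable one_le_two) (hw.memLp.integrable one_le_two)
      (hw.memLp_x.integrable one_le_two),
    hu.deriv_y.add hD hb hw.deriv_y (hu.memLp.integrable one_le_two)
      (hu.memLp_y.integrable one_le_two) (hw.memLp.integrable one_le_two)
      (hw.memLp_y.integrable one_le_two)⟩

theorem IsWeakLaplacian.add (hD : IsOpen D) (hb : Bornology.IsBounded D)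
    {a b d a' b' d' : ℂ → ℂ} (h : IsWeakLaplacian D a b d) (h' : IsWeakLaplacian D a' b' d')
    (ia : IntegrableOn a D) (ib : IntegrableOn b D) (id : IntegrableOn d D)
    (ia' : IntegrableOn a' D) (ib' : IntegrableOn b' D) (id' : IntegrableOn d' D) :
    IsWeakLaplacian D (fun z => a z + a' z) (fun z => b z + b' z) (fun z => d z + d' z) := by
  intro φ hφ
  have hc := hφ.contDiff_one.contDiffOn (s := closure D)
  have e := integral_add (integrableOn_flux hD hb ia ib id hc)
    (integrableOn_flux hD hb ia' ib' id' hc)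
  rw [h φ hφ, h' φ hφ, add_zero] at e
  rw [← e]
  congr 1
  funext z
  module

/-- The smooth `u` solves the equation of another potential `v'` and is corrected by `w` in `H₀¹`
with `-Δw + vw = v'u - vu`, so that `ψ = u + w` solves the equation of `v`. The flux of `u` is
bounded since `∇u` is, that of `w` by boundary decay. -/
theorem exists_isDtN (hD : IsOpen D) (hb : Bornology.IsBounded D) (hC : HasC2Boundary D)
    (hf : (frontier D).Nonempty) {v v' u : ℂ → Matrix (Fin n) (Fin n) ℂ} (hv : IsCk 1 D v)
    (hv' : IsCk 1 D v') (hdir : ZeroNotDirichletEigenvalue D v) (hu : IsCk 2 D u)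
    (heq : ∀ z ∈ D, matLaplacian u z = v' z * u z) : ∃ g, IsDtN D v u g := by
  have := isFiniteMeasure_restrict hb
  have hu1 : ∀ i j, ContDiffOn ℝ 1 (fun z => u z i j) (closure D) := fun i j =>
    (hu i j).of_le one_le_two
  have hvt := fun i j => hv.memLp_top hD hb i j ⊤
  have hvt' := fun i j => hv'.memLp_top hD hb i j ⊤
  have hut := fun i j => hu.memLp_top hD hb i j ⊤
  set F : ℂ → Matrix (Fin n) (Fin n) ℂ := fun z => v' z * u z - v z * u z with hF
  have hFt : ∀ i j, MemLp (fun z => F z i j) ⊤ (volume.restrict D) := fun i j =>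
    (memLp_mul_apply hvt' hut i j).sub (memLp_mul_apply hvt hut i j)
  obtain ⟨w, wx, wy, hw⟩ := exists_isH10_solution hD hb hvt hdir (F := F)
    fun i j => (hFt i j).mono_exponent le_top
  have hh2 : ∀ i j, MemLp (fun z => (v z * w z) i j - F z i j) 2 (volume.restrict D) := fun i j =>
    (memLp_mul_apply hvt (fun i j => (hw i j).1.isH1.memLp) i j).sub
      ((hFt i j).mono_exponent le_top)
  -- Stampacchia's bound makes `w` bounded, hence `Δw` too, as the barrier argument requires.
  have hwt : ∀ i j, MemLp (fun z => w z i j) ⊤ (volume.restrict D) := fun i j => by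
    obtain ⟨C, -, h⟩ := exists_norm_le_sqrt_integral D hD hb
    exact MemLp.of_bound (hw i j).1.isH1.memLp.aestronglyMeasurable _
      (h _ _ _ _ (hw i j).1 (hh2 i j) (hw i j).2)
  have hht : ∀ i j, MemLp (fun z => (v z * w z) i j - F z i j) ⊤ (volume.restrict D) := fun i j =>
    (memLp_mul_apply hvt hwt i j).sub (hFt i j)
  have hH1 := fun i j => isH1_of_contDiffOn hD hb (hu1 i j)
  have hlu : ∀ i j, IsWeakLaplacian D (fun z => fderiv ℝ (fun z => u z i j) z 1)
      (fun z => fderiv ℝ (fun z => u z i j) z Complex.I) (fun z => (v' z * u z) i j) := fun i j =>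
    (isWeakLaplacian_of_contDiffOn hD ((hu i j).mono subset_closure)).congr (by
      filter_upwards [ae_restrict_mem hD.measurableSet] with z hz
      rw [← heq z hz]
      rfl)
  have ix := fun i j => (hH1 i j).memLp_x.integrable one_le_two
  have iy := fun i j => (hH1 i j).memLp_y.integrable one_le_two
  have id := fun i j => (memLp_mul_apply hvt' hut i j).integrable le_top
  have iwx := fun i j => (hw i j).1.isH1.memLp_x.integrable one_le_two
  have iwy := fun i j => (hw i j).1.isH1.memLp_y.integrable one_le_two
  have iwd := fun i j => (hht i j).integrable le_top
  have hsum : ∀ i j, (fun z => (v' z * u z) i j + ((v z * w z) i j - F z i j)) =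
      fun z => (v z * (u z + w z)) i j := fun i j => by
    funext z
    have e : F z i j = (v' z * u z) i j - (v z * u z) i j := rfl
    rw [e, mul_add, Matrix.add_apply]
    ring
  have hflux : ∀ i j, HasFluxBound D (fun z => fderiv ℝ (fun z => u z i j) z 1 + wx z i j)
      (fun z => fderiv ℝ (fun z => u z i j) z Complex.I + wy z i j)
      (fun z => (v z * (u z + w z)) i j) := by
    intro i j
    rw [← hsum]
    obtain ⟨M, -, hM⟩ := exists_bound_fderiv hD hb (hu1 i j)
    have hs1 : HasStripBound D (fun z => fderiv ℝ (fun z => u z i j) z 1)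
        (fun z => fderiv ℝ (fun z => u z i j) z Complex.I) :=
      hasStripBound_of_bound hD hb (M := M)
        (fun z hz => by simpa using (fderiv ℝ (fun z => u z i j) z).le_of_opNorm_le (hM z hz).2 1)
        (fun z hz => by
          simpa using (fderiv ℝ (fun z => u z i j) z).le_of_opNorm_le (hM z hz).2 Complex.I)
    obtain ⟨H, hH⟩ := exists_ae_bound_of_memLp_top (hht i j)
    obtain ⟨C₀, hC₀, hle⟩ := (hw i j).1.exists_le_infDist hD hb hC hf (hh2 i j) (hw i j).2 hH
    have hs2 := (hw i j).1.hasStripBound hD hb hC₀ hle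
    exact (hs1.hasFluxBound hD hb hC (hlu i j) (ix i j) (iy i j) (id i j)).add hD hb
      (hs2.hasFluxBound hD hb hC (hw i j).2 (iwx i j) (iwy i j) (iwd i j)) (ix i j) (iy i j)
      (id i j) (iwx i j) (iwy i j) (iwd i j)
  have hg := fun i j => (hflux i j).exists_hasNormalDeriv hD hb hC ((ix i j).add (iwx i j))
    ((iy i j).add (iwy i j)) (by
      rw [← hsum]
      exact (id i j).add (iwd i j))
  choose g hg1 hg2 using hg
  refine ⟨fun z => Matrix.of fun i j => g i j z, fun i j p _ => hg1 i j p,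
    fun z => u z + w z,
    fun z => Matrix.of fun i j => fderiv ℝ (fun z => u z i j) z 1 + wx z i j,
    fun z => Matrix.of fun i j => fderiv ℝ (fun z => u z i j) z Complex.I + wy z i j,
    fun i j => ⟨(hH1 i j).add hD hb (hw i j).1.isH1, ?_, ?_, hg2 i j⟩⟩
  · have := (hlu i j).add hD hb (hw i j).2 (ix i j) (iy i j) (id i j) (iwx i j) (iwy i j)
      (iwd i j)
    rwa [hsum] at this
  · exact ⟨fun z => u z i j, hu1 i j, fun _ _ => rfl, (hw i j).1.congr
      (Eventually.of_forall fun z => by simp) (Eventually.of_forall fun z => by simp)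
      (Eventually.of_forall fun z => by simp)⟩

theorem isDtN_dtn {v f : ℂ → Matrix (Fin n) (Fin n) ℂ} (h : ∃ g, IsDtN D v f g) :
    IsDtN D v f (dtn D v f) := by
  rw [dtn, dif_pos h]
  exact h.choose_spec

/-! ### Green's identity for the Dirichlet-to-Neumann image -/

theorem integrable_mul_arcLength (hD : IsOpen D) (hb : Bornology.IsBounded D)
    (hC : HasC2Boundary D) {U g : ℂ → ℂ} (hU : ContinuousOn U (closure D))
    (hg : Integrable g (arcLength D)) : Integrable (fun z => U z * g z) (arcLength D) := by
  obtain ⟨M, hM⟩ := hb.isCompact_closure.exists_bound_of_continuousOn hU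
  refine hg.bdd_mul (c := M) (integrable_arcLength hD hb hC hU).aestronglyMeasurable ?_
  filter_upwards [ae_restrict_mem isClosed_frontier.measurableSet] with z hz
    using hM z (frontier_subset_closure hz)

theorem HasNormalDeriv.integral_mul (hD : IsOpen D) (hb : Bornology.IsBounded D)
    (hC : HasC2Boundary D) {a b d g : ℂ → ℂ} (h : HasNormalDeriv D a b d g)
    (ia : IntegrableOn a D) (ib : IntegrableOn b D) (id : IntegrableOn d D)
    (ig : Integrable g (arcLength D)) {U : ℂ → ℂ} (hU : ContDiffOn ℝ 1 U (closure D)) :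
    ∫ z, U z * g z ∂(arcLength D) =
      ∫ z in D, (fderiv ℝ U z 1 * a z + fderiv ℝ U z Complex.I * b z + U z * d z) := by
  have hR : ContDiffOn ℝ 1 (fun z => (U z).re) (closure D) :=
    Complex.reCLM.contDiff.comp_contDiffOn hU
  have hI : ContDiffOn ℝ 1 (fun z => (U z).im) (closure D) :=
    Complex.imCLM.contDiff.comp_contDiffOn hU
  have i1 : Integrable (fun z => (U z).re • g z) (arcLength D) := by
    simpa using integrable_mul_arcLength hD hb hC
      (Complex.continuous_ofReal.comp_continuousOn hR.continuousOn) ig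
  have i2 : Integrable (fun z => (U z).im • g z) (arcLength D) := by
    simpa using integrable_mul_arcLength hD hb hC
      (Complex.continuous_ofReal.comp_continuousOn hI.continuousOn) ig
  have e1 : ∫ z, U z * g z ∂(arcLength D) =
      ∫ z, ((U z).re • g z + Complex.I * ((U z).im • g z)) ∂(arcLength D) := by
    congr 1
    funext z
    rw [Complex.real_smul, Complex.real_smul]
    conv_lhs => rw [← Complex.re_add_im (U z)]
    ring
  have e2 := h _ hR
  have e3 := h _ hI
  rw [e1, integral_add i1 (i2.const_mul _), integral_const_mul, ← e2, ← e3, ← integral_const_mul,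
    ← integral_add (integrableOn_flux hD hb ia ib id hR)
      ((integrableOn_flux hD hb ia ib id hI).const_mul _)]
  refine setIntegral_congr_fun hD.measurableSet fun z hz => ?_
  have hUd := ((hU.mono subset_closure).contDiffAt (hD.mem_nhds hz)).differentiableAt one_ne_zero
  have d1 : ∀ e : ℂ, fderiv ℝ (fun z => (U z).re) z e = (fderiv ℝ U z e).re := fun e => by
    rw [HasFDerivAt.fderiv (f := fun z => (U z).re)
      (Complex.reCLM.hasFDerivAt.comp z hUd.hasFDerivAt)]
    rfl
  have d2 : ∀ e : ℂ, fderiv ℝ (fun z => (U z).im) z e = (fderiv ℝ U z e).im := fun e => by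
    rw [HasFDerivAt.fderiv (f := fun z => (U z).im)
      (Complex.imCLM.hasFDerivAt.comp z hUd.hasFDerivAt)]
    rfl
  rw [d1, d1, d2, d2]
  simp only [Complex.real_smul]
  conv_rhs => rw [← Complex.re_add_im (U z), ← Complex.re_add_im (fderiv ℝ U z 1),
    ← Complex.re_add_im (fderiv ℝ U z Complex.I)]
  ring

/-- The boundary condition provides some `C¹` extension `G` of the data. It differs from `f` by a
function vanishing on `∂D`, which lies in `H₀¹`. -/
theorem HasBoundaryValue.isH10_sub (hD : IsOpen D) (hb : Bornology.IsBounded D)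
    {u ux uy f : ℂ → ℂ} (h : HasBoundaryValue D u ux uy f) (hf : ContDiffOn ℝ 1 f (closure D)) :
    IsH10 D (fun z => u z - f z) (fun z => ux z - fderiv ℝ f z 1)
      (fun z => uy z - fderiv ℝ f z Complex.I) := by
  obtain ⟨G, hG, hGf, hH⟩ := h
  have h1 := isH10_of_eq_zero_on_frontier hD hb (hf.sub hG) fun z hz => by
    simp [hGf hz]
  have hd : ∀ z ∈ D, fderiv ℝ (fun x => f x - G x) z = fderiv ℝ f z - fderiv ℝ G z := fun z hz =>
    fderiv_fun_sub (((hf.mono subset_closure).contDiffAt (hD.mem_nhds hz)).differentiableAt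
      one_ne_zero) (((hG.mono subset_closure).contDiffAt (hD.mem_nhds hz)).differentiableAt
      one_ne_zero)
  refine (hH.sub hD hb h1).congr (Eventually.of_forall fun z => by simp) ?_ ?_
  · filter_upwards [ae_restrict_mem hD.measurableSet] with z hz
    rw [hd z hz]
    simp
  · filter_upwards [ae_restrict_mem hD.measurableSet] with z hz
    rw [hd z hz]
    simp

/-- The bilinear gradient term `∑ₖ ∇(u₂)ₖᵢ · ∇(u₁)ₖⱼ`. -/
noncomputable def gradProd (u₂ u₁ : ℂ → Matrix (Fin n) (Fin n) ℂ) (i j : Fin n) (z : ℂ) : ℂ :=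
  ∑ k, (fderiv ℝ (fun z => u₂ z k i) z 1 * fderiv ℝ (fun z => u₁ z k j) z 1 +
    fderiv ℝ (fun z => u₂ z k i) z Complex.I * fderiv ℝ (fun z => u₁ z k j) z Complex.I)

theorem integrableOn_gradProd (hD : IsOpen D) (hb : Bornology.IsBounded D)
    {u₂ u₁ : ℂ → Matrix (Fin n) (Fin n) ℂ} (hu₂ : IsCk 1 D u₂) (hu₁ : IsCk 1 D u₁) (i j : Fin n) :
    IntegrableOn (gradProd u₂ u₁ i j) D := by
  refine integrable_finsetSum _ fun k _ => Integrable.add ?_ ?_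
  · exact (memLp_fderiv_of_contDiffOn hD hb (hu₂ k i) 1).integrable_mul
      (memLp_fderiv_of_contDiffOn hD hb (hu₁ k j) 1)
  · exact (memLp_fderiv_of_contDiffOn hD hb (hu₂ k i) _).integrable_mul
      (memLp_fderiv_of_contDiffOn hD hb (hu₁ k j) _)

/-- Green's formula is tested with the entries of `u₂`, and from it the equation of `u₂` tested with
`ψ - u₁` is subtracted: `∇ψ` disappears and only zeroth-order terms in `ψ` are left. -/
theorem IsDtN.exists_integral_eq (hD : IsOpen D) (hb : Bornology.IsBounded D)
    (hC : HasC2Boundary D) {v v₂ u₁ u₂ g : ℂ → Matrix (Fin n) (Fin n) ℂ} (hg : IsDtN D v u₁ g)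
    (hv : IsCk 1 D v) (hv₂ : IsCk 1 D v₂) (hu₁ : IsCk 2 D u₁) (hu₂ : IsCk 2 D u₂)
    (heq : ∀ z ∈ D, matLaplacian u₂ z = (v₂ z)ᵀ * u₂ z) :
    ∃ ψ ψx ψy : ℂ → Matrix (Fin n) (Fin n) ℂ, (∀ i j,
      IsH10 D (fun z => ψ z i j - u₁ z i j) (fun z => ψx z i j - fderiv ℝ (fun z => u₁ z i j) z 1)
        (fun z => ψy z i j - fderiv ℝ (fun z => u₁ z i j) z Complex.I) ∧
      IsWeakLaplacian D (fun z => ψx z i j) (fun z => ψy z i j) (fun z => (v z * ψ z) i j) ∧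
      IsH1 D (fun z => ψ z i j) (fun z => ψx z i j) (fun z => ψy z i j)) ∧
      ∀ i j, ∫ z, ((u₂ z)ᵀ * g z) i j ∂(arcLength D) =
        ∫ z in D, (gradProd u₂ u₁ i j z +
          ((u₂ z)ᵀ * (v z * ψ z) - (u₂ z)ᵀ * v₂ z * (ψ z - u₁ z)) i j) := by
  have := isFiniteMeasure_restrict hb
  have := isFiniteMeasure_arcLength hD hb hC
  obtain ⟨hgp, ψ, ψx, ψy, hψ⟩ := hg
  have hu₁1 : ∀ i j, ContDiffOn ℝ 1 (fun z => u₁ z i j) (closure D) := fun i j =>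
    (hu₁ i j).of_le one_le_two
  have hu₂1 : ∀ i j, ContDiffOn ℝ 1 (fun z => u₂ z i j) (closure D) := fun i j =>
    (hu₂ i j).of_le one_le_two
  have hw := fun i j => (hψ i j).2.2.1.isH10_sub hD hb (hu₁1 i j)
  refine ⟨ψ, ψx, ψy, fun i j => ⟨hw i j, (hψ i j).2.1, (hψ i j).1⟩, fun i j => ?_⟩
  have hvt := fun i j => hv.memLp_top hD hb i j ⊤
  have hv₂t : ∀ i j, MemLp (fun z => (v₂ z)ᵀ i j) ⊤ (volume.restrict D) := fun i j =>
    hv₂.memLp_top hD hb j i ⊤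
  have hψ2 := fun i j => (hψ i j).1.memLp
  have hvψ : ∀ i j, MemLp (fun z => (v z * ψ z) i j) 2 (volume.restrict D) := fun i j =>
    memLp_mul_apply hvt hψ2 i j
  have hvu : ∀ i j, MemLp (fun z => ((v₂ z)ᵀ * u₂ z) i j) 2 (volume.restrict D) := fun i j =>
    memLp_mul_apply hv₂t (fun i j => hu₂.memLp_top hD hb i j 2) i j
  have hgi : ∀ i j, Integrable (fun z => g z i j) (arcLength D) := fun i j =>
    (hgp i j 1 ENNReal.one_ne_top).integrable le_rfl
  have hl : ∀ i j, IsWeakLaplacian D (fun z => fderiv ℝ (fun z => u₂ z i j) z 1)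
      (fun z => fderiv ℝ (fun z => u₂ z i j) z Complex.I) (fun z => ((v₂ z)ᵀ * u₂ z) i j) :=
    fun i j => (isWeakLaplacian_of_contDiffOn hD ((hu₂ i j).mono subset_closure)).congr (by
      filter_upwards [ae_restrict_mem hD.measurableSet] with z hz
      rw [← heq z hz]
      rfl)
  have hU := fun i j => isH1_of_contDiffOn hD hb (hu₂1 i j)
  have key : ∀ k, ∫ z, u₂ z k i * g z k j ∂(arcLength D) = ∫ z in D,
      ((fderiv ℝ (fun z => u₂ z k i) z 1 * ψx z k j +
        fderiv ℝ (fun z => u₂ z k i) z Complex.I * ψy z k j + u₂ z k i * (v z * ψ z) k j) -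
      ((ψx z k j - fderiv ℝ (fun z => u₁ z k j) z 1) • fderiv ℝ (fun z => u₂ z k i) z 1 +
        (ψy z k j - fderiv ℝ (fun z => u₁ z k j) z Complex.I) •
          fderiv ℝ (fun z => u₂ z k i) z Complex.I +
        (ψ z k j - u₁ z k j) • ((v₂ z)ᵀ * u₂ z) k i)) := by
    intro k
    have e1 := (hψ k j).2.2.2.integral_mul hD hb hC ((hψ k j).1.memLp_x.integrable one_le_two)
      ((hψ k j).1.memLp_y.integrable one_le_two) ((hvψ k j).integrable one_le_two) (hgi k j)
      (hu₂1 k i)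
    have e2 := (hw k j).integral_eq hD hb (hl k i) (hU k i).memLp_x (hU k i).memLp_y (hvu k i)
    have i1 := integrable_weak (hU k i).memLp_x (hU k i).memLp_y (hU k i).memLp (hψ k j).1.memLp_x
      (hψ k j).1.memLp_y (hvψ k j)
    have i2 := integrable_weak (hw k j).isH1.memLp_x (hw k j).isH1.memLp_y (hw k j).isH1.memLp
      (hU k i).memLp_x (hU k i).memLp_y (hvu k i)
    have e3 := integral_sub i1 i2
    rw [e2, sub_zero] at e3
    rw [e1]
    exact e3.symm
  have hint : ∀ k, IntegrableOn (fun z =>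
      ((fderiv ℝ (fun z => u₂ z k i) z 1 * ψx z k j +
        fderiv ℝ (fun z => u₂ z k i) z Complex.I * ψy z k j + u₂ z k i * (v z * ψ z) k j) -
      ((ψx z k j - fderiv ℝ (fun z => u₁ z k j) z 1) • fderiv ℝ (fun z => u₂ z k i) z 1 +
        (ψy z k j - fderiv ℝ (fun z => u₁ z k j) z Complex.I) •
          fderiv ℝ (fun z => u₂ z k i) z Complex.I +
        (ψ z k j - u₁ z k j) • ((v₂ z)ᵀ * u₂ z) k i))) D := fun k =>
    (integrable_weak (hU k i).memLp_x (hU k i).memLp_y (hU k i).memLp (hψ k j).1.memLp_x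
      (hψ k j).1.memLp_y (hvψ k j)).sub
    (integrable_weak (hw k j).isH1.memLp_x (hw k j).isH1.memLp_y (hw k j).isH1.memLp
      (hU k i).memLp_x (hU k i).memLp_y (hvu k i))
  have eL : ∫ z, ((u₂ z)ᵀ * g z) i j ∂(arcLength D) =
      ∑ k, ∫ z, u₂ z k i * g z k j ∂(arcLength D) := by
    simp only [Matrix.mul_apply, Matrix.transpose_apply]
    exact integral_finsetSum _ fun k _ =>
      integrable_mul_arcLength hD hb hC (hu₂1 k i).continuousOn (hgi k j)
  rw [eL, Finset.sum_congr rfl fun k _ => key k, ← integral_finsetSum _ fun k _ => hint k]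
  congr 1
  funext z
  have m1 : (u₂ z)ᵀ * v₂ z = ((v₂ z)ᵀ * u₂ z)ᵀ := by
    rw [Matrix.transpose_mul, Matrix.transpose_transpose]
  rw [gradProd, Matrix.sub_apply, m1, Matrix.mul_apply (M := (u₂ z)ᵀ),
    Matrix.mul_apply (M := ((v₂ z)ᵀ * u₂ z)ᵀ), ← Finset.sum_sub_distrib, ← Finset.sum_add_distrib]
  refine Finset.sum_congr rfl fun k _ => ?_
  simp only [Matrix.transpose_apply, Matrix.sub_apply, smul_eq_mul]
  ring

end

/-! ### Comparison of two solutions and integrability of the volume terms -/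

section

/-- The plane is connected and unbounded, so a bounded nonempty set is not clopen. -/
theorem frontier_nonempty {D : Set ℂ} (hb : Bornology.IsBounded D) (hne : D.Nonempty) :
    (frontier D).Nonempty := by
  by_contra h
  have h1 := isClopen_iff_frontier_eq_empty.2 (not_nonempty_iff_eq_empty.1 h)
  rcases isClopen_iff.1 h1 with h2 | h2
  · exact hne.ne_empty h2
  · rw [h2] at hb
    exact NormedSpace.unbounded_univ ℝ ℂ hb

theorem IsWeakLaplacian.neg {D : Set ℂ} {a b d : ℂ → ℂ} (h : IsWeakLaplacian D a b d) :
    IsWeakLaplacian D (fun z => -a z) (fun z => -b z) (fun z => -d z) := by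
  intro φ hφ
  rw [← neg_eq_zero, ← integral_neg, ← h φ hφ]
  congr 1
  funext z
  module

/-- A difference of two solutions of `-Δψ + vψ = 0` solves the same equation. -/
theorem isWeakLaplacian_mul_sub {n : ℕ} {D : Set ℂ} (hD : IsOpen D) (hb : Bornology.IsBounded D)
    {v ψ ψx ψy u : ℂ → Matrix (Fin n) (Fin n) ℂ} (hv : IsCk 1 D v) (hu : IsCk 2 D u)
    (heq : ∀ z ∈ D, matLaplacian u z = v z * u z)
    (hH : ∀ i j, IsH1 D (fun z => ψ z i j) (fun z => ψx z i j) (fun z => ψy z i j))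
    (hl : ∀ i j, IsWeakLaplacian D (fun z => ψx z i j) (fun z => ψy z i j)
      (fun z => (v z * ψ z) i j)) (i j : Fin n) :
    IsWeakLaplacian D (fun z => ψx z i j - fderiv ℝ (fun z => u z i j) z 1)
      (fun z => ψy z i j - fderiv ℝ (fun z => u z i j) z Complex.I)
      (fun z => (v z * (ψ z - u z)) i j) := by
  have := isFiniteMeasure_restrict hb
  have hvt := fun i j => hv.memLp_top hD hb i j ⊤
  have hu1 := isH1_of_contDiffOn hD hb ((hu i j).of_le one_le_two)
  have hlu : IsWeakLaplacian D (fun z => fderiv ℝ (fun z => u z i j) z 1)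
      (fun z => fderiv ℝ (fun z => u z i j) z Complex.I) (fun z => (v z * u z) i j) :=
    (isWeakLaplacian_of_contDiffOn hD ((hu i j).mono subset_closure)).congr (by
      filter_upwards [ae_restrict_mem hD.measurableSet] with z hz
      rw [← heq z hz]
      rfl)
  have hvu := memLp_mul_apply hvt (fun i j => hu.memLp_top hD hb i j 2) i j
  have hvψ := memLp_mul_apply hvt (fun i j => (hH i j).memLp) i j
  have key := (hl i j).add hD hb hlu.neg ((hH i j).memLp_x.integrable one_le_two)
    ((hH i j).memLp_y.integrable one_le_two) (hvψ.integrable one_le_two)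
    (hu1.memLp_x.integrable one_le_two).neg (hu1.memLp_y.integrable one_le_two).neg
    (hvu.integrable one_le_two).neg
  have e : (fun z => (v z * (ψ z - u z)) i j) =
      fun z => (v z * ψ z) i j + -(v z * u z) i j := by
    funext z
    rw [mul_sub, Matrix.sub_apply, sub_eq_add_neg]
  rw [e]
  simpa only [sub_eq_add_neg] using key

theorem IsCk.integrableOn_mul_mul {n : ℕ} {D : Set ℂ} (hD : IsOpen D)
    (hb : Bornology.IsBounded D) {u v w : ℂ → Matrix (Fin n) (Fin n) ℂ} {k l m : ℕ}
    (hu : IsCk k D u) (hv : IsCk l D v) (hw : IsCk m D w) (i j : Fin n) :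
    IntegrableOn (fun z => ((u z)ᵀ * v z * w z) i j) D := by
  have := isFiniteMeasure_restrict hb
  have h1 : ∀ i j, MemLp (fun z => (u z)ᵀ i j) ⊤ (volume.restrict D) := fun i j =>
    hu.memLp_top hD hb j i ⊤
  exact (memLp_mul_apply (v := fun z => (u z)ᵀ * v z)
    (memLp_mul_apply h1 fun i j => hv.memLp_top hD hb i j ⊤)
    (fun i j => hw.memLp_top hD hb i j ⊤) i j).integrable le_top

end

end Alessandrini

/-! ### The two statements -/

open Alessandrini in
theorem mainTheorem3 (n : ℕ) (D : Set ℂ) (hD_open : IsOpen D) (hD_conn : IsConnected D)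
    (hD_bdd : Bornology.IsBounded D) (hD_C2 : Alessandrini.HasC2Boundary D) :
    (∀ v : ℂ → Matrix (Fin n) (Fin n) ℂ, Alessandrini.IsCk 1 D v →
      Alessandrini.ZeroNotDirichletEigenvalue D v →
      Alessandrini.ZeroNotDirichletEigenvalue D (fun z => (v z)ᵀ)) ∧
    (∀ v₁ v₂ u₁ u₂ : ℂ → Matrix (Fin n) (Fin n) ℂ,
      Alessandrini.IsCk 1 D v₁ → Alessandrini.IsCk 1 D v₂ →
      Alessandrini.ZeroNotDirichletEigenvalue D v₁ →
      Alessandrini.ZeroNotDirichletEigenvalue D v₂ →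
      Alessandrini.IsCk 2 D u₁ → Alessandrini.IsCk 2 D u₂ →
      (∀ z ∈ D, -Alessandrini.matLaplacian u₁ z + v₁ z * u₁ z = 0) →
      (∀ z ∈ D, -Alessandrini.matLaplacian u₂ z + (v₂ z)ᵀ * u₂ z = 0) →
      Alessandrini.IsDtN D v₁ u₁ (Alessandrini.dtn D v₁ u₁) ∧
      Alessandrini.IsDtN D v₂ u₁ (Alessandrini.dtn D v₂ u₁) ∧
      Alessandrini.MatIntegrable (fun z => (u₂ z)ᵀ *
        (Alessandrini.dtn D v₂ u₁ z - Alessandrini.dtn D v₁ u₁ z)) (Alessandrini.arcLength D) ∧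
      Alessandrini.MatIntegrable (fun z => (u₂ z)ᵀ * (v₂ z - v₁ z) * u₁ z)
        (volume.restrict D) ∧
      Alessandrini.matIntegral (fun z => (u₂ z)ᵀ *
        (Alessandrini.dtn D v₂ u₁ z - Alessandrini.dtn D v₁ u₁ z)) (Alessandrini.arcLength D) =
      Alessandrini.matIntegral (fun z => (u₂ z)ᵀ * (v₂ z - v₁ z) * u₁ z)
        (volume.restrict D)) := by
  refine ⟨fun v hv hdir => hdir.transpose hD_open hD_bdd
    fun i j => hv.memLp_top hD_open hD_bdd i j ⊤, ?_⟩
  intro v₁ v₂ u₁ u₂ hv₁ hv₂ hdir₁ hdir₂ hu₁ hu₂ heq₁ heq₂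
  have hfr := frontier_nonempty hD_bdd hD_conn.nonempty
  have heq₁' : ∀ z ∈ D, matLaplacian u₁ z = v₁ z * u₁ z := fun z hz =>
    (neg_add_eq_zero.1 (heq₁ z hz))
  have heq₂' : ∀ z ∈ D, matLaplacian u₂ z = (v₂ z)ᵀ * u₂ z := fun z hz =>
    (neg_add_eq_zero.1 (heq₂ z hz))
  have hd₁ := isDtN_dtn (exists_isDtN hD_open hD_bdd hD_C2 hfr hv₁ hv₁ hdir₁ hu₁ heq₁')
  -- `u₁` solves the equation of `v₁`, not of `v₂`; here it only supplies the boundary values.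
  have hd₂ := isDtN_dtn (exists_isDtN hD_open hD_bdd hD_C2 hfr hv₂ hv₁ hdir₂ hu₁ heq₁')
  set g₁ := dtn D v₁ u₁
  set g₂ := dtn D v₂ u₁
  have := isFiniteMeasure_arcLength hD_open hD_bdd hD_C2
  have := isFiniteMeasure_restrict hD_bdd
  have hgi : ∀ {v g : ℂ → Matrix (Fin n) (Fin n) ℂ}, IsDtN D v u₁ g → ∀ i j,
      Integrable (fun z => ((u₂ z)ᵀ * g z) i j) (arcLength D) := by
    intro v g hg i j
    simp only [Matrix.mul_apply, Matrix.transpose_apply]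
    exact integrable_finsetSum _ fun k _ => integrable_mul_arcLength hD_open hD_bdd hD_C2
      (hu₂ k i).continuousOn ((hg.1 k j 1 ENNReal.one_ne_top).integrable le_rfl)
  have hsplit : ∀ i j, (fun z => ((u₂ z)ᵀ * (g₂ z - g₁ z)) i j) =
      fun z => ((u₂ z)ᵀ * g₂ z) i j - ((u₂ z)ᵀ * g₁ z) i j := fun i j => by
    funext z
    rw [mul_sub, Matrix.sub_apply]
  have hA : ∀ {v : ℂ → Matrix (Fin n) (Fin n) ℂ}, IsCk 1 D v → ∀ i j,
      IntegrableOn (fun z => ((u₂ z)ᵀ * v z * u₁ z) i j) D := fun hv i j =>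
    hu₂.integrableOn_mul_mul hD_open hD_bdd hv hu₁ i j
  have hE : ∀ i j, IntegrableOn (gradProd u₂ u₁ i j) D := fun i j =>
    integrableOn_gradProd hD_open hD_bdd (fun i j => (hu₂ i j).of_le one_le_two)
      (fun i j => (hu₁ i j).of_le one_le_two) i j
  have hsplit' : ∀ i j, (fun z => ((u₂ z)ᵀ * (v₂ z - v₁ z) * u₁ z) i j) =
      fun z => ((u₂ z)ᵀ * v₂ z * u₁ z) i j - ((u₂ z)ᵀ * v₁ z * u₁ z) i j := fun i j => by
    funext z
    rw [mul_sub, sub_mul, Matrix.sub_apply]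
  refine ⟨hd₁, hd₂, fun i j => ?_, fun i j => ?_, ?_⟩
  · rw [hsplit]
    exact (hgi hd₂ i j).sub (hgi hd₁ i j)
  · rw [hsplit']
    exact (hA hv₂ i j).sub (hA hv₁ i j)
  -- With the same potential in both equations the terms in `ψ` cancel identically, so `ψ` need not
  -- be known.
  have green₂ : ∀ i j, ∫ z, ((u₂ z)ᵀ * g₂ z) i j ∂(arcLength D) =
      ∫ z in D, (gradProd u₂ u₁ i j z + ((u₂ z)ᵀ * v₂ z * u₁ z) i j) := by
    obtain ⟨ψ, ψx, ψy, -, h⟩ := hd₂.exists_integral_eq hD_open hD_bdd hD_C2 hv₂ hv₂ hu₁ hu₂ heq₂'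
    intro i j
    rw [h]
    congr 1
    funext z
    rw [mul_sub, mul_assoc, mul_assoc, sub_sub_cancel]
  have green₁ : ∀ i j, ∫ z, ((u₂ z)ᵀ * g₁ z) i j ∂(arcLength D) =
      ∫ z in D, (gradProd u₂ u₁ i j z + ((u₂ z)ᵀ * v₁ z * u₁ z) i j) := by
    obtain ⟨ψ, ψx, ψy, hψ, h⟩ :=
      hd₁.exists_integral_eq hD_open hD_bdd hD_C2 hv₁ hv₂ hu₁ hu₂ heq₂'
    -- Here `ψ` and `u₁` solve the same equation with the same boundary values, so the Dirichlet
    -- condition identifies them.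
    have hzero := hdir₁ (fun z => ψ z - u₁ z)
      (fun z => Matrix.of fun i j => ψx z i j - fderiv ℝ (fun z => u₁ z i j) z 1)
      (fun z => Matrix.of fun i j => ψy z i j - fderiv ℝ (fun z => u₁ z i j) z Complex.I)
      (fun i j => (hψ i j).1) (isWeakLaplacian_mul_sub hD_open hD_bdd hv₁ hu₁ heq₁'
        (fun i j => (hψ i j).2.2) fun i j => (hψ i j).2.1)
    intro i j
    rw [h]
    refine integral_congr_ae ?_
    filter_upwards [hzero] with z hz
    rw [hz, mul_zero, sub_zero, sub_eq_zero.1 hz, mul_assoc]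
  ext i j
  simp only [matIntegral, Matrix.of_apply]
  rw [hsplit, hsplit', integral_sub (hgi hd₂ i j) (hgi hd₁ i j),
    integral_sub (hA hv₂ i j) (hA hv₁ i j), green₁, green₂, integral_add (hE i j) (hA hv₂ i j),
    integral_add (hE i j) (hA hv₁ i j)]
  ring
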